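/- **Theorem 1.6.** Fix an integer $k>1$ and a real $\alpha\ge 1$. There is a real $\gamma=\gamma(k,\alpha)>0$ such that the following holds. Let $m>1$ be an integer and let $H$ be either the complete $k$-uniform hypergraph on a set $V$ with $|V|=km$ (its edges are all $k$-subsets of $V$), or a complete $k$-partite hypergraph on $V$ (where $V=V_1\cup\dots\cup V_k$ is a disjoint union with $|V_1|=\dots=|V_k|=m$, and the edges are all $S\subset V$ with $|S\cap V_i|=1$ for every $i$). Let $W=\{w_S : S\in H\}$ be an $\alpha$-balanced weight on $H$, that is, $w_S>0$ and $w_{S}/w_{T}\le\alpha$ for all $S,T\in H$. Let $$P_H(W)=\sum w_{S_1}\cdots w_{S_m},$$ where the sum is over all perfect matchings $\{S_1,\dots,S_m\}$ of $H$ (sets of pairwise disjoint edges with union $V$). Let $\Omega_k(H)$ be the set of the $k$-stochastic weights on $H$, that is, of all $X=\{x_S\ge 0: S\in H\}$ with $\sum_{S\ni v}x_S=1$ for every $v\in V$, and let $$f_W(X)=\sum_{S\in H}x_S\ln\frac{x_S}{w_S}\qquad(0\ln 0=0).$$ 1. The set $\Omega_k(H)$ is convex, $f_W$ is strictly convex on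 it and attains its minimum $\zeta=\min_{X\in\Omega_k(H)}f_W(X)$, and $$e^{-\zeta-m(k-1)}\,m^{-\gamma}\ \le\ P_H(W)\ \le\ e^{-\zeta-m(k-1)}\,m^{\gamma}.$$ 2. $P_H(W)$ can be approximated within a polynomial factor in polynomial time. That is, for fixed $k$ and $\alpha$ there are one program for a random access machine with exact arithmetic and an integer $C$ such that, for all $m$, $H$ and $W$ as above, the program, given $m$ and the array of the weights $w_{\{v_1,\dots,v_k\}}$ (with $0$ in place of the weight where $\{v_1,\dots,v_k\}\notin H$), with the vertices labelled in any order, halts after at most $C m^{C}$ steps with an output $\eta$ such that $$\eta\, m^{-\gamma}\ \le\ P_H(W)\ \le\ \eta\, m^{\gamma}.$$ The steps are $+,-,\times,/$ and comparison of real numbers, and setting, addition, truncated subtraction and comparison of nonnegative integer counters, which serve as addresses and can be copied into real cells, together with the control steps. Moreover, if all $w_S$ are rational with numerators and denominators at most $2^{L}$, then all counters that occur in the computation are at most $2^{C(m+L)^{C}}$, and all numbers in the real cells are rational with numerators and denominators at most $2^{C(m+L)^{C}}$ in absolute value. -/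

import Mathlib

noncomputable section

open Classical in
/-- The complete `k`-uniform hypergraph on the vertex set `V`: all `k`-subsets are edges. -/
def IsCompleteUniform {V : Type*} (k : ℕ) (H : Finset (Finset V)) : Prop :=
  ∀ S : Finset V, S ∈ H ↔ S.card = k

open Classical in
/-- A complete `k`-partite hypergraph with parts of size `m`: the vertex set is the disjoint union
of `k` parts with `m` vertices each, and the edges are the sets with exactly one vertex in each
part. -/
def IsCompletePartite {V : Type*} (k m : ℕ) (H : Finset (Finset V)) : Prop :=
  ∃ part : Fin k → Finset V,
    (∀ i j, i ≠ j → Disjoint (part i) (part j)) ∧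
    (∀ v, ∃ i, v ∈ part i) ∧
    (∀ i, (part i).card = m) ∧
    ∀ S : Finset V, S ∈ H ↔ ∀ i, (S ∩ part i).card = 1

/-- A perfect matching of `H`: a set of pairwise disjoint edges that covers all vertices. -/
def IsPerfectMatching {V : Type*} {H : Finset (Finset V)} (M : Finset {S // S ∈ H}) : Prop :=
  (∀ S ∈ M, ∀ T ∈ M, S ≠ T → Disjoint S.1 T.1) ∧ ∀ v : V, ∃ S ∈ M, v ∈ S.1

open Classical in
/-- The partition function of perfect matchings,
the sum of `w_{S_1} ⋯ w_{S_m}` over all perfect matchings `{S_1, …, S_m}` of `H`. -/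
def partitionFunction {V : Type*} {H : Finset (Finset V)} (W : {S // S ∈ H} → ℝ) : ℝ :=
  ∑ M : Finset {S // S ∈ H} with IsPerfectMatching M, ∏ S ∈ M, W S

/-- A positive weight any two values of which have ratio at most `α`. -/
def IsBalanced {V : Type*} {H : Finset (Finset V)} (α : ℝ) (W : {S // S ∈ H} → ℝ) : Prop :=
  (∀ S, 0 < W S) ∧ ∀ S T, W S / W T ≤ α

open Classical in
/-- The set `Ω_k(H)` of the `k`-stochastic weights on `H`: nonnegative weights such that, for every
vertex, the weights of the edges containing it add up to `1`. -/
def stochasticWeights {V : Type*} (H : Finset (Finset V)) : Set ({S // S ∈ H} → ℝ) :=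
  {X | (∀ S, 0 ≤ X S) ∧ ∀ v : V, ∑ S : {S // S ∈ H} with v ∈ S.1, X S = 1}

/-- The function `f_W(X) = ∑ x_S ln (x_S / w_S)`, where `0 ln 0 = 0`. -/
def entropyFun {V : Type*} {H : Finset (Finset V)} (W X : {S // S ∈ H} → ℝ) : ℝ :=
  ∑ S, X S * Real.log (X S / W S)

/-! ### A random access machine for real arithmetic

The machine has integer counters, which serve as addresses and can only be set, added, subtracted
and compared, and an array of numerical cells, addressed through the counters, with the four
exact arithmetic operations and comparison. There is no rounding, and a program contains no
real constants. -/

/-- The four arithmetic operations. -/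
inductive ArithOp
  | add
  | sub
  | mul
  | div

/-- The value of an arithmetic operation (`ArithOp.div` is never executed with divisor `0`). -/
def ArithOp.eval : ArithOp → ℝ → ℝ → ℝ
  | .add, x, y => x + y
  | .sub, x, y => x - y
  | .mul, x, y => x * y
  | .div, x, y => x / y

/-- Programs. Here `c_i` is the `i`-th counter and `r[a]` is the numerical cell with address `a`. -/
inductive Program
  /-- `c_i := n` -/
  | setCounter (i n : ℕ)
  /-- `c_i := c_j + c_l` -/
  | addCounter (i j l : ℕ)
  /-- `c_i := max (c_j - c_l) 0` -/
  | subCounter (i j l : ℕ)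
  /-- `r[c_i] := c_j` -/
  | fromCounter (i j : ℕ)
  /-- `r[c_i] := r[c_j] op r[c_l]` -/
  | arith (op : ArithOp) (i j l : ℕ)
  /-- do nothing -/
  | skip
  /-- first `p`, then `q` -/
  | seq (p q : Program)
  /-- if `c_i < c_j` then `p` else `q` -/
  | ifCounterLt (i j : ℕ) (p q : Program)
  /-- if `r[c_i] < r[c_j]` then `p` else `q` -/
  | ifLt (i j : ℕ) (p q : Program)
  /-- while `c_i < c_j` do `p` -/
  | whileCounterLt (i j : ℕ) (p : Program)

/-- The contents of the memory. -/
structure Memory where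
  /-- the counters -/
  counter : ℕ → ℕ
  /-- the numerical cells -/
  cell : ℕ → ℝ

/-- A configuration: the programs that remain to be executed, in this order, and the memory. -/
structure Config where
  /-- what remains to be executed -/
  todo : List Program
  /-- the memory -/
  mem : Memory

open Classical in
/-- One step of the machine. The machine has halted when nothing remains to be executed; at a
division by zero it gets stuck and never halts. -/
def Config.step : Config → Config
  | ⟨[], s⟩ => ⟨[], s⟩
  | ⟨.setCounter i n :: ps, s⟩ => ⟨ps, Function.update s.counter i n, s.cell⟩
  | ⟨.addCounter i j l :: ps, s⟩ =>
      ⟨ps, Function.update s.counter i (s.counter j + s.counter l), s.cell⟩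
  | ⟨.subCounter i j l :: ps, s⟩ =>
      ⟨ps, Function.update s.counter i (s.counter j - s.counter l), s.cell⟩
  | ⟨.fromCounter i j :: ps, s⟩ =>
      ⟨ps, s.counter, Function.update s.cell (s.counter i) (s.counter j : ℝ)⟩
  | ⟨.arith op i j l :: ps, s⟩ =>
      if op = .div ∧ s.cell (s.counter l) = 0 then ⟨.arith op i j l :: ps, s⟩
      else ⟨ps, s.counter, Function.update s.cell (s.counter i)
        (op.eval (s.cell (s.counter j)) (s.cell (s.counter l)))⟩
  | ⟨.skip :: ps, s⟩ => ⟨ps, s⟩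
  | ⟨.seq p q :: ps, s⟩ => ⟨p :: q :: ps, s⟩
  | ⟨.ifCounterLt i j p q :: ps, s⟩ =>
      ⟨(if s.counter i < s.counter j then p else q) :: ps, s⟩
  | ⟨.ifLt i j p q :: ps, s⟩ =>
      ⟨(if s.cell (s.counter i) < s.cell (s.counter j) then p else q) :: ps, s⟩
  | ⟨.whileCounterLt i j p :: ps, s⟩ =>
      if s.counter i < s.counter j then ⟨p :: .whileCounterLt i j p :: ps, s⟩ else ⟨ps, s⟩

/-- The configuration of the machine after `t` steps of the program `p` from the memory `s`. -/
def Program.run (p : Program) (s : Memory) (t : ℕ) : Config :=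
  Config.step^[t] ⟨[p], s⟩

open Classical in
/-- The weight `W` as an array: for a list `(v_1, …, v_k)` of (labels of) vertices, the weight of
`{v_1, …, v_k}` if this is an edge, and `0` otherwise. -/
def weightArray {V : Type*} {n : ℕ} (k : ℕ) {H : Finset (Finset V)} (W : {S // S ∈ H} → ℝ)
    (label : Fin n ≃ V) (v : Fin k → Fin n) : ℝ :=
  if h : Finset.univ.image (fun i => label (v i)) ∈ H then W ⟨_, h⟩ else 0

/-- The input to the machine: counter `0` holds `m` and, with `n = k m`, the entry `(v_1, …, v_k)`
of the array of weights is in the cell with address `v_1 + v_2 n + ⋯ + v_k n ^ (k - 1)`.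
Everything else is `0`. -/
def inputMemory {V : Type*} (k m : ℕ) {H : Finset (Finset V)} (W : {S // S ∈ H} → ℝ)
    (label : Fin (k * m) ≃ V) : Memory where
  counter i := if i = 0 then m else 0
  cell a := if h : a < (k * m) ^ k then
    weightArray k W label (finFunctionFinEquiv.symm ⟨a, h⟩) else 0

/-- `x` is a rational number that can be written with numerator and denominator at most `2 ^ L` in
absolute value. -/
def HasBitSize (L : ℕ) (x : ℝ) : Prop :=
  ∃ (p : ℤ) (q : ℕ), 0 < q ∧ x = p / q ∧ |p| ≤ 2 ^ L ∧ q ≤ 2 ^ L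

end

/-!
# Perfect matchings in balanced hypergraphs and the entropy minimum

A complete uniform or complete partite hypergraph is determined by a coloring of the vertices and by
the number `κ i` of vertices of each color `i` in an edge (`exists_profile`). A positive weight `w` on
such a hypergraph has a scaling `x_S = w_S ∏_{v ∈ S} l_v` that is stochastic (`exists_scaling`). By
duality, this scaling is the minimizer of the relative entropy, the minimum is `ζ = ∑_v log l_v`, and
scaling multiplies the partition function by `∏_v l_v = exp ζ`. So the bounds to be proved say that the
partition function of a stochastic scaling of a balanced weight is `exp (-m (k - 1))` up to a
polynomial factor (`abs_log_matchingSum_le`).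

This goes by induction on `m`. Since the weight `w` is balanced, exchanging vertices of the same color
shows that the scaling factors of such vertices have bounded ratio, and hence that `x` is balanced with
a constant `β` that does not depend on `m` (`scaled_balanced`). Expanding the partition function along
a vertex `v` writes it as an average, with weights `x_S` for the edges `S` at `v`, of the partition
functions of `x` on the hypergraphs without the vertices of `S`. As `x` is balanced, the restricted
weight has row sums `1 - O(1 / m)` and total weight `m - k + O(1 / m)`, while it should have total
weight `m - 1`. The minimum of the relative entropy is stable (`sum_log_scaling_le_of_near`: the error
is quadratic in the deviation of the row sums, because a defect can be corrected by a small signed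
weight, `exists_correction`), so the factors that make the restricted weight stochastic have
product `exp (k - 1 + O(1 / m))` (`removal_scaling`). The errors `O(1 / m)` add up to `O(log m)`.

The same stability shows that any scaling with row sums within `O(1 / m)` of `1` determines the
partition function up to a polynomial factor (`abs_log_matchingSum_add_le`). The program finds one by
coordinate ascent for the dual problem: it visits the vertices in turn and multiplies a scaling factor
by `1 ± τ` if the row sum is off by more than `2 τ`, where `τ` is of order `1 / m`. Every such update
raises the dual objective function by a fixed multiple of `τ ^ 2`, whereas it can rise by at most
`m log α` (`sum_log_sub_le`); so `O(m ^ 3)` sweeps suffice (`scaledRow_scaleRounds`). As an update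
multiplies the numbers by at most one of two fixed rational numbers, their bit sizes grow linearly in
the number of updates (`bitCost_scaleSweep`). Programs are analyzed by a logic of triples that bounds
the running time and confines all cells to a given set of numbers (`Program.Within`); the choice of
this set as the numbers of small bit size gives the bounds on the bit sizes.
-/


set_option linter.unusedSectionVars false
open Finset

/-! ### Hypergraphs given by a coloring and a profile -/

section Combinatorics
variable {V ι : Type*} [DecidableEq V] [DecidableEq ι] [Fintype ι]

/-- The hypergraph on `U` whose edges are the sets with exactly `κ i` vertices of each color `i`. One
color gives complete uniform hypergraphs, and `κ = 1` gives complete partite ones, so that both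
families can be treated at once; removing the vertices of an edge keeps the coloring and the profile. -/
def profileEdges (c : V → ι) (κ : ι → ℕ) (U : Finset V) : Finset (Finset V) :=
  {S ∈ U.powerset | ∀ i, #{v ∈ S | c v = i} = κ i}

/-- The numbers of vertices of each color in `U` are those of a union of `m` disjoint edges. -/
def HasOrder (c : V → ι) (κ : ι → ℕ) (U : Finset V) (m : ℕ) : Prop :=
  ∀ i, #{v ∈ U | c v = i} = κ i * m

/-- The sum of the weights of the edges that contain `v`. -/
def rowSum (E : Finset (Finset V)) (x : Finset V → ℝ) (v : V) : ℝ := ∑ S ∈ E with v ∈ S, x S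

/-- The image of `S` under the transposition of `u` and `v`. If these have the same color, it maps edges
to edges, which is all the symmetry of the hypergraph that is used. -/
def swapVertices (u v : V) (S : Finset V) : Finset V := S.map (Equiv.swap u v).toEmbedding

variable {c : V → ι} {κ : ι → ℕ} {U : Finset V} {m : ℕ}

lemma mem_profileEdges {S : Finset V} :
    S ∈ profileEdges c κ U ↔ S ⊆ U ∧ ∀ i, #{v ∈ S | c v = i} = κ i := by
  simp [profileEdges]

lemma subset_of_mem_profileEdges {S : Finset V} (h : S ∈ profileEdges c κ U) : S ⊆ U :=
  (mem_profileEdges.1 h).1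

lemma profileEdges_mono {U' : Finset V} (h : U' ⊆ U) : profileEdges c κ U' ⊆ profileEdges c κ U :=
  fun S hS => mem_profileEdges.2
    ⟨(mem_profileEdges.1 hS).1.trans h, (mem_profileEdges.1 hS).2⟩

lemma card_eq_sum_colors (c : V → ι) (S : Finset V) : #S = ∑ i, #{v ∈ S | c v = i} :=
  card_eq_sum_card_fiberwise (fun _ _ => mem_univ _)

lemma card_of_mem_profileEdges {S : Finset V} (h : S ∈ profileEdges c κ U) : #S = ∑ i, κ i := by
  rw [card_eq_sum_colors c S]
  exact sum_congr rfl fun i _ => (mem_profileEdges.1 h).2 i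

lemma HasOrder.card (h : HasOrder c κ U m) : #U = (∑ i, κ i) * m := by
  rw [card_eq_sum_colors c U, sum_mul]
  exact sum_congr rfl fun i _ => h i

lemma HasOrder.sdiff (h : HasOrder c κ U m) {S : Finset V} (hS : S ∈ profileEdges c κ U) :
    HasOrder c κ (U \ S) (m - 1) := by
  intro i
  have h1 : ({v ∈ U \ S | c v = i} : Finset V) = {v ∈ U | c v = i} \ {v ∈ S | c v = i} := by
    ext v; simp only [mem_filter, mem_sdiff]; tauto
  rw [h1, card_sdiff_of_subset (filter_subset_filter _ (subset_of_mem_profileEdges hS)), h i,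
    (mem_profileEdges.1 hS).2 i, Nat.mul_sub, mul_one]

lemma HasOrder.profileEdges_nonempty (h : HasOrder c κ U m) (hm : 1 ≤ m) :
    (profileEdges c κ U).Nonempty := by
  have h1 : ∀ i, ∃ t ⊆ ({v ∈ U | c v = i} : Finset V), #t = κ i := fun i =>
    exists_subset_card_eq (by rw [h i]; exact Nat.le_mul_of_pos_right _ hm)
  choose t ht htc using h1
  refine ⟨univ.biUnion t, mem_profileEdges.2 ⟨?_, ?_⟩⟩
  · exact biUnion_subset.2 fun i _ => (ht i).trans (filter_subset _ _)
  · intro i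
    rw [← htc i]
    congr 1
    ext v
    simp only [mem_filter, mem_biUnion, mem_univ, true_and]
    constructor
    · rintro ⟨⟨j, hj⟩, hv⟩
      have := (mem_filter.1 (ht j hj)).2
      rw [← hv, this]; exact hj
    · intro hv
      exact ⟨⟨i, hv⟩, (mem_filter.1 (ht i hv)).2⟩

lemma HasOrder.profileEdges_one (h : HasOrder c κ U 1) : profileEdges c κ U = {U} := by
  ext S
  rw [mem_singleton]
  constructor
  · intro hS
    refine eq_of_subset_of_card_le (subset_of_mem_profileEdges hS) ?_
    rw [card_of_mem_profileEdges hS, h.card, mul_one]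
  · rintro rfl
    exact mem_profileEdges.2 ⟨subset_rfl, fun i => by rw [h i, mul_one]⟩

lemma mem_swapVertices {u v a : V} {S : Finset V} :
    a ∈ swapVertices u v S ↔ Equiv.swap u v a ∈ S := by
  simp [swapVertices, mem_map_equiv]

lemma swapVertices_swapVertices (u v : V) (S : Finset V) :
    swapVertices u v (swapVertices u v S) = S := by
  ext a; simp [mem_swapVertices]

lemma swapVertices_mem {u v : V} (hu : u ∈ U) (hv : v ∈ U) (huv : c u = c v) {S : Finset V}
    (hS : S ∈ profileEdges c κ U) : swapVertices u v S ∈ profileEdges c κ U := by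
  have hc : ∀ a, c (Equiv.swap u v a) = c a := by
    intro a
    rw [Equiv.swap_apply_def]; split_ifs with h1 h2 <;> simp_all
  rw [mem_profileEdges] at hS ⊢
  refine ⟨fun a ha => ?_, fun i => ?_⟩
  · have := hS.1 (mem_swapVertices.1 ha)
    rw [Equiv.swap_apply_def] at this
    split_ifs at this with h1 h2 <;> simp_all
  · rw [← hS.2 i, swapVertices, filter_map, card_map]
    congr 2
    ext a
    simp [hc]

lemma sum_swapVertices {u v : V} (hu : u ∈ U) (hv : v ∈ U) (huv : c u = c v)
    (g : Finset V → ℝ) :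
    ∑ S ∈ profileEdges c κ U, g (swapVertices u v S) = ∑ S ∈ profileEdges c κ U, g S :=
  sum_nbij' (swapVertices u v) (swapVertices u v) (fun _ h => swapVertices_mem hu hv huv h)
    (fun _ h => swapVertices_mem hu hv huv h) (fun _ _ => swapVertices_swapVertices _ _ _)
    (fun _ _ => swapVertices_swapVertices _ _ _) (fun _ _ => rfl)

lemma rowSum_eq_of_swap {u v : V} (hu : u ∈ U) (hv : v ∈ U) (huv : c u = c v)
    {x : Finset V → ℝ} (hx : ∀ S, x (swapVertices u v S) = x S) :
    rowSum (profileEdges c κ U) x u = rowSum (profileEdges c κ U) x v := by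
  simp only [rowSum, sum_filter]
  rw [← sum_swapVertices hu hv huv]
  exact sum_congr rfl fun S _ => by simp [mem_swapVertices, hx]

/-- Double counting of the pairs of an edge and a vertex in it. -/
lemma sum_mul_rowSum {E : Finset (Finset V)} (hE : ∀ S ∈ E, S ⊆ U) (x : Finset V → ℝ)
    (a : V → ℝ) :
    ∑ v ∈ U, a v * rowSum E x v = ∑ S ∈ E, x S * ∑ v ∈ S, a v := by
  simp only [rowSum, sum_filter, mul_sum]
  rw [sum_comm]
  refine sum_congr rfl fun S hS => ?_
  have : U ∩ S = S := inter_eq_right.2 (hE S hS)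
  rw [← this, ← filter_mem_eq_inter, sum_filter]
  refine sum_congr rfl fun v hv => ?_
  by_cases h : v ∈ S <;> simp [h, hv, mul_comm]

lemma sum_color_indicator (S : Finset V) (i : ι) :
    ∑ v ∈ S, (if c v = i then (1 : ℝ) else 0) = #{v ∈ S | c v = i} := by
  simp

lemma sum_rowSum_color {E : Finset (Finset V)} (hE : E ⊆ profileEdges c κ U)
    (x : Finset V → ℝ) (i : ι) :
    ∑ v ∈ U with c v = i, rowSum E x v = κ i * ∑ S ∈ E, x S := by
  have := sum_mul_rowSum (fun S hS => subset_of_mem_profileEdges (hE hS)) x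
    (fun v => if c v = i then (1 : ℝ) else 0)
  simp only [ite_mul, one_mul, zero_mul] at this
  rw [sum_filter, this, mul_sum]
  refine sum_congr rfl fun S hS => ?_
  rw [sum_color_indicator, (mem_profileEdges.1 (hE hS)).2 i, mul_comm]

lemma sum_rowSum {E : Finset (Finset V)} (hE : E ⊆ profileEdges c κ U) (x : Finset V → ℝ) :
    ∑ v ∈ U, rowSum E x v = (∑ i, κ i : ℕ) * ∑ S ∈ E, x S := by
  rw [← sum_fiberwise_of_maps_to (fun v _ => mem_univ (c v)), Nat.cast_sum, sum_mul]
  exact sum_congr rfl fun i _ => sum_rowSum_color hE x i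

lemma sum_of_stochastic (h : HasOrder c κ U m) (hk : 0 < ∑ i, κ i) {x : Finset V → ℝ}
    (hx : ∀ v ∈ U, rowSum (profileEdges c κ U) x v = 1) :
    ∑ S ∈ profileEdges c κ U, x S = m := by
  have h1 := sum_rowSum (subset_refl (profileEdges c κ U)) x
  rw [sum_congr rfl hx, sum_const, h.card] at h1
  have h2 : ((∑ i, κ i : ℕ) : ℝ) ≠ 0 := by positivity
  simp only [nsmul_eq_mul, mul_one] at h1
  rw [Nat.cast_mul] at h1
  exact (mul_left_cancel₀ h2 h1).symm

lemma color_pos_of_mem (h : HasOrder c κ U m) {v : V} (hv : v ∈ U) : 0 < κ (c v) * m := by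
  rw [← h (c v)]; exact card_pos.2 ⟨v, by simp [hv]⟩

/-- All vertices lie in equally many edges. -/
lemma order_mul_degree (h : HasOrder c κ U m) {v : V} (hv : v ∈ U) :
    m * rowSum (profileEdges c κ U) (fun _ => 1) v = #(profileEdges c κ U) := by
  have h1 := sum_rowSum_color (subset_refl (profileEdges c κ U)) (fun _ => (1 : ℝ)) (c v)
  have h2 : ∀ u ∈ ({u ∈ U | c u = c v} : Finset V),
      rowSum (profileEdges c κ U) (fun _ => 1) u = rowSum (profileEdges c κ U) (fun _ => 1) v :=
    fun u hu => rowSum_eq_of_swap (mem_filter.1 hu).1 hv (mem_filter.1 hu).2 fun _ => rfl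
  rw [sum_congr rfl h2, sum_const, h (c v)] at h1
  have h3 := color_pos_of_mem h hv
  have h4 : (κ (c v) : ℝ) ≠ 0 := by
    have := Nat.pos_of_mul_pos_right h3
    positivity
  simp only [nsmul_eq_mul, Nat.cast_mul, sum_const, mul_one, mul_assoc] at h1
  exact mul_left_cancel₀ h4 h1

/-- The number of edges that contain both `u` and `v`. -/
def codegree (E : Finset (Finset V)) (u v : V) : ℝ := rowSum E (fun S => if u ∈ S then 1 else 0) v

lemma codegree_self (E : Finset (Finset V)) (u : V) :
    codegree E u u = rowSum E (fun _ => 1) u :=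
  sum_congr rfl fun S hS => by simp [(mem_filter.1 hS).2]

lemma sum_codegree {E : Finset (Finset V)} (hE : ∀ S ∈ E, S ⊆ U) (u : V) (a : V → ℝ) :
    ∑ v ∈ U, a v * codegree E u v = rowSum E (fun S => ∑ v ∈ S, a v) u := by
  unfold codegree
  rw [sum_mul_rowSum hE, rowSum, sum_filter]
  exact sum_congr rfl fun S _ => by simp

lemma codegree_eq_of_swap {w u v : V} (hu : u ∈ U) (hv : v ∈ U) (huv : c u = c v) (hwu : w ≠ u)
    (hwv : w ≠ v) :
    codegree (profileEdges c κ U) w u = codegree (profileEdges c κ U) w v :=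
  rowSum_eq_of_swap hu hv huv fun S => by
    simp [mem_swapVertices, Equiv.swap_apply_of_ne_of_ne hwu hwv]

lemma sum_codegree_color (u : V) (j : ι) :
    ∑ v ∈ U with c v = j, codegree (profileEdges c κ U) u v =
      κ j * rowSum (profileEdges c κ U) (fun _ => 1) u := by
  unfold codegree
  rw [sum_rowSum_color subset_rfl, rowSum, sum_filter]

/-- By symmetry, all vertices other than `u` with the color of `u` have the same codegree with `u`. -/
lemma codegree_same (h : HasOrder c κ U m) {u v : V} (hu : u ∈ U) (hv : v ∈ U) (huv : c u = c v)
    (hne : u ≠ v) :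
    (κ (c u) * m - 1) * codegree (profileEdges c κ U) u v =
      (κ (c u) - 1) * rowSum (profileEdges c κ U) (fun _ => 1) u := by
  have h1 := sum_codegree_color (c := c) (κ := κ) (U := U) u (c u)
  have hu' : u ∈ ({w ∈ U | c w = c u} : Finset V) := by simp [hu]
  rw [← add_sum_erase _ _ hu', codegree_self] at h1
  have h2 : ∀ w ∈ ({w ∈ U | c w = c u} : Finset V).erase u,
      codegree (profileEdges c κ U) u w = codegree (profileEdges c κ U) u v := by
    intro w hw
    simp only [mem_erase, mem_filter] at hw
    exact codegree_eq_of_swap hw.2.1 hv (hw.2.2.trans huv) hw.1.symm hne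
  have hpos := color_pos_of_mem h hu
  rw [sum_congr rfl h2, sum_const, card_erase_of_mem hu', h (c u), nsmul_eq_mul,
    Nat.cast_sub hpos] at h1
  push_cast at h1
  linarith

lemma codegree_diff (h : HasOrder c κ U m) {u v : V} (hv : v ∈ U) (huv : c u ≠ c v) :
    m * codegree (profileEdges c κ U) u v = rowSum (profileEdges c κ U) (fun _ => 1) u := by
  have h1 := sum_codegree_color (c := c) (κ := κ) (U := U) u (c v)
  have h2 : ∀ w ∈ ({w ∈ U | c w = c v} : Finset V),
      codegree (profileEdges c κ U) u w = codegree (profileEdges c κ U) u v := by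
    intro w hw
    simp only [mem_filter] at hw
    exact codegree_eq_of_swap hw.1 hv hw.2 (fun e => huv (by rw [e, hw.2]))
      (fun e => huv (by rw [e]))
  have h3 := color_pos_of_mem h hv
  have h4 : (κ (c v) : ℝ) ≠ 0 := by
    have := Nat.pos_of_mul_pos_right h3
    positivity
  rw [sum_congr rfl h2, sum_const, h (c v)] at h1
  simp only [nsmul_eq_mul, Nat.cast_mul, mul_assoc] at h1
  exact mul_left_cancel₀ h4 h1

lemma degree_nonneg (E : Finset (Finset V)) (v : V) : 0 ≤ rowSum E (fun _ => 1) v :=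
  sum_nonneg fun _ _ => zero_le_one

/-- Two vertices have few common edges: at most a fraction `1 / m` of the edges at one of them. -/
lemma order_mul_codegree_le (h : HasOrder c κ U m) (hm : 1 ≤ m) {u v : V} (hu : u ∈ U)
    (hv : v ∈ U) (hne : u ≠ v) :
    m * codegree (profileEdges c κ U) u v ≤ rowSum (profileEdges c κ U) (fun _ => 1) u := by
  by_cases huv : c u = c v
  · have h1 := codegree_same h hu hv huv hne
    have hd := degree_nonneg (profileEdges c κ U) u
    have hm' : (1 : ℝ) ≤ m := by exact_mod_cast hm
    -- two vertices of one color exist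
    have h2 : 2 ≤ κ (c u) * m := by
      rw [← h (c u), ← card_pair hne]
      exact card_le_card (by intro a ha; simp at ha; rcases ha with rfl | rfl <;> simp [*])
    have h2' : (2 : ℝ) ≤ κ (c u) * m := by exact_mod_cast h2
    by_contra hcon
    push Not at hcon
    have hκ : (1 : ℝ) ≤ κ (c u) := by
      exact_mod_cast Nat.pos_of_ne_zero (by rintro e; simp [e] at h2)
    nlinarith [mul_lt_mul_of_pos_left hcon (by linarith : (0 : ℝ) < κ (c u) * m - 1)]
  · exact (codegree_diff h hv huv).le

lemma card_profileEdges_pos (h : HasOrder c κ U m) (hm : 1 ≤ m) :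
    (0 : ℝ) < #(profileEdges c κ U) := by
  exact_mod_cast card_pos.2 (h.profileEdges_nonempty hm)

/-- Row-sum defects whose sum over every color class is `0` can be repaired by a small signed
weight, namely `z_S = ∑_{v ∈ S} ε_v / D_v`, where `D_v` is the number of edges that contain `v`
but not another given vertex of the same color. -/
lemma exists_correction (h : HasOrder c κ U m) (hm : 2 ≤ m) {ε : V → ℝ} {e : ℝ} (he : 0 ≤ e)
    (hε : ∀ v ∈ U, |ε v| ≤ e) (h0 : ∀ i, ∑ v ∈ U with c v = i, ε v = 0) :
    ∃ z : Finset V → ℝ, (∀ v ∈ U, rowSum (profileEdges c κ U) z v = ε v) ∧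
      ∀ S ∈ profileEdges c κ U,
        |z S| ≤ 2 * (∑ i, κ i : ℕ) * e * (m / #(profileEdges c κ U)) := by
  set E := profileEdges c κ U with hEdef
  have hm1 : 1 ≤ m := by lia
  have hE := card_profileEdges_pos h hm1
  have hm0 : (0 : ℝ) < m := by exact_mod_cast hm1
  have hm2 : (2 : ℝ) ≤ m := by exact_mod_cast hm
  set d : ℝ := #E / m with hd
  have hdpos : 0 < d := div_pos hE hm0
  have hdeg : ∀ v ∈ U, rowSum E (fun _ => 1) v = d := fun v hv => by
    rw [hd, eq_div_iff hm0.ne', mul_comm]; exact order_mul_degree h hv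
  -- the codegree of two vertices of color `i`
  set C : ι → ℝ := fun i => (κ i - 1) * d / (κ i * m - 1) with hC
  have hCle : ∀ v ∈ U, d / 2 ≤ d - C (c v) := by
    intro v hv
    have hκ : 1 ≤ κ (c v) := Nat.pos_of_mul_pos_right (color_pos_of_mem h hv)
    have hκ' : (1 : ℝ) ≤ κ (c v) := by exact_mod_cast hκ
    have hpos : (0 : ℝ) < κ (c v) * m - 1 := by nlinarith
    have : C (c v) ≤ d / 2 := by
      rw [hC]; simp only
      rw [div_le_iff₀ hpos]
      nlinarith [mul_pos hdpos hpos]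
    linarith
  set a : V → ℝ := fun v => ε v / (d - C (c v)) with ha
  have ha0 : ∀ i, ∑ v ∈ U with c v = i, a v = 0 := by
    intro i
    rw [sum_congr rfl (g := fun v => ε v / (d - C i)) fun v hv => by
      rw [ha]; simp only [(mem_filter.1 hv).2], ← sum_div, h0, zero_div]
  have habs : ∀ v ∈ U, |a v| ≤ 2 * e * (m / #E) := by
    intro v hv
    have h1 := hCle v hv
    have h2 : 0 < d - C (c v) := by linarith [half_pos hdpos]
    rw [ha]; simp only
    rw [abs_div, abs_of_pos h2, div_le_iff₀ h2]
    have h3 : (m / #E : ℝ) = 1 / d := by rw [hd]; field_simp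
    rw [h3]
    calc |ε v| ≤ e := hε v hv
      _ = 2 * e * (1 / d) * (d / 2) := by field_simp
      _ ≤ _ := mul_le_mul_of_nonneg_left h1 (by positivity)
  refine ⟨fun S => ∑ v ∈ S, a v, fun v hv => ?_, fun S hS => ?_⟩
  · rw [← sum_codegree (fun S hS => subset_of_mem_profileEdges hS) v a,
      ← sum_fiberwise_of_maps_to (fun w _ => mem_univ (c w))]
    rw [sum_eq_single (c v)]
    · have hv' : v ∈ ({w ∈ U | c w = c v} : Finset V) := by simp [hv]
      have h1 : ∀ w ∈ ({w ∈ U | c w = c v} : Finset V).erase v,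
          a w * codegree E v w = a w * C (c v) := by
        intro w hw
        simp only [mem_erase, mem_filter] at hw
        have h2 := codegree_same h hv hw.2.1 hw.2.2.symm hw.1.symm
        rw [← hEdef, hdeg v hv] at h2
        have hpos : (0 : ℝ) < κ (c v) * m - 1 := by
          have hκ : 1 ≤ κ (c v) := Nat.pos_of_mul_pos_right (color_pos_of_mem h hv)
          have hκ' : (1 : ℝ) ≤ κ (c v) := by exact_mod_cast hκ
          nlinarith
        congr 1
        rw [hC]; simp only
        rw [eq_div_iff hpos.ne', ← h2, mul_comm]
      have h3 := ha0 (c v)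
      rw [← add_sum_erase _ _ hv'] at h3
      rw [← add_sum_erase _ _ hv', sum_congr rfl h1, ← sum_mul, codegree_self, hdeg v hv]
      have h4 : a v * (d - C (c v)) = ε v := by
        rw [ha]; simp only
        have h1 := hCle v hv
        have h2 : 0 < d - C (c v) := by linarith [half_pos hdpos]
        field_simp
      have h5 : ∑ w ∈ ({w ∈ U | c w = c v} : Finset V).erase v, a w = - a v := by linarith
      rw [h5, ← h4]; ring
    · intro j _ hj
      have h1 : ∀ w ∈ ({w ∈ U | c w = j} : Finset V), a w * codegree E v w = a w * (d / m) := by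
        intro w hw
        simp only [mem_filter] at hw
        have h2 := codegree_diff h (u := v) hw.1 (by rw [hw.2]; exact hj.symm)
        rw [← hEdef, hdeg v hv] at h2
        congr 1
        rw [eq_div_iff hm0.ne', ← h2, mul_comm]
      rw [sum_congr rfl h1, ← sum_mul, ha0, zero_mul]
    · simp
  · calc |∑ v ∈ S, a v| ≤ ∑ v ∈ S, |a v| := abs_sum_le_sum_abs _ _
      _ ≤ ∑ v ∈ S, 2 * e * (m / #E) :=
        sum_le_sum fun v hv => habs v (subset_of_mem_profileEdges hS hv)
      _ = _ := by rw [sum_const, card_of_mem_profileEdges hS, nsmul_eq_mul]; ring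

end Combinatorics

/-! ### Sums over perfect matchings -/

section Matchings
variable {V ι : Type*} [DecidableEq V] [DecidableEq ι] [Fintype ι]

/-- The perfect matchings of the hypergraph `profileEdges c κ U`, as sets of subsets of the ambient
vertex set, so that matchings on `U` and on subsets of `U` can be compared. -/
def matchingsOn (c : V → ι) (κ : ι → ℕ) (U : Finset V) : Finset (Finset (Finset V)) :=
  {M ∈ (profileEdges c κ U).powerset |
    (∀ S ∈ M, ∀ T ∈ M, S ≠ T → Disjoint S T) ∧ ∀ v ∈ U, ∃ S ∈ M, v ∈ S}

/-- The partition function of the perfect matchings on `U`. -/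
def matchingSum (c : V → ι) (κ : ι → ℕ) (U : Finset V) (w : Finset V → ℝ) : ℝ :=
  ∑ M ∈ matchingsOn c κ U, ∏ S ∈ M, w S

variable {c : V → ι} {κ : ι → ℕ} {U : Finset V} {m : ℕ}

lemma mem_matchingsOn {M : Finset (Finset V)} : M ∈ matchingsOn c κ U ↔ M ⊆ profileEdges c κ U ∧
    (∀ S ∈ M, ∀ T ∈ M, S ≠ T → Disjoint S T) ∧ ∀ v ∈ U, ∃ S ∈ M, v ∈ S := by
  simp [matchingsOn]

/-- Row expansion: a perfect matching is an edge that contains `v` and a perfect matching of the rest. -/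
lemma matchingSum_eq_sum {v : V} (hv : v ∈ U) (w : Finset V → ℝ) :
    matchingSum c κ U w =
      ∑ S ∈ profileEdges c κ U with v ∈ S, w S * matchingSum c κ (U \ S) w := by
  simp only [matchingSum, mul_sum]
  rw [sum_sigma']
  symm
  have hnot : ∀ S : Finset V, v ∈ S → ∀ M' ∈ matchingsOn c κ (U \ S), S ∉ M' := by
    intro S hS M' hM' hmem
    have := subset_of_mem_profileEdges ((mem_matchingsOn.1 hM').1 hmem) hS
    exact (mem_sdiff.1 this).2 hS
  refine sum_bij (fun p _ => insert p.1 p.2) ?_ ?_ ?_ ?_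
  · rintro ⟨S, M'⟩ h
    simp only [mem_sigma, mem_filter] at h
    obtain ⟨⟨hS, hvS⟩, hM'⟩ := h
    have hM := mem_matchingsOn.1 hM'
    refine mem_matchingsOn.2 ⟨?_, ?_, ?_⟩
    · exact insert_subset hS (hM.1.trans (profileEdges_mono sdiff_subset))
    · have hd : ∀ T ∈ M', Disjoint S T := fun T hT =>
        (disjoint_sdiff).mono_right (subset_of_mem_profileEdges (hM.1 hT))
      intro A hA B hB hAB
      rcases mem_insert.1 hA with rfl | hA <;> rcases mem_insert.1 hB with rfl | hB
      · exact absurd rfl hAB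
      · exact hd B hB
      · exact (hd A hA).symm
      · exact hM.2.1 A hA B hB hAB
    · intro u hu
      by_cases huS : u ∈ S
      · exact ⟨S, mem_insert_self _ _, huS⟩
      · obtain ⟨T, hT, huT⟩ := hM.2.2 u (mem_sdiff.2 ⟨hu, huS⟩)
        exact ⟨T, mem_insert_of_mem hT, huT⟩
  · rintro ⟨S, M⟩ h ⟨S', M'⟩ h' heq
    simp only [mem_sigma, mem_filter] at h h' heq
    have hSS : S = S' := by
      have h1 : S ∈ insert S' M' := heq ▸ mem_insert_self _ _
      rcases mem_insert.1 h1 with h1 | h1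
      · exact h1
      · have := subset_of_mem_profileEdges ((mem_matchingsOn.1 h'.2).1 h1) h.1.2
        exact absurd h'.1.2 (mem_sdiff.1 this).2
    subst hSS
    have : M = M' := by
      rw [← erase_insert (hnot S h.1.2 M h.2), heq, erase_insert (hnot S h.1.2 M' h'.2)]
    rw [this]
  · intro M hM
    have h := mem_matchingsOn.1 hM
    obtain ⟨S, hS, hvS⟩ := h.2.2 v hv
    refine ⟨⟨S, M.erase S⟩, ?_, insert_erase hS⟩
    simp only [mem_sigma, mem_filter]
    refine ⟨⟨h.1 hS, hvS⟩, mem_matchingsOn.2 ⟨?_, ?_, ?_⟩⟩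
    · intro T hT
      rw [mem_erase] at hT
      have hT' := mem_profileEdges.1 (h.1 hT.2)
      refine mem_profileEdges.2 ⟨subset_sdiff.2 ⟨hT'.1, h.2.1 T hT.2 S hS hT.1⟩, hT'.2⟩
    · intro A hA B hB
      exact h.2.1 A (mem_of_mem_erase hA) B (mem_of_mem_erase hB)
    · intro u hu
      rw [mem_sdiff] at hu
      obtain ⟨T, hT, huT⟩ := h.2.2 u hu.1
      exact ⟨T, mem_erase.2 ⟨fun e => hu.2 (e ▸ huT), hT⟩, huT⟩
  · rintro ⟨S, M'⟩ h
    simp only [mem_sigma, mem_filter] at h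
    rw [prod_insert (hnot S h.1.2 M' h.2)]

/-- Scaling the vertices multiplies the partition function by the product of all scaling factors. -/
lemma matchingSum_mul_prod (w : Finset V → ℝ) (l : V → ℝ) :
    matchingSum c κ U (fun S => w S * ∏ v ∈ S, l v) = matchingSum c κ U w * ∏ v ∈ U, l v := by
  rw [matchingSum, matchingSum, sum_mul]
  refine sum_congr rfl fun M hM => ?_
  rw [prod_mul_distrib]
  congr 1
  have h := mem_matchingsOn.1 hM
  have hU : M.biUnion (fun S => S) = U := by
    ext v
    simp only [mem_biUnion]
    exact ⟨fun ⟨S, hS, hv⟩ => subset_of_mem_profileEdges (h.1 hS) hv, fun hv => h.2.2 v hv⟩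
  rw [← hU, prod_biUnion (fun S hS T hT hST => h.2.1 S hS T hT hST)]

end Matchings

/-! ### Stochastic scalings -/

section Scaling
variable {V ι : Type*} [DecidableEq V] [DecidableEq ι] [Fintype ι]
variable {c : V → ι} {κ : ι → ℕ} {U : Finset V} {m : ℕ}

/-- The one-variable estimate that makes the dual objective function coercive. -/
lemma mul_exp_sub_mul_ge {w y : ℝ} (hw : 0 < w) (hy : 0 < y) :
    ∃ D : ℝ, ∀ t, y * |t| - D ≤ w * Real.exp t - y * t := by
  refine ⟨max 0 (-(2 * y * (1 - Real.log (2 * y / w)))), fun t => ?_⟩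
  have h1 : 2 * y * (t - Real.log (2 * y / w) + 1) ≤ w * Real.exp t := by
    have h2 : w * Real.exp t = 2 * y * Real.exp (t - Real.log (2 * y / w)) := by
      rw [Real.exp_sub, Real.exp_log (by positivity)]; field_simp
    rw [h2]
    exact mul_le_mul_of_nonneg_left (Real.add_one_le_exp _) (by positivity)
  have h3 := le_max_left 0 (-(2 * y * (1 - Real.log (2 * y / w))))
  have h4 := le_max_right 0 (-(2 * y * (1 - Real.log (2 * y / w))))
  have h5 : 0 ≤ w * Real.exp t := by positivity
  rcases abs_cases t with ⟨h, _⟩ | ⟨h, _⟩ <;> rw [h]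
  · linarith
  · linarith

/-- Every positive weight has a `k`-stochastic scaling. The logarithms of the scaling factors are a
minimizer of `∑_S (w_S exp θ(S) - y θ(S))`, where `θ(S) = ∑_{v ∈ S} θ_v` and `y` is the uniform
stochastic weight. As a function of the values `θ(S)`, which range over a closed subspace, this is
coercive, so that a minimizer exists although `θ` itself is not unique. -/
lemma exists_scaling (h : HasOrder c κ U m) (hm : 1 ≤ m) {w : Finset V → ℝ}
    (hw : ∀ S ∈ profileEdges c κ U, 0 < w S) :
    ∃ l : V → ℝ, (∀ v, 0 < l v) ∧
      ∀ v ∈ U, rowSum (profileEdges c κ U) (fun S => w S * ∏ u ∈ S, l u) v = 1 := by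
  set E := profileEdges c κ U with hE
  have hEpos := card_profileEdges_pos h hm
  have hm0 : (0 : ℝ) < m := by exact_mod_cast hm
  set y : ℝ := m / #E with hy
  have hypos : 0 < y := div_pos hm0 hEpos
  let φ : (V → ℝ) →ₗ[ℝ] ({S // S ∈ E} → ℝ) :=
    { toFun := fun θ S => ∑ v ∈ S.1, θ v
      map_add' := fun a b => by ext S; simp [sum_add_distrib]
      map_smul' := fun r a => by ext S; simp [mul_sum] }
  let G : ({S // S ∈ E} → ℝ) → ℝ := fun q => ∑ S, (w S.1 * Real.exp (q S) - y * q S)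
  have hGc : Continuous G := by fun_prop
  have hD : ∀ S : {S // S ∈ E}, ∃ D : ℝ, ∀ t, y * |t| - D ≤ w S.1 * Real.exp t - y * t :=
    fun S => mul_exp_sub_mul_ge (hw S.1 S.2) hypos
  choose D hD using hD
  have hco : ∀ q, y * ‖q‖ - ∑ S, D S ≤ G q := by
    intro q
    have h1 : ‖q‖ ≤ ∑ S, |q S| := by
      refine (pi_norm_le_iff_of_nonneg (sum_nonneg fun _ _ => abs_nonneg _)).2 fun S => ?_
      exact single_le_sum (f := fun S => |q S|) (fun _ _ => abs_nonneg _) (mem_univ S)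
    calc y * ‖q‖ - ∑ S, D S ≤ y * ∑ S, |q S| - ∑ S, D S := by gcongr
      _ = ∑ S, (y * |q S| - D S) := by rw [sum_sub_distrib, mul_sum]
      _ ≤ G q := sum_le_sum fun S _ => hD S _
  have hclosed : IsClosed (LinearMap.range φ : Set ({S // S ∈ E} → ℝ)) :=
    Submodule.closed_of_finiteDimensional _
  have hev : ∀ᶠ q in Filter.cocompact ({S // S ∈ E} → ℝ) ⊓
      Filter.principal (LinearMap.range φ : Set ({S // S ∈ E} → ℝ)), G 0 ≤ G q := by
    refine Filter.Eventually.filter_mono inf_le_left ?_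
    have h1 := (tendsto_norm_cocompact_atTop (E := {S // S ∈ E} → ℝ)).eventually_ge_atTop
      ((G 0 + ∑ S, D S) / y)
    filter_upwards [h1] with q hq
    rw [div_le_iff₀ hypos] at hq
    linarith [hco q]
  obtain ⟨q, ⟨θ, rfl⟩, hq⟩ := ContinuousOn.exists_isMinOn' hGc.continuousOn hclosed
    (Submodule.zero_mem _) hev
  refine ⟨fun v => Real.exp (θ v), fun v => Real.exp_pos _, fun v hv => ?_⟩
  have hder : HasDerivAt (fun t : ℝ => G (φ (θ + t • Pi.single v 1)))
      (∑ S : {S // S ∈ E}, (if v ∈ S.1 then w S.1 * Real.exp (φ θ S) - y else 0)) 0 := by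
    have h1 : ∀ (t : ℝ) (S : {S // S ∈ E}), φ (θ + t • Pi.single v 1) S =
        φ θ S + if v ∈ S.1 then t else 0 := by
      intro t S
      simp [φ, sum_add_distrib, Pi.single_apply]
    simp only [G, h1]
    refine HasDerivAt.fun_sum fun S _ => ?_
    by_cases hvS : v ∈ S.1
    · simp only [hvS, if_true]
      have h2 : HasDerivAt (fun t : ℝ => φ θ S + t) 1 0 := (hasDerivAt_id 0).const_add _
      have h3 := (h2.exp.const_mul (w S.1)).fun_sub (h2.const_mul y)
      simpa using h3
    · simpa [hvS] using hasDerivAt_const (0 : ℝ) _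
  have hmin : IsLocalMin (fun t : ℝ => G (φ (θ + t • Pi.single v 1))) 0 := by
    refine Filter.Eventually.of_forall fun t => ?_
    have := hq ⟨θ + t • Pi.single v 1, rfl⟩
    simpa using this
  have h0 := hmin.hasDerivAt_eq_zero hder
  have hφ : ∀ S : {S // S ∈ E}, φ θ S = ∑ u ∈ S.1, θ u := fun _ => rfl
  simp only [hφ] at h0
  rw [univ_eq_attach, sum_attach E (fun S => if v ∈ S then w S * Real.exp (∑ u ∈ S, θ u) - y else 0),
    ← sum_filter, sum_sub_distrib] at h0
  have h1 := order_mul_degree h hv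
  rw [rowSum] at h1
  simp only [sum_const, nsmul_eq_mul, mul_one] at h0 h1
  rw [rowSum]
  simp only [← Real.exp_sum]
  have h2 : (#{S ∈ E | v ∈ S} : ℝ) * y = 1 := by
    rw [hy, mul_div_assoc', div_eq_one_iff_eq hEpos.ne', mul_comm]; exact h1
  linarith

end Scaling

/-! ### Nearly stochastic scalings are balanced -/

section Balance
variable {V ι : Type*} [DecidableEq V] [DecidableEq ι] [Fintype ι]
variable {c : V → ι} {κ : ι → ℕ} {U : Finset V} {m : ℕ}

lemma prod_swapVertices (u v : V) (S : Finset V) (hv : v ∈ S) (hu : u ∉ S) (l : V → ℝ) :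
    (∏ a ∈ swapVertices u v S, l a) * l v = (∏ a ∈ S, l a) * l u := by
  rw [swapVertices, prod_map]
  rw [← mul_prod_erase _ _ hv, ← mul_prod_erase _ (fun a => l a) hv]
  have : ∏ x ∈ S.erase v, l ((Equiv.swap u v).toEmbedding x) = ∏ x ∈ S.erase v, l x := by
    refine prod_congr rfl fun x hx => ?_
    rw [mem_erase] at hx
    simp only [Equiv.coe_toEmbedding]
    rw [Equiv.swap_apply_of_ne_of_ne (by rintro rfl; exact hu hx.2) hx.1]
  rw [this]
  simp; ring

/-- Compares the scaled weight of an edge `S` that contains `v` but not `u` with that of the edge in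
which `u` replaces `v`. -/
lemma scaled_swap_le {α : ℝ} {w x : Finset V → ℝ} {l : V → ℝ} (hl : ∀ v, 0 < l v)
    (hα : ∀ S ∈ profileEdges c κ U, ∀ T ∈ profileEdges c κ U, w S ≤ α * w T)
    (hx : ∀ S ∈ profileEdges c κ U, x S = w S * ∏ v ∈ S, l v) {u v : V} (hu : u ∈ U)
    (hv : v ∈ U) (huv : c u = c v) {S : Finset V} (hS : S ∈ profileEdges c κ U) (hvS : v ∈ S)
    (huS : u ∉ S) : l u * x S ≤ α * l v * x (swapVertices u v S) := by
  have hS' := swapVertices_mem hu hv huv hS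
  rw [hx S hS, hx _ hS']
  have h1 := prod_swapVertices u v S hvS huS l
  have h2 : 0 < ∏ a ∈ S, l a := prod_pos fun a _ => hl a
  calc l u * (w S * ∏ v ∈ S, l v) = w S * ((∏ v ∈ S, l v) * l u) := by ring
    _ ≤ (α * w (swapVertices u v S)) * ((∏ v ∈ S, l v) * l u) :=
      mul_le_mul_of_nonneg_right (hα S hS _ hS') (by have := hl u; positivity)
    _ = _ := by rw [← h1]; ring

/-- In a nearly stochastic scaling of a balanced weight, the scaling factors of vertices of the
same color are within a constant factor of each other. -/
lemma scaling_factor_le (h : HasOrder c κ U m) (hm : 2 ≤ m) {α δ : ℝ} (hα1 : 1 ≤ α) (hδ : 0 ≤ δ)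
    (hδα : δ * (4 * (1 + α) + 1) ≤ 1) {w x : Finset V → ℝ} {l : V → ℝ} (hl : ∀ v, 0 < l v)
    (hw : ∀ S ∈ profileEdges c κ U, 0 < w S)
    (hα : ∀ S ∈ profileEdges c κ U, ∀ T ∈ profileEdges c κ U, w S ≤ α * w T)
    (hx : ∀ S ∈ profileEdges c κ U, x S = w S * ∏ v ∈ S, l v)
    (hrow : ∀ v ∈ U, |rowSum (profileEdges c κ U) x v - 1| ≤ δ) {u v : V} (hu : u ∈ U)
    (hv : v ∈ U) (huv : c u = c v) : l u ≤ 2 * α * l v := by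
  set E := profileEdges c κ U with hE
  have hxpos : ∀ S ∈ E, 0 < x S := fun S hS => by
    rw [hx S hS]; exact mul_pos (hw S hS) (prod_pos fun a _ => hl a)
  -- it suffices to compare the largest factor with the smallest one
  suffices H : ∀ u ∈ U, ∀ v ∈ U, c u = c v →
      (∀ a ∈ U, c a = c u → l v ≤ l a ∧ l a ≤ l u) → l u ≤ 2 * α * l v by
    have hne : ({a ∈ U | c a = c u} : Finset V).Nonempty := ⟨u, by simp [hu]⟩
    obtain ⟨p, hp, hpmax⟩ := exists_max_image _ l hne
    obtain ⟨q, hq, hqmin⟩ := exists_min_image _ l hne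
    simp only [mem_filter] at hp hq hpmax hqmin
    have h1 := H p hp.1 q hq.1 (hp.2.trans hq.2.symm) fun a ha hca =>
      ⟨hqmin a ⟨ha, hca.trans hp.2⟩, hpmax a ⟨ha, hca.trans hp.2⟩⟩
    calc l u ≤ l p := hpmax u ⟨hu, rfl⟩
      _ ≤ 2 * α * l q := h1
      _ ≤ _ := mul_le_mul_of_nonneg_left (hqmin v ⟨hv, huv.symm⟩) (by linarith)
  clear! u v
  intro u hu v hv huv hext
  by_cases hne : u = v
  · subst hne; nlinarith [hl u]
  set su := ∑ A ∈ E with (u ∈ A ∧ v ∉ A), x A with hsu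
  set sv := ∑ A ∈ E with (v ∈ A ∧ u ∉ A), x A with hsv
  set q := ∑ A ∈ E with (u ∈ A ∧ v ∈ A), x A with hq
  have hru : rowSum E x u = q + su := by
    simp only [rowSum, hq, hsu, sum_filter, ← sum_add_distrib]
    refine sum_congr rfl fun A _ => ?_
    by_cases h1 : u ∈ A <;> by_cases h2 : v ∈ A <;> simp [h1, h2]
  have hrv : rowSum E x v = q + sv := by
    simp only [rowSum, hq, hsv, sum_filter, ← sum_add_distrib]
    refine sum_congr rfl fun A _ => ?_
    by_cases h1 : u ∈ A <;> by_cases h2 : v ∈ A <;> simp [h1, h2]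
  have h1 : l u * sv ≤ α * l v * su := by
    simp only [hsv, hsu, sum_filter, mul_sum]
    rw [← sum_swapVertices hu hv huv (fun A => α * l v * if u ∈ A ∧ v ∉ A then x A else 0)]
    refine sum_le_sum fun A hA => ?_
    by_cases h2 : v ∈ A ∧ u ∉ A
    · have := scaled_swap_le hl hα hx hu hv huv hA h2.1 h2.2
      simpa [mem_swapVertices, h2.1, h2.2] using this
    · simp [mem_swapVertices, h2]
  -- replacing `v` by a third vertex shows that few edges at `u` contain `v`
  have h2 : q ≤ α * su := by
    set N : Finset V := {a ∈ U | c a = c u} with hN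
    have hκ : 0 < κ (c u) := Nat.pos_of_mul_pos_right (color_pos_of_mem h hu)
    have hκ' : (0 : ℝ) < κ (c u) := by exact_mod_cast hκ
    have h3 : ∀ a ∈ N, (∑ A ∈ E with (u ∈ A ∧ v ∈ A ∧ a ∉ A), x A) ≤
        α * ∑ A ∈ E with (u ∈ A ∧ v ∉ A ∧ a ∈ A), x A := by
      intro a ha
      simp only [hN, mem_filter] at ha
      simp only [sum_filter, mul_sum]
      by_cases hau : a = u
      · subst hau
        rw [sum_eq_zero]
        · exact sum_nonneg fun A hA => by
            have := (hxpos A hA).le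
            split_ifs <;> nlinarith
        · intro A _; simp; tauto
      rw [← sum_swapVertices ha.1 hv (ha.2.trans huv)
        (fun A => α * if u ∈ A ∧ v ∉ A ∧ a ∈ A then x A else 0)]
      refine sum_le_sum fun A hA => ?_
      by_cases h4 : u ∈ A ∧ v ∈ A ∧ a ∉ A
      · have h5 := scaled_swap_le hl hα hx ha.1 hv (ha.2.trans huv) hA h4.2.1 h4.2.2
        have h6 := (hext a ha.1 ha.2).1
        have h7 := hxpos A hA
        have h8 : x A ≤ α * x (swapVertices a v A) := by
          have h9 : l v * x A ≤ l v * (α * x (swapVertices a v A)) := by nlinarith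
          exact le_of_mul_le_mul_left h9 (hl v)
        have h10 : Equiv.swap a v u = u :=
          Equiv.swap_apply_of_ne_of_ne (fun e => hau e.symm) hne
        simpa [mem_swapVertices, h4.1, h4.2.1, h4.2.2, h10] using h8
      · rw [if_neg h4]
        have := (hxpos _ (swapVertices_mem ha.1 hv (ha.2.trans huv) hA)).le
        split_ifs <;> nlinarith
    have h4 := sum_le_sum h3
    rw [← mul_sum] at h4
    simp only [sum_filter] at h4
    rw [sum_comm, sum_comm (s := N)] at h4
    have hcount : ∀ A ∈ E, #{a ∈ N | a ∈ A} = κ (c u) := by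
      intro A hA
      rw [← (mem_profileEdges.1 hA).2 (c u)]
      congr 1; ext a
      have := @(mem_profileEdges.1 hA).1 a
      simp only [hN, mem_filter]; tauto
    have h5 : ∀ A ∈ E, (κ (c u) : ℝ) * (if u ∈ A ∧ v ∈ A then x A else 0) ≤
        ∑ a ∈ N, if u ∈ A ∧ v ∈ A ∧ a ∉ A then x A else 0 := by
      intro A hA
      by_cases h6 : u ∈ A ∧ v ∈ A
      · simp only [h6, true_and, if_true, and_self]
        rw [← sum_filter, sum_const, nsmul_eq_mul]
        refine mul_le_mul_of_nonneg_right ?_ (hxpos A hA).le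
        have h7 := card_filter_add_card_filter_not (s := N) (fun a => a ∈ A)
        rw [hcount A hA, hN, h (c u)] at h7
        have : κ (c u) * 2 ≤ κ (c u) * m := Nat.mul_le_mul_left _ hm
        exact_mod_cast (by rw [hN]; lia : κ (c u) ≤ #{a ∈ N | a ∉ A})
      · have : ∀ a, ¬ (u ∈ A ∧ v ∈ A ∧ a ∉ A) := fun a => by tauto
        simp [h6, this]
    have h6 : ∀ A ∈ E, (∑ a ∈ N, if u ∈ A ∧ v ∉ A ∧ a ∈ A then x A else 0) =
        (κ (c u) : ℝ) * (if u ∈ A ∧ v ∉ A then x A else 0) := by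
      intro A hA
      by_cases h6 : u ∈ A ∧ v ∉ A
      · simp only [h6, true_and, if_true, and_self, not_false_eq_true]
        rw [← sum_filter, sum_const, nsmul_eq_mul, hcount A hA]
      · have : ∀ a, ¬ (u ∈ A ∧ v ∉ A ∧ a ∈ A) := fun a => by tauto
        simp [h6, this]
    have h7 := (sum_le_sum h5).trans h4
    rw [sum_congr rfl h6, ← mul_sum, ← mul_sum, ← sum_filter, ← sum_filter, ← hq, ← hsu] at h7
    have h8 : (κ (c u) : ℝ) * q ≤ κ (c u) * (α * su) := by linarith
    exact le_of_mul_le_mul_left h8 hκ'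
  have hu1 := abs_le.1 (hrow u hu)
  have hv1 := abs_le.1 (hrow v hv)
  have hlu := hl u
  have hlv := hl v
  -- hence `su` is not small, and `sv`, which is nearly `su`, is at least half of it
  have h3 : (1 + α) * (4 * δ) ≤ (1 + α) * su := by nlinarith
  have h4 : 4 * δ ≤ su := le_of_mul_le_mul_left h3 (by linarith)
  have h5 : su - 2 * δ ≤ sv := by linarith
  have hsupos : 0 < su := by
    have h6 : 0 < 1 - δ := by nlinarith
    nlinarith
  have h6 : su / 2 ≤ sv := by linarith
  have h7 : l u * (su / 2) ≤ α * l v * su := (mul_le_mul_of_nonneg_left h6 hlu.le).trans h1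
  have h8 : su * l u ≤ su * (2 * α * l v) := by linarith
  exact le_of_mul_le_mul_left h8 hsupos

lemma prod_le_prod_of_card_eq {s t : Finset V} (hst : #s = #t) {f g : V → ℝ}
    (hf : ∀ a ∈ s, 0 ≤ f a) (hfg : ∀ a ∈ s, ∀ b ∈ t, f a ≤ g b) :
    ∏ a ∈ s, f a ≤ ∏ b ∈ t, g b := by
  let e := equivOfCardEq hst
  rw [← prod_attach s, ← prod_attach t]
  calc ∏ a ∈ s.attach, f a ≤ ∏ a ∈ s.attach, g (e a) :=
        prod_le_prod (fun a _ => hf a a.2) fun a _ => hfg a a.2 _ (e a).2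
    _ = _ := by
      rw [← univ_eq_attach, ← univ_eq_attach]
      exact Equiv.prod_comp e fun b : t => g b

/-- A nearly stochastic scaling of a balanced weight is balanced, with a constant that does not depend
on the number of vertices. -/
lemma scaled_balanced (h : HasOrder c κ U m) (hm : 2 ≤ m) {α δ : ℝ} (hα1 : 1 ≤ α) (hδ : 0 ≤ δ)
    (hδα : δ * (4 * (1 + α) + 1) ≤ 1) {w x : Finset V → ℝ} {l : V → ℝ} (hl : ∀ v, 0 < l v)
    (hw : ∀ S ∈ profileEdges c κ U, 0 < w S)
    (hα : ∀ S ∈ profileEdges c κ U, ∀ T ∈ profileEdges c κ U, w S ≤ α * w T)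
    (hx : ∀ S ∈ profileEdges c κ U, x S = w S * ∏ v ∈ S, l v)
    (hrow : ∀ v ∈ U, |rowSum (profileEdges c κ U) x v - 1| ≤ δ) {A B : Finset V}
    (hA : A ∈ profileEdges c κ U) (hB : B ∈ profileEdges c κ U) :
    x A ≤ α * (2 * α) ^ (∑ i, κ i) * x B := by
  have hA' := mem_profileEdges.1 hA
  have hB' := mem_profileEdges.1 hB
  have h1 : ∏ v ∈ A, l v ≤ (2 * α) ^ (∑ i, κ i) * ∏ v ∈ B, l v := by
    have h2 : (2 * α) ^ (∑ i, κ i) * ∏ v ∈ B, l v = ∏ v ∈ B, 2 * α * l v := by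
      rw [prod_mul_distrib, prod_const, card_of_mem_profileEdges hB]
    rw [h2, ← prod_fiberwise_of_maps_to (fun v _ => mem_univ (c v)),
      ← prod_fiberwise_of_maps_to (s := B) (fun v _ => mem_univ (c v))]
    refine prod_le_prod (fun i _ => prod_nonneg fun a _ => (hl a).le) fun i _ => ?_
    refine prod_le_prod_of_card_eq ((hA'.2 i).trans (hB'.2 i).symm) (fun a _ => (hl a).le) ?_
    intro a ha b hb
    simp only [mem_filter] at ha hb
    exact scaling_factor_le h hm hα1 hδ hδα hl hw hα hx hrow (hA'.1 ha.1) (hB'.1 hb.1)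
      (ha.2.trans hb.2.symm)
  rw [hx A hA, hx B hB]
  calc w A * ∏ v ∈ A, l v ≤ (α * w B) * ((2 * α) ^ (∑ i, κ i) * ∏ v ∈ B, l v) :=
        mul_le_mul (hα A hA B hB) h1 (prod_nonneg fun a _ => (hl a).le)
          (mul_nonneg (by linarith) (hw B hB).le)
    _ = _ := by ring

end Balance

/-! ### Stability of the entropy optimum -/

section Entropy

/-- The tangent line of `y log (y / x)` at `y = x`. -/
lemma sub_le_mul_log_div {x y : ℝ} (hx : 0 < x) (hy : 0 ≤ y) : y - x ≤ y * Real.log (y / x) := by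
  rcases hy.eq_or_lt with rfl | hy
  · simp [hx.le]
  · have h1 := Real.one_sub_inv_le_log_of_pos (div_pos hy hx)
    calc y - x = y * (1 - (y / x)⁻¹) := by field_simp
      _ ≤ _ := mul_le_mul_of_nonneg_left h1 hy.le

lemma mul_log_div_le {x y : ℝ} (hx : 0 < x) (hy : 0 ≤ y) :
    y * Real.log (y / x) ≤ y * (y / x - 1) := by
  rcases hy.eq_or_lt with rfl | hy
  · simp
  · exact mul_le_mul_of_nonneg_left (Real.log_le_sub_one_of_pos (div_pos hy hx)) hy.le

lemma mul_log_div_mul {x y r : ℝ} (hx : 0 < x) (hr : 0 < r) (hy : 0 ≤ y) :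
    y * Real.log (y / (x * r)) = y * Real.log (y / x) - y * Real.log r := by
  rcases hy.eq_or_lt with rfl | hy
  · simp
  · rw [← mul_sub, ← Real.log_div (by positivity) hr.ne', div_div]

end Entropy

section Stability
variable {V ι : Type*} [DecidableEq V] [DecidableEq ι] [Fintype ι]
variable {c : V → ι} {κ : ι → ℕ} {U : Finset V} {m : ℕ}

/-- A weight that is nearly stochastic can be corrected to a stochastic one whose relative entropy is
quadratically small in the error of the row sums. -/
lemma exists_stochastic_near (h : HasOrder c κ U m) (hm : 2 ≤ m) (hk : 0 < ∑ i, κ i)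
    {x : Finset V → ℝ} {b e : ℝ} (hb : 0 < b) (he : 0 ≤ e)
    (hx : ∀ S ∈ profileEdges c κ U, b * (m / #(profileEdges c κ U)) ≤ x S)
    (hsum : ∑ S ∈ profileEdges c κ U, x S = m)
    (hrow : ∀ v ∈ U, |1 - rowSum (profileEdges c κ U) x v| ≤ e)
    (hbe : 2 * (∑ i, κ i : ℕ) * e ≤ b) :
    ∃ y : Finset V → ℝ, (∀ S ∈ profileEdges c κ U, 0 ≤ y S) ∧
      (∀ v ∈ U, rowSum (profileEdges c κ U) y v = 1) ∧
      ∑ S ∈ profileEdges c κ U, y S * Real.log (y S / x S) ≤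
        4 * (∑ i, κ i : ℕ) ^ 2 * e ^ 2 * m / b := by
  set E := profileEdges c κ U with hE
  set k : ℝ := ((∑ i, κ i : ℕ) : ℝ) with hkdef
  have hm1 : 1 ≤ m := by lia
  have hEpos : (0 : ℝ) < #E := card_profileEdges_pos h hm1
  have hm0 : (0 : ℝ) < m := by exact_mod_cast hm1
  have hkpos : 0 ≤ k := by positivity
  obtain ⟨z, hz, hzabs⟩ := exists_correction h hm he hrow (fun i => by
    rw [sum_sub_distrib, sum_rowSum_color subset_rfl, ← hE, hsum, sum_const, h i]
    simp)
  rw [← hE, ← hkdef] at hzabs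
  have hxpos : ∀ S ∈ E, 0 < x S := fun S hS => lt_of_lt_of_le (by positivity) (hx S hS)
  have hy0 : ∀ S ∈ E, 0 ≤ x S + z S := by
    intro S hS
    have h1 := (abs_le.1 (hzabs S hS)).1
    have h2 : 2 * k * e * (m / #E) ≤ b * (m / #E) := by gcongr
    linarith [hx S hS]
  have hrow1 : ∀ v ∈ U, rowSum E (fun S => x S + z S) v = 1 := by
    intro v hv
    have h1 := hz v hv
    rw [rowSum] at h1 ⊢
    rw [sum_add_distrib, h1, rowSum]; ring
  refine ⟨fun S => x S + z S, hy0, hrow1, ?_⟩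
  have hzsum : ∑ S ∈ E, z S = 0 := by
    have h1 := sum_of_stochastic h hk hrow1
    rw [← hE, sum_add_distrib, hsum] at h1
    linarith
  have hterm : ∀ S ∈ E, (x S + z S) * Real.log ((x S + z S) / x S) ≤
      z S + 4 * k ^ 2 * e ^ 2 / b * (m / #E) := by
    intro S hS
    have hxS := hxpos S hS
    refine (mul_log_div_le hxS (hy0 S hS)).trans ?_
    have h1 : (x S + z S) * ((x S + z S) / x S - 1) = z S + z S ^ 2 / x S := by
      field_simp; ring
    rw [h1]
    have h2 : z S ^ 2 ≤ (2 * k * e * (m / #E)) ^ 2 := by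
      rw [← sq_abs]; exact pow_le_pow_left₀ (abs_nonneg _) (hzabs S hS) 2
    have h3 : z S ^ 2 / x S ≤ (2 * k * e * (m / #E)) ^ 2 / (b * (m / #E)) :=
      div_le_div₀ (by positivity) h2 (by positivity) (hx S hS)
    have h4 : (2 * k * e * (m / #E)) ^ 2 / (b * (m / #E)) =
        4 * k ^ 2 * e ^ 2 / b * (m / #E) := by field_simp; ring
    linarith
  refine (sum_le_sum hterm).trans ?_
  rw [sum_add_distrib, hzsum, sum_const, nsmul_eq_mul, zero_add]
  apply le_of_eq; field_simp

lemma sum_log_eq {x : Finset V → ℝ} (hx : ∀ v ∈ U, rowSum (profileEdges c κ U) x v = 1)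
    (a : V → ℝ) :
    ∑ v ∈ U, a v = ∑ S ∈ profileEdges c κ U, x S * ∑ v ∈ S, a v := by
  rw [← sum_mul_rowSum (fun S hS => subset_of_mem_profileEdges hS)]
  exact sum_congr rfl fun v hv => by rw [hx v hv, mul_one]

lemma sum_mul_log_scaled {x y : Finset V → ℝ} {l : V → ℝ} (hl : ∀ v, 0 < l v)
    (hx : ∀ S ∈ profileEdges c κ U, 0 < x S) (hy0 : ∀ S ∈ profileEdges c κ U, 0 ≤ y S)
    (hy : ∀ v ∈ U, rowSum (profileEdges c κ U) y v = 1) :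
    ∑ S ∈ profileEdges c κ U, y S * Real.log (y S / x S) =
      ∑ S ∈ profileEdges c κ U, y S * Real.log (y S / (x S * ∏ v ∈ S, l v)) +
        ∑ v ∈ U, Real.log (l v) := by
  rw [sum_log_eq hy, ← sum_add_distrib]
  refine sum_congr rfl fun S hS => ?_
  rw [mul_log_div_mul (hx S hS) (prod_pos fun v _ => hl v) (hy0 S hS),
    Real.log_prod fun v _ => (hl v).ne']
  ring

/-- Weak duality: the relative entropy of a stochastic weight with respect to `x` is at least its
minimum, which is attained by the stochastic scaling of `x` and equals the sum of the logarithms of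
the scaling factors. -/
lemma sum_log_scaling_le (h : HasOrder c κ U m) (hk : 0 < ∑ i, κ i) {x y : Finset V → ℝ}
    {l : V → ℝ} (hl : ∀ v, 0 < l v) (hx : ∀ S ∈ profileEdges c κ U, 0 < x S)
    (hlx : ∀ v ∈ U, rowSum (profileEdges c κ U) (fun S => x S * ∏ u ∈ S, l u) v = 1)
    (hy0 : ∀ S ∈ profileEdges c κ U, 0 ≤ y S)
    (hy : ∀ v ∈ U, rowSum (profileEdges c κ U) y v = 1) :
    ∑ v ∈ U, Real.log (l v) ≤ ∑ S ∈ profileEdges c κ U, y S * Real.log (y S / x S) := by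
  rw [sum_mul_log_scaled hl hx hy0 hy]
  have h1 : ∑ S ∈ profileEdges c κ U, (y S - x S * ∏ u ∈ S, l u) ≤
      ∑ S ∈ profileEdges c κ U, y S * Real.log (y S / (x S * ∏ v ∈ S, l v)) :=
    sum_le_sum fun S hS =>
      sub_le_mul_log_div (mul_pos (hx S hS) (prod_pos fun v _ => hl v)) (hy0 S hS)
  rw [sum_sub_distrib, sum_of_stochastic h hk hy, sum_of_stochastic h hk hlx] at h1
  linarith

lemma sum_log_scaling_eq {x : Finset V → ℝ}
    {l : V → ℝ} (hl : ∀ v, 0 < l v) (hx : ∀ S ∈ profileEdges c κ U, 0 < x S)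
    (hlx : ∀ v ∈ U, rowSum (profileEdges c κ U) (fun S => x S * ∏ u ∈ S, l u) v = 1) :
    ∑ S ∈ profileEdges c κ U, x S * (∏ u ∈ S, l u) * Real.log (x S * (∏ u ∈ S, l u) / x S) =
      ∑ v ∈ U, Real.log (l v) := by
  have hpos : ∀ S ∈ profileEdges c κ U, 0 < x S * ∏ u ∈ S, l u := fun S hS =>
    mul_pos (hx S hS) (prod_pos fun v _ => hl v)
  rw [sum_mul_log_scaled hl hx (fun S hS => (hpos S hS).le) hlx, add_eq_right]
  exact sum_eq_zero fun S hS => by rw [div_self (hpos S hS).ne', Real.log_one, mul_zero]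

/-- Lower bound for the minimum of the relative entropy, from convexity and the total weight alone. -/
lemma le_sum_log_scaling (h : HasOrder c κ U m) (hm : 1 ≤ m) (hk : 0 < ∑ i, κ i)
    {x : Finset V → ℝ} {l : V → ℝ} (hl : ∀ v, 0 < l v)
    (hx : ∀ S ∈ profileEdges c κ U, 0 < x S)
    (hlx : ∀ v ∈ U, rowSum (profileEdges c κ U) (fun S => x S * ∏ u ∈ S, l u) v = 1) :
    m * Real.log (m / ∑ S ∈ profileEdges c κ U, x S) ≤ ∑ v ∈ U, Real.log (l v) := by
  have hM : 0 < ∑ S ∈ profileEdges c κ U, x S := sum_pos hx (h.profileEdges_nonempty hm)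
  have hm0 : (0 : ℝ) < m := by exact_mod_cast hm
  set M := ∑ S ∈ profileEdges c κ U, x S with hMdef
  have hpos : ∀ S ∈ profileEdges c κ U, 0 < x S * ∏ u ∈ S, l u := fun S hS =>
    mul_pos (hx S hS) (prod_pos fun v _ => hl v)
  rw [← sum_log_scaling_eq hl hx hlx]
  have h1 : ∀ S ∈ profileEdges c κ U,
      x S * (∏ u ∈ S, l u) - x S * (m / M) + x S * (∏ u ∈ S, l u) * Real.log (m / M) ≤
      x S * (∏ u ∈ S, l u) * Real.log (x S * (∏ u ∈ S, l u) / x S) := by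
    intro S hS
    have h2 := sub_le_mul_log_div (mul_pos (hx S hS) (div_pos hm0 hM)) (hpos S hS).le
    rw [mul_log_div_mul (hx S hS) (div_pos hm0 hM) (hpos S hS).le] at h2
    linarith
  have h2 := sum_le_sum h1
  rw [sum_add_distrib, sum_sub_distrib, ← sum_mul, ← sum_mul, ← hMdef,
    sum_of_stochastic h hk hlx, mul_div_cancel₀ _ hM.ne'] at h2
  linarith

/-- Upper bound for the minimum of the relative entropy of a balanced weight `x`, all row sums of which
are nearly equal: except for a quadratic error, it is the bound that the total weight gives. -/
lemma sum_log_scaling_le_of_near (h : HasOrder c κ U m) (hm : 2 ≤ m) (hk : 0 < ∑ i, κ i)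
    {x : Finset V → ℝ} {l : V → ℝ} (hl : ∀ v, 0 < l v)
    (hlx : ∀ v ∈ U, rowSum (profileEdges c κ U) (fun S => x S * ∏ u ∈ S, l u) v = 1)
    {β e M : ℝ} (hβ : 0 < β) (he : 0 ≤ e)
    (hx : ∀ S ∈ profileEdges c κ U, 0 < x S)
    (hbal : ∀ S ∈ profileEdges c κ U, ∀ T ∈ profileEdges c κ U, x S ≤ β * x T)
    (hM : ∑ S ∈ profileEdges c κ U, x S = M)
    (hrow : ∀ v ∈ U, |1 - m / M * rowSum (profileEdges c κ U) x v| ≤ e)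
    (hbe : 2 * (∑ i, κ i : ℕ) * e * β ≤ 1) :
    ∑ v ∈ U, Real.log (l v) ≤
      m * Real.log (m / M) + 4 * (∑ i, κ i : ℕ) ^ 2 * e ^ 2 * m * β := by
  have hm1 : 1 ≤ m := by lia
  have hm0 : (0 : ℝ) < m := by exact_mod_cast hm1
  have hEpos := card_profileEdges_pos h hm1
  have hMpos : 0 < M := hM ▸ sum_pos hx (h.profileEdges_nonempty hm1)
  have hr : 0 < m / M := div_pos hm0 hMpos
  have hge : ∀ T ∈ profileEdges c κ U, M ≤ #(profileEdges c κ U) * (β * x T) := by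
    intro T hT
    rw [← hM, ← nsmul_eq_mul]
    exact sum_le_card_nsmul _ _ _ fun S hS => hbal S hS T hT
  obtain ⟨y, hy0, hy, hle⟩ := exists_stochastic_near h hm hk (x := fun S => x S * (m / M))
    (b := 1 / β) (e := e) (by positivity) he
    (fun S hS => by
      have h1 := hge S hS
      rw [div_mul_div_comm, one_mul, div_le_iff₀ (by positivity)]
      calc (m : ℝ) = M * (m / M) := by field_simp
        _ ≤ (#(profileEdges c κ U) * (β * x S)) * (m / M) := by gcongr
        _ = _ := by ring)
    (by rw [← sum_mul, hM]; field_simp)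
    (fun v hv => by
      have h1 := hrow v hv
      rw [rowSum, mul_comm, sum_mul] at h1
      exact h1)
    (by rw [le_div_iff₀ hβ]; exact hbe)
  refine (sum_log_scaling_le h hk hl hx hlx hy0 hy).trans ?_
  have h2 : ∑ S ∈ profileEdges c κ U, y S * Real.log (y S / (x S * (m / M))) =
      ∑ S ∈ profileEdges c κ U, y S * Real.log (y S / x S) - m * Real.log (m / M) := by
    rw [← sum_of_stochastic h hk hy, sum_mul, ← sum_sub_distrib]
    exact sum_congr rfl fun S hS => mul_log_div_mul (hx S hS)
      (by rw [sum_of_stochastic h hk hy]; exact hr) (hy0 S hS)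
  rw [h2, div_div_eq_mul_div, div_one] at hle
  linarith

/-- The uniform weight `m / #E` is stochastic. -/
lemma rowSum_uniform (h : HasOrder c κ U m) (hm : 1 ≤ m) {v : V} (hv : v ∈ U) :
    rowSum (profileEdges c κ U) (fun _ => m / #(profileEdges c κ U)) v = 1 := by
  have h1 := order_mul_degree h hv
  have h2 := card_profileEdges_pos h hm
  rw [rowSum] at h1 ⊢
  simp only [sum_const, nsmul_eq_mul, mul_one] at h1 ⊢
  rw [mul_div_assoc', div_eq_one_iff_eq h2.ne', mul_comm]; exact h1

/-- The entropy of the uniform stochastic weight relative to a balanced weight is within `m log β` of the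
bound that the total weight gives. -/
lemma sum_uniform_log_le (h : HasOrder c κ U m) (hm : 1 ≤ m)
    {x : Finset V → ℝ} {β M : ℝ} (hβ : 0 < β) (hx : ∀ S ∈ profileEdges c κ U, 0 < x S)
    (hbal : ∀ S ∈ profileEdges c κ U, ∀ T ∈ profileEdges c κ U, x S ≤ β * x T)
    (hM : ∑ S ∈ profileEdges c κ U, x S = M) :
    ∑ S ∈ profileEdges c κ U, (m / #(profileEdges c κ U) : ℝ) *
        Real.log (m / #(profileEdges c κ U) / x S) ≤
      m * Real.log (m / M) + m * Real.log β := by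
  have hm0 : (0 : ℝ) < m := by exact_mod_cast hm
  have hEpos := card_profileEdges_pos h hm
  have hMpos : 0 < M := hM ▸ sum_pos hx (h.profileEdges_nonempty hm)
  have h1 : ∀ S ∈ profileEdges c κ U, (m / #(profileEdges c κ U) : ℝ) *
        Real.log (m / #(profileEdges c κ U) / x S) ≤
      (m / #(profileEdges c κ U) : ℝ) * Real.log (m / M * β) := by
    intro S hS
    have hxS := hx S hS
    refine mul_le_mul_of_nonneg_left (Real.log_le_log (by positivity) ?_) (by positivity)
    have hge : M ≤ #(profileEdges c κ U) * (β * x S) := by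
      rw [← hM, ← nsmul_eq_mul]
      exact sum_le_card_nsmul _ _ _ fun T hT => hbal T hT S hS
    rw [div_div, div_mul_eq_mul_div, div_le_div_iff₀ (by positivity) hMpos]
    calc (m : ℝ) * M ≤ m * (#(profileEdges c κ U) * (β * x S)) := by gcongr
      _ = _ := by ring
  refine (sum_le_sum h1).trans ?_
  rw [sum_const, nsmul_eq_mul, Real.log_mul (by positivity) hβ.ne']
  apply le_of_eq; field_simp

end Stability

/-! ### Removal of the vertices of an edge -/

section Removal
variable {V ι : Type*} [DecidableEq V] [DecidableEq ι] [Fintype ι]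
variable {c : V → ι} {κ : ι → ℕ} {U : Finset V} {m : ℕ}

/-- In a balanced stochastic weight, the edges through two given vertices have total weight `O(1 / m)`. -/
lemma pair_mass_le (h : HasOrder c κ U m) (hm : 1 ≤ m) {x : Finset V → ℝ} {β : ℝ} (hβ : 0 < β)
    (hbal : ∀ S ∈ profileEdges c κ U, ∀ T ∈ profileEdges c κ U, x S ≤ β * x T)
    (hsum : ∑ S ∈ profileEdges c κ U, x S = m) {u v : V} (hu : u ∈ U) (hv : v ∈ U)
    (huv : u ≠ v) : ∑ S ∈ profileEdges c κ U with (v ∈ S ∧ u ∈ S), x S ≤ β / m := by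
  set E := profileEdges c κ U with hE
  have hm0 : (0 : ℝ) < m := by exact_mod_cast hm
  have hEpos : (0 : ℝ) < #E := card_profileEdges_pos h hm
  have h1 : ∀ S ∈ E, x S ≤ β * m / #E := by
    intro S hS
    rw [le_div_iff₀ hEpos, ← hsum, mul_sum, mul_comm, ← nsmul_eq_mul]
    exact card_nsmul_le_sum _ _ _ fun T hT => hbal S hS T hT
  have h2 : (#{S ∈ E | v ∈ S ∧ u ∈ S} : ℝ) = codegree E u v := by
    simp only [codegree, rowSum, ← sum_filter, filter_filter]
    simp
  have h3 := order_mul_codegree_le h hm hu hv huv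
  have h4 := order_mul_degree h hu
  rw [← hE] at h3 h4
  calc ∑ S ∈ E with (v ∈ S ∧ u ∈ S), x S ≤ #{S ∈ E | v ∈ S ∧ u ∈ S} • (β * m / #E) :=
        sum_le_card_nsmul _ _ _ fun S hS => h1 S (mem_filter.1 hS).1
    _ = (m * codegree E u v) * (β / #E) := by rw [nsmul_eq_mul, h2]; ring
    _ ≤ rowSum E (fun _ => 1) u * (β / #E) := by gcongr
    _ = β / m := by
      rw [← h4]
      have : rowSum E (fun _ => 1) u ≠ 0 := by
        intro h0; rw [h0, mul_zero] at h4; exact hEpos.ne h4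
      field_simp

lemma mem_profileEdges_sdiff {S T : Finset V} :
    T ∈ profileEdges c κ (U \ S) ↔ T ∈ profileEdges c κ U ∧ Disjoint T S := by
  simp only [mem_profileEdges, subset_sdiff]; tauto

lemma profileEdges_sdiff (S : Finset V) :
    profileEdges c κ (U \ S) = {T ∈ profileEdges c κ U | Disjoint T S} := by
  ext T; rw [mem_profileEdges_sdiff, mem_filter]

/-- When the vertices of an edge are removed, the row sums of a balanced stochastic weight decrease by
`O(1 / m)`. -/
lemma removal_row (h : HasOrder c κ U m) (hm : 1 ≤ m) {x : Finset V → ℝ} {β : ℝ} (hβ : 0 < β)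
    (hx : ∀ S ∈ profileEdges c κ U, 0 < x S)
    (hbal : ∀ S ∈ profileEdges c κ U, ∀ T ∈ profileEdges c κ U, x S ≤ β * x T)
    (hsum : ∑ S ∈ profileEdges c κ U, x S = m)
    (hrow : ∀ v ∈ U, rowSum (profileEdges c κ U) x v = 1) {S : Finset V}
    (hS : S ∈ profileEdges c κ U) {v : V} (hv : v ∈ U \ S) :
    rowSum (profileEdges c κ (U \ S)) x v ≤ 1 ∧
      1 - (∑ i, κ i : ℕ) * (β / m) ≤ rowSum (profileEdges c κ (U \ S)) x v := by
  rw [mem_sdiff] at hv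
  have hSU := subset_of_mem_profileEdges hS
  have h1 := hrow v hv.1
  rw [profileEdges_sdiff]
  rw [rowSum, sum_filter] at h1
  rw [rowSum, sum_filter, sum_filter]
  constructor
  · rw [← h1]
    refine sum_le_sum fun T hT => ?_
    have := (hx T hT).le
    split_ifs <;> simp_all
  · have h2 : ∑ s ∈ S, ∑ T ∈ profileEdges c κ U with (v ∈ T ∧ s ∈ T), x T ≤
        (∑ i, κ i : ℕ) * (β / m) := by
      rw [← card_of_mem_profileEdges hS, ← nsmul_eq_mul]
      exact sum_le_card_nsmul _ _ _ fun s hs =>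
        pair_mass_le h hm hβ hbal hsum (hSU hs) hv.1 (by rintro rfl; exact hv.2 hs)
    have h3 : (1 : ℝ) ≤ ∑ T ∈ profileEdges c κ U,
        (if Disjoint T S then (if v ∈ T then x T else 0) else 0) +
        ∑ s ∈ S, ∑ T ∈ profileEdges c κ U with (v ∈ T ∧ s ∈ T), x T := by
      rw [← h1]
      simp only [sum_filter]
      rw [sum_comm, ← sum_add_distrib]
      refine sum_le_sum fun T hT => ?_
      have hxT := (hx T hT).le
      by_cases hvT : v ∈ T
      · by_cases hd : Disjoint T S
        · simp only [hvT, hd, if_true, true_and]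
          have : 0 ≤ ∑ s ∈ S, if s ∈ T then x T else 0 :=
            sum_nonneg fun s _ => by split_ifs <;> simp [hxT]
          linarith
        · simp only [hvT, hd, if_true, true_and, if_false, zero_add]
          obtain ⟨s, hsT, hsS⟩ := not_disjoint_iff.1 hd
          calc x T = if s ∈ T then x T else 0 := by simp [hsT]
            _ ≤ _ := single_le_sum (f := fun s => if s ∈ T then x T else 0)
              (fun s _ => by split_ifs <;> simp [hxT]) hsS
      · simp [hvT]
    linarith

/-- When the vertices of an edge are removed, the total weight `m` decreases by `k`, up to `O(1 / m)`:
this is inclusion-exclusion over the vertices of the edge, and `pair_mass_le` bounds the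
overlaps. -/
lemma removal_total (h : HasOrder c κ U m) (hm : 1 ≤ m) {x : Finset V → ℝ} {β : ℝ} (hβ : 0 < β)
    (hx : ∀ S ∈ profileEdges c κ U, 0 < x S)
    (hbal : ∀ S ∈ profileEdges c κ U, ∀ T ∈ profileEdges c κ U, x S ≤ β * x T)
    (hsum : ∑ S ∈ profileEdges c κ U, x S = m)
    (hrow : ∀ v ∈ U, rowSum (profileEdges c κ U) x v = 1) {S : Finset V}
    (hS : S ∈ profileEdges c κ U) :
    (m : ℝ) - (∑ i, κ i : ℕ) ≤ ∑ T ∈ profileEdges c κ (U \ S), x T ∧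
      ∑ T ∈ profileEdges c κ (U \ S), x T ≤
        m - (∑ i, κ i : ℕ) + (∑ i, κ i : ℕ) ^ 2 * (β / m) := by
  set E := profileEdges c κ U with hE
  have hSU := subset_of_mem_profileEdges hS
  set k : ℝ := ((∑ i, κ i : ℕ) : ℝ) with hk
  have hcard : (#S : ℝ) = k := by rw [card_of_mem_profileEdges hS]
  have hg : ∑ T ∈ E, x T * #{s ∈ S | s ∈ T} = k := by
    have h1 : ∑ s ∈ S, rowSum E x s = k := by
      rw [sum_congr rfl fun s hs => hrow s (hSU hs), sum_const, nsmul_eq_mul, mul_one, hcard]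
    rw [← h1]
    simp only [rowSum, sum_filter]
    rw [sum_comm]
    refine sum_congr rfl fun T _ => ?_
    rw [← sum_filter, sum_const, nsmul_eq_mul, mul_comm]
  rw [profileEdges_sdiff, sum_filter]
  have hdisj : ∀ T, Disjoint T S ↔ #{s ∈ S | s ∈ T} = 0 := by
    intro T
    rw [card_eq_zero, filter_eq_empty_iff, disjoint_comm, disjoint_left]
  constructor
  · rw [← hg, ← hsum, ← sum_sub_distrib]
    refine sum_le_sum fun T hT => ?_
    have hxT := hx T hT
    by_cases hd : Disjoint T S
    · rw [if_pos hd, (hdisj T).1 hd]; simp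
    · rw [if_neg hd]
      have : (1 : ℝ) ≤ #{s ∈ S | s ∈ T} := by
        exact_mod_cast Nat.pos_of_ne_zero fun h0 => hd ((hdisj T).2 h0)
      nlinarith
  · have h2 : ∑ s ∈ S, ∑ s' ∈ S.erase s, ∑ T ∈ E with (s ∈ T ∧ s' ∈ T), x T ≤
        k ^ 2 * (β / m) := by
      have h3 : ∀ s ∈ S, ∑ s' ∈ S.erase s, ∑ T ∈ E with (s ∈ T ∧ s' ∈ T), x T ≤ k * (β / m) := by
        intro s hs
        calc ∑ s' ∈ S.erase s, ∑ T ∈ E with (s ∈ T ∧ s' ∈ T), x T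
            ≤ #(S.erase s) • (β / m) := sum_le_card_nsmul _ _ _ fun s' hs' => by
              rw [mem_erase] at hs'
              exact pair_mass_le h hm hβ hbal hsum (hSU hs'.2) (hSU hs) hs'.1
          _ ≤ _ := by
            rw [nsmul_eq_mul, ← hcard]
            have : (#(S.erase s) : ℝ) ≤ #S := by exact_mod_cast card_le_card (erase_subset _ _)
            gcongr
      calc _ ≤ #S • (k * (β / m)) := sum_le_card_nsmul _ _ _ h3
        _ = _ := by rw [nsmul_eq_mul, hcard]; ring
    refine le_trans ?_ (add_le_add_right h2 _)
    rw [← hg, ← hsum, ← sum_sub_distrib]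
    simp only [sum_filter]
    have h4 : ∑ s ∈ S, ∑ s' ∈ S.erase s, ∑ T ∈ E, (if s ∈ T ∧ s' ∈ T then x T else 0) =
        ∑ T ∈ E, x T * (#{s ∈ S | s ∈ T} * (#{s ∈ S | s ∈ T} - 1)) := by
      rw [sum_congr rfl fun s _ => sum_comm, sum_comm]
      refine sum_congr rfl fun T _ => ?_
      have h5 : ∀ s ∈ S, ∑ s' ∈ S.erase s, (if s ∈ T ∧ s' ∈ T then x T else 0) =
          if s ∈ T then x T * (#{s ∈ S | s ∈ T} - 1) else 0 := by
        intro s hs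
        by_cases hsT : s ∈ T
        · simp only [hsT, true_and, if_true]
          have h6 : (#{s ∈ S | s ∈ T} : ℝ) * x T = ∑ s' ∈ S, if s' ∈ T then x T else 0 := by
            rw [← sum_filter, sum_const, nsmul_eq_mul]
          rw [← add_sum_erase _ _ hs, if_pos hsT] at h6
          linarith
        · simp [hsT]
      rw [sum_congr rfl h5, ← sum_filter, sum_const, nsmul_eq_mul]; ring
    rw [h4, ← sum_add_distrib]
    refine sum_le_sum fun T hT => ?_
    have hxT := hx T hT
    by_cases hd : Disjoint T S
    · rw [if_pos hd, (hdisj T).1 hd]; simp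
    · rw [if_neg hd]
      nlinarith [mul_nonneg hxT.le (sq_nonneg ((#{s ∈ S | s ∈ T} : ℝ) - 1))]

end Removal

/-! ### The partition function of a stochastic weight -/

section Induction
variable {V ι : Type*} [DecidableEq V] [DecidableEq ι] [Fintype ι]
variable {c : V → ι} {κ : ι → ℕ} {U : Finset V} {m : ℕ}

/-- The constant in the estimate `removal_scaling`, for `k`-uniform hypergraphs and `β`-balanced weights.
The third summand only serves for small `m`, where a crude bound suffices. -/
def removalConst (k β : ℝ) : ℝ :=
  2 * k ^ 2 + 64 * k ^ 4 * β ^ 3 + (12 * k ^ 2 * β ^ 2) ^ 2 * (2 * β + k * (12 * k ^ 2 * β ^ 2)) +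
    k ^ 2 * β

lemma large_aux {k β m : ℝ} (hk : 1 ≤ k) (hβ : 1 ≤ β) (hm : 12 * k ^ 2 * β ^ 2 ≤ m) :
    12 * k ≤ m ∧ 12 * (k * β) ≤ m := by
  have h1 : k * β ≤ (k * β) ^ 2 := by
    have : 1 ≤ k * β := one_le_mul_of_one_le_of_one_le hk hβ
    nlinarith
  have h2 : k ≤ k * β := by nlinarith
  constructor <;> nlinarith

lemma mul_div_le_of_large {k β m : ℝ} (hk : 1 ≤ k) (hβ : 1 ≤ β)
    (hm : 12 * k ^ 2 * β ^ 2 ≤ m) : k ^ 2 * (β / m) ≤ k := by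
  obtain ⟨h1, h2⟩ := large_aux hk hβ hm
  rw [mul_div_assoc', div_le_iff₀ (by linarith)]
  nlinarith

lemma abs_one_sub_mul_le {k β m M r : ℝ} (hk : 1 ≤ k) (hβ : 1 ≤ β)
    (hm : 12 * k ^ 2 * β ^ 2 ≤ m) (hMge : m - k ≤ M) (hMle : M ≤ m - k + k ^ 2 * (β / m))
    (hr1 : r ≤ 1) (hr2 : 1 - k * (β / m) ≤ r) : |1 - (m - 1) / M * r| ≤ 4 * k * β / m := by
  obtain ⟨hkm, hkβm⟩ := large_aux hk hβ hm
  have h3 := mul_div_le_of_large hk hβ hm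
  have hm0 : 0 < m := by linarith
  have hMhalf : m / 2 ≤ M := by linarith
  have hMpos : 0 < M := by linarith
  have hq1 : |(m - 1) / M - 1| ≤ 2 * k / m := by
    have h1 : (m - 1) / M - 1 = (m - 1 - M) / M := by field_simp
    rw [h1, abs_div, abs_of_pos hMpos, div_le_div_iff₀ hMpos hm0]
    have h2 : |m - 1 - M| ≤ k := by rw [abs_le]; constructor <;> linarith
    calc |m - 1 - M| * m ≤ k * m := mul_le_mul_of_nonneg_right h2 hm0.le
      _ ≤ k * (2 * M) := mul_le_mul_of_nonneg_left (by linarith) (by linarith)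
      _ = _ := by ring
  have hq2 : (m - 1) / M ≤ 2 := by rw [div_le_iff₀ hMpos]; linarith
  have hq0 : 0 < (m - 1) / M := div_pos (by linarith) hMpos
  have h1 : 1 - (m - 1) / M * r = -((m - 1) / M - 1) + (m - 1) / M * (1 - r) := by ring
  rw [h1]
  refine (abs_add_le _ _).trans ?_
  rw [abs_neg, abs_of_nonneg (mul_nonneg hq0.le (by linarith))]
  have h2 : (m - 1) / M * (1 - r) ≤ 2 * (k * (β / m)) :=
    mul_le_mul hq2 (by linarith) (by linarith) (by norm_num)
  have h3 : 2 * k / m + 2 * (k * (β / m)) ≤ 4 * k * β / m := by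
    rw [mul_div_assoc', mul_div_assoc', ← add_div]
    refine div_le_div_of_nonneg_right ?_ hm0.le
    nlinarith
  linarith

lemma removal_upper_bound {k β m M : ℝ} (hk : 1 ≤ k) (hβ : 1 ≤ β)
    (hm : 12 * k ^ 2 * β ^ 2 ≤ m) (hMge : m - k ≤ M) :
    (m - 1) * Real.log ((m - 1) / M) + 4 * k ^ 2 * (4 * k * β / m) ^ 2 * (m - 1) * β ≤
      k - 1 + removalConst k β / m := by
  obtain ⟨hkm, hkβm⟩ := large_aux hk hβ hm
  have hm0 : 0 < m := by linarith
  have hMpos : 0 < M := by linarith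
  have hm1R : 0 < m - 1 := by linarith
  have hq0 : 0 < (m - 1) / M := div_pos hm1R hMpos
  have h5 : 4 * k ^ 2 * (4 * k * β / m) ^ 2 * (m - 1) * β ≤ 64 * k ^ 4 * β ^ 3 / m := by
    have h6 : 4 * k ^ 2 * (4 * k * β / m) ^ 2 * (m - 1) * β =
        (64 * k ^ 4 * β ^ 3 / m) * ((m - 1) / m) := by field_simp; ring
    rw [h6]
    refine mul_le_of_le_one_right (by positivity) ?_
    rw [div_le_one hm0]; linarith
  have h7 : (m - 1) * Real.log ((m - 1) / M) ≤ k - 1 + 2 * k ^ 2 / m := by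
    have h8 := mul_le_mul_of_nonneg_left (Real.log_le_sub_one_of_pos hq0) hm1R.le
    refine h8.trans ?_
    have h9 : (m - 1) * ((m - 1) / M - 1) = (m - 1) * (m - 1 - M) / M := by field_simp
    rw [h9, div_le_iff₀ hMpos]
    have h10 : (m - 1) * (m - 1 - M) ≤ (m - 1) * (k - 1) :=
      mul_le_mul_of_nonneg_left (by linarith) hm1R.le
    refine h10.trans ?_
    have h12 : (k - 1 + 2 * k ^ 2 / m) * (m - k) ≤ (k - 1 + 2 * k ^ 2 / m) * M :=
      mul_le_mul_of_nonneg_left hMge (add_nonneg (by linarith) (by positivity))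
    refine le_trans ?_ h12
    have h13 : 2 * k ^ 2 / m * (m - k) = 2 * k ^ 2 * (1 - k / m) := by field_simp
    have h14 : k / m ≤ 1 / 2 := by rw [div_le_iff₀ hm0]; linarith
    have h15 : 2 * k ^ 2 * (1 / 2) ≤ 2 * k ^ 2 * (1 - k / m) :=
      mul_le_mul_of_nonneg_left (by linarith) (by positivity)
    rw [add_mul, h13]
    nlinarith
  have h15 : 2 * k ^ 2 / m + 64 * k ^ 4 * β ^ 3 / m ≤ removalConst k β / m := by
    rw [← add_div]
    refine div_le_div_of_nonneg_right ?_ hm0.le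
    unfold removalConst
    have : 0 ≤ (12 * k ^ 2 * β ^ 2) ^ 2 * (2 * β + k * (12 * k ^ 2 * β ^ 2)) +
      k ^ 2 * β := by positivity
    linarith
  linarith

/-- When the vertices of one edge `S` are removed from a balanced stochastic weight, the product of the
factors that make the rest stochastic again is `exp (k - 1 + O(1 / m))`. -/
lemma removal_scaling (h : HasOrder c κ U m) (hm : 2 ≤ m) (hk : 1 ≤ ∑ i, κ i)
    {x : Finset V → ℝ} {β : ℝ} (hβ : 1 ≤ β) (hx : ∀ S ∈ profileEdges c κ U, 0 < x S)
    (hbal : ∀ S ∈ profileEdges c κ U, ∀ T ∈ profileEdges c κ U, x S ≤ β * x T)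
    (hrow : ∀ v ∈ U, rowSum (profileEdges c κ U) x v = 1) {S : Finset V}
    (hS : S ∈ profileEdges c κ U) {l : V → ℝ} (hl : ∀ v, 0 < l v)
    (hlx : ∀ v ∈ U \ S,
      rowSum (profileEdges c κ (U \ S)) (fun T => x T * ∏ u ∈ T, l u) v = 1) :
    |∑ v ∈ U \ S, Real.log (l v) - ((∑ i, κ i : ℕ) - 1)| ≤
      removalConst (∑ i, κ i : ℕ) β / m := by
  have hm1 : 1 ≤ m := by lia
  have hm' : 1 ≤ m - 1 := by lia
  have hβ0 : 0 < β := by linarith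
  have h' := h.sdiff hS
  have hsum := sum_of_stochastic h hk hrow
  have hE' : ∀ T ∈ profileEdges c κ (U \ S), T ∈ profileEdges c κ U :=
    fun T hT => profileEdges_mono sdiff_subset hT
  have hx' : ∀ T ∈ profileEdges c κ (U \ S), 0 < x T := fun T hT => hx T (hE' T hT)
  have hbal' : ∀ A ∈ profileEdges c κ (U \ S), ∀ B ∈ profileEdges c κ (U \ S), x A ≤ β * x B :=
    fun A hA B hB => hbal A (hE' A hA) B (hE' B hB)
  have hcast : ((m - 1 : ℕ) : ℝ) = m - 1 := by push_cast [Nat.cast_sub hm1]; ring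
  have hrows := fun v hv => removal_row h hm1 hβ0 hx hbal hsum hrow hS (v := v) hv
  obtain ⟨hMge, hMle⟩ := removal_total h hm1 hβ0 hx hbal hsum hrow hS
  have hMpos : 0 < ∑ T ∈ profileEdges c κ (U \ S), x T :=
    sum_pos hx' (h'.profileEdges_nonempty hm')
  have hlow := le_sum_log_scaling h' hm' hk hl hx' hlx
  have hcrude := (sum_log_scaling_le h' hk hl hx' hlx (y := fun _ => _)
    (fun S _ => by positivity) (fun v hv => rowSum_uniform h' hm' hv)).trans
    (sum_uniform_log_le h' hm' hβ0 hx' hbal' rfl)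
  have hnear := fun e he hr hbe hm => sum_log_scaling_le_of_near h' (e := e) hm hk hl hlx hβ0 he
    hx' hbal' rfl hr hbe
  have hMsingle : m ≤ β * 2 ^ ((∑ i, κ i) * m) * ∑ T ∈ profileEdges c κ (U \ S), x T := by
    obtain ⟨T, hT⟩ := h'.profileEdges_nonempty hm'
    have h1 : x T ≤ ∑ T ∈ profileEdges c κ (U \ S), x T :=
      single_le_sum (fun A hA => (hx' A hA).le) hT
    have h2 : (#(profileEdges c κ U) : ℝ) ≤ 2 ^ ((∑ i, κ i) * m) := by
      rw [← h.card]
      exact_mod_cast (card_le_card (filter_subset _ _)).trans (card_powerset U).le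
    have hxT := hx' T hT
    calc (m : ℝ) ≤ #(profileEdges c κ U) • (β * x T) := by
          rw [← hsum]
          exact sum_le_card_nsmul _ _ _ fun A hA => hbal A hA T (hE' T hT)
      _ = #(profileEdges c κ U) * (β * x T) := nsmul_eq_mul _ _
      _ ≤ 2 ^ ((∑ i, κ i) * m) * (β * x T) := by gcongr
      _ ≤ 2 ^ ((∑ i, κ i) * m) * (β * ∑ T ∈ profileEdges c κ (U \ S), x T) := by gcongr
      _ = _ := by ring
  set M := ∑ T ∈ profileEdges c κ (U \ S), x T with hM
  set Z := ∑ v ∈ U \ S, Real.log (l v) with hZ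
  have hkR : (1 : ℝ) ≤ (∑ i, κ i : ℕ) := by exact_mod_cast hk
  have hpow2 : Real.log (2 ^ ((∑ i, κ i) * m)) ≤ (∑ i, κ i : ℕ) * m := by
    rw [Real.log_pow, Nat.cast_mul]
    have := Real.log_two_lt_d9
    have h3 : (0 : ℝ) ≤ (∑ i, κ i : ℕ) * m := by positivity
    nlinarith
  have hpp : (0 : ℝ) < 2 ^ ((∑ i, κ i) * m) := by positivity
  set P2 : ℝ := 2 ^ ((∑ i, κ i) * m) with hP2
  generalize hkk : ((∑ i, κ i : ℕ) : ℝ) = k at *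
  have hm2 : (2 : ℝ) ≤ m := by exact_mod_cast hm
  have hm0 : (0 : ℝ) < m := by linarith
  rw [hcast] at hlow hcrude
  simp only [hcast] at hnear
  have hm1R : (0 : ℝ) < m - 1 := by linarith
  rw [abs_le]
  constructor
  · have h1 := Real.one_sub_inv_le_log_of_pos (div_pos hm1R hMpos)
    have h2 := mul_le_mul_of_nonneg_left h1 hm1R.le
    have h3 : ((m : ℝ) - 1) * (1 - (((m : ℝ) - 1) / M)⁻¹) = m - 1 - M := by field_simp
    have h4 : k ^ 2 * (β / m) ≤ removalConst k β / m := by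
      rw [mul_div_assoc']
      refine div_le_div_of_nonneg_right ?_ hm0.le
      unfold removalConst
      have : 0 ≤ 2 * k ^ 2 + 64 * k ^ 4 * β ^ 3 +
        (12 * k ^ 2 * β ^ 2) ^ 2 * (2 * β + k * (12 * k ^ 2 * β ^ 2)) := by positivity
      linarith
    linarith
  -- For large `m`, all remaining row sums are nearly `1`. For small `m`, it suffices to compare with
  -- the uniform weight, and to bound the number of edges by that of all subsets.
  · by_cases hbig : 12 * k ^ 2 * β ^ 2 ≤ m
    · have h12 : (12 : ℝ) ≤ m := by
        have h1 : 1 ≤ k ^ 2 * β ^ 2 := one_le_mul_of_one_le_of_one_le (one_le_pow₀ hkR)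
          (one_le_pow₀ hβ)
        linarith
      have h2m : 2 ≤ m - 1 := by
        have : 12 ≤ m := by exact_mod_cast h12
        lia
      have hu := hnear (4 * k * β / m) (by positivity)
        (fun v hv => abs_one_sub_mul_le hkR hβ hbig hMge hMle (hrows v hv).1 (hrows v hv).2) (by
          rw [mul_div_assoc', div_mul_eq_mul_div, div_le_one hm0]
          have : 0 ≤ k ^ 2 * β ^ 2 := by positivity
          linarith) h2m
      have := removal_upper_bound hkR hβ hbig hMge
      linarith
    · push Not at hbig
      have h1 : Real.log (((m : ℝ) - 1) / M) ≤ β + k * m := by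
        have h2 : ((m : ℝ) - 1) / M ≤ β * P2 := by
          rw [div_le_iff₀ hMpos]; linarith
        calc Real.log (((m : ℝ) - 1) / M) ≤ Real.log (β * P2) :=
              Real.log_le_log (div_pos hm1R hMpos) h2
          _ = Real.log β + Real.log P2 := Real.log_mul hβ0.ne' hpp.ne'
          _ ≤ β + k * m := by linarith [Real.log_le_sub_one_of_pos hβ0]
      have h3 : Real.log β ≤ β := by linarith [Real.log_le_sub_one_of_pos hβ0]
      have h4 : Z ≤ m * (2 * β + k * m) := by
        have h5 : ((m : ℝ) - 1) * (2 * β + k * m) ≤ m * (2 * β + k * m) := by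
          have : 0 ≤ 2 * β + k * m := by positivity
          nlinarith
        nlinarith
      have h6 : m * (2 * β + k * m) ≤ removalConst k β / m := by
        rw [le_div_iff₀ hm0]
        have h7 : (m : ℝ) * (2 * β + k * m) * m ≤
            (12 * k ^ 2 * β ^ 2) ^ 2 * (2 * β + k * (12 * k ^ 2 * β ^ 2)) := by
          calc (m : ℝ) * (2 * β + k * m) * m = m ^ 2 * (2 * β + k * m) := by ring
            _ ≤ _ := by gcongr
        unfold removalConst
        have : 0 ≤ 2 * k ^ 2 + 64 * k ^ 4 * β ^ 3 + k ^ 2 * β := by positivity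
        linarith
      linarith

lemma one_div_le_log_sub_log {m : ℕ} (hm : 1 ≤ m) :
    1 / ((m + 1 : ℕ) : ℝ) ≤ Real.log (m + 1 : ℕ) - Real.log m := by
  have h0 : (0 : ℝ) < m := by exact_mod_cast hm
  rw [← Real.log_div (by positivity) (by positivity)]
  refine le_trans ?_ (Real.one_sub_inv_le_log_of_pos (by positivity))
  push_cast
  apply le_of_eq; field_simp; ring

/-- The partition function of a stochastic scaling of a balanced weight is `exp (-m (k - 1))` up to a
polynomial factor. By induction on `m`: the row expansion is a convex combination of the partition
functions that remain when one edge is removed, each of which is made stochastic by factors with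
product `exp (k - 1 + O(1 / m))`; the errors add up to a harmonic sum. The statement allows any
stochastic scaling of `w`, rather than a balanced stochastic weight, so that the balance constant
does not deteriorate in the induction. -/
lemma abs_log_matchingSum_le (hk : 1 ≤ ∑ i, κ i) {α : ℝ} (hα1 : 1 ≤ α) (hm : 1 ≤ m) :
    ∀ {U : Finset V} {w : Finset V → ℝ} {l : V → ℝ}, HasOrder c κ U m → (∀ v, 0 < l v) →
    (∀ S ∈ profileEdges c κ U, 0 < w S) →
    (∀ S ∈ profileEdges c κ U, ∀ T ∈ profileEdges c κ U, w S ≤ α * w T) →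
    (∀ v ∈ U, rowSum (profileEdges c κ U) (fun S => w S * ∏ u ∈ S, l u) v = 1) →
    0 < matchingSum c κ U (fun S => w S * ∏ u ∈ S, l u) ∧
    |Real.log (matchingSum c κ U (fun S => w S * ∏ u ∈ S, l u)) +
        m * ((∑ i, κ i : ℕ) - 1)| ≤
      (∑ i, κ i : ℕ) +
        removalConst (∑ i, κ i : ℕ) (α * (2 * α) ^ (∑ i, κ i)) * Real.log m := by
  have hkR : (1 : ℝ) ≤ (∑ i, κ i : ℕ) := by exact_mod_cast hk
  set k : ℝ := ((∑ i, κ i : ℕ) : ℝ) with hkdef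
  set β : ℝ := α * (2 * α) ^ (∑ i, κ i) with hβdef
  have hβ : 1 ≤ β := one_le_mul_of_one_le_of_one_le hα1 (one_le_pow₀ (by linarith))
  have hC0 : 0 ≤ removalConst k β := by unfold removalConst; positivity
  induction m, hm using Nat.le_induction with
  | base =>
    intro U w l h hl hw hα hrow
    have hU : U.Nonempty := card_pos.1 (by rw [h.card, mul_one]; exact hk)
    obtain ⟨v, hv⟩ := hU
    have h1 := hrow v hv
    have h2 : matchingSum c κ U (fun S => w S * ∏ u ∈ S, l u) = 1 := by
      rw [matchingSum_eq_sum hv, h.profileEdges_one, filter_singleton, if_pos hv, sum_singleton]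
      rw [h.profileEdges_one, rowSum, filter_singleton, if_pos hv, sum_singleton] at h1
      rw [h1, sdiff_self, one_mul, matchingSum]
      have : matchingsOn c κ (∅ : Finset V) = {∅} := by
        ext M
        rw [mem_matchingsOn, mem_singleton]
        constructor
        · rintro ⟨hM, -⟩
          refine eq_empty_of_forall_notMem fun S hS => ?_
          have h3 := subset_empty.1 (subset_of_mem_profileEdges (hM hS))
          have h4 := card_of_mem_profileEdges (hM hS)
          rw [h3, card_empty] at h4
          lia
        · rintro rfl; simp
      rw [bot_eq_empty, this]; simp
    rw [h2]
    refine ⟨one_pos, ?_⟩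
    simp only [Real.log_one, Nat.cast_one, one_mul, zero_add, mul_zero, add_zero]
    rw [abs_of_nonneg (by linarith)]; linarith
  | succ m hm ih =>
    intro U w l h hl hw hα hrow
    have hU : U.Nonempty := card_pos.1 (by rw [h.card]; positivity)
    obtain ⟨v, hv⟩ := hU
    set x : Finset V → ℝ := fun S => w S * ∏ u ∈ S, l u with hxdef
    have hx : ∀ S ∈ profileEdges c κ U, 0 < x S := fun S hS =>
      mul_pos (hw S hS) (prod_pos fun a _ => hl a)
    have hbal : ∀ S ∈ profileEdges c κ U, ∀ T ∈ profileEdges c κ U, x S ≤ β * x T :=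
      fun S hS T hT => scaled_balanced h (by lia) hα1 le_rfl (by simp) hl hw hα
        (fun S _ => rfl) (fun v hv => by rw [hrow v hv]; simp) hS hT
    set B : ℝ := k + removalConst k β * Real.log m with hB
    set D : ℝ := removalConst k β / (m + 1 : ℕ) with hD
    -- the partition functions of the hypergraphs that remain when one edge is removed
    have hstep : ∀ S ∈ profileEdges c κ U,
        Real.exp (-((m + 1 : ℕ) * (k - 1)) - (B + D)) ≤ matchingSum c κ (U \ S) x ∧
        matchingSum c κ (U \ S) x ≤ Real.exp (-((m + 1 : ℕ) * (k - 1)) + (B + D)) := by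
      intro S hS
      have h' := h.sdiff hS
      rw [Nat.add_sub_cancel] at h'
      have hE' : ∀ T ∈ profileEdges c κ (U \ S), T ∈ profileEdges c κ U :=
        fun T hT => profileEdges_mono sdiff_subset hT
      obtain ⟨l', hl', hlx⟩ := exists_scaling h' hm (w := x) fun T hT => hx T (hE' T hT)
      have hrem := removal_scaling h (by lia) hk hβ hx hbal hrow hS hl' hlx
      have hfun : (fun T => x T * ∏ u ∈ T, l' u) = fun T => w T * ∏ u ∈ T, (l u * l' u) := by
        ext T; rw [hxdef, prod_mul_distrib, mul_assoc]
      have hih := ih (U := U \ S) (w := w) (l := fun v => l v * l' v) h'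
        (fun v => mul_pos (hl v) (hl' v)) (fun T hT => hw T (hE' T hT))
        (fun A hA B hB => hα A (hE' A hA) B (hE' B hB)) (by rw [← hfun]; exact hlx)
      rw [← hfun, matchingSum_mul_prod x l'] at hih
      have hlpos : 0 < ∏ v ∈ U \ S, l' v := prod_pos fun v _ => hl' v
      have hP : 0 < matchingSum c κ (U \ S) x := pos_of_mul_pos_left hih.1 hlpos.le
      have h2 := hih.2
      rw [Real.log_mul hP.ne' hlpos.ne', Real.log_prod fun v _ => (hl' v).ne'] at h2
      have h3 := abs_le.1 h2
      have h4 := abs_le.1 hrem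
      rw [← Real.log_le_log_iff (Real.exp_pos _) hP, ← Real.log_le_log_iff hP (Real.exp_pos _),
        Real.log_exp, Real.log_exp]
      rw [← hkdef, ← hD] at h4
      have h5 : ((m + 1 : ℕ) : ℝ) * (k - 1) = m * (k - 1) + (k - 1) := by push_cast; ring
      constructor <;> linarith [h3.1, h3.2, h4.1, h4.2]
    have hconst : ∀ r : ℝ, r = ∑ S ∈ profileEdges c κ U with v ∈ S, x S * r := fun r => by
      have h1 := hrow v hv
      rw [rowSum] at h1
      rw [← sum_mul, h1, one_mul]
    have hge : Real.exp (-((m + 1 : ℕ) * (k - 1)) - (B + D)) ≤ matchingSum c κ U x := by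
      rw [matchingSum_eq_sum hv]
      refine (hconst _).trans_le (sum_le_sum fun S hS => ?_)
      rw [mem_filter] at hS
      exact mul_le_mul_of_nonneg_left (hstep S hS.1).1 (hx S hS.1).le
    have hle : matchingSum c κ U x ≤ Real.exp (-((m + 1 : ℕ) * (k - 1)) + (B + D)) := by
      rw [matchingSum_eq_sum hv]
      refine le_of_le_of_eq (sum_le_sum fun S hS => ?_) (hconst _).symm
      rw [mem_filter] at hS
      exact mul_le_mul_of_nonneg_left (hstep S hS.1).2 (hx S hS.1).le
    have hP : 0 < matchingSum c κ U x := (Real.exp_pos _).trans_le hge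
    refine ⟨hP, ?_⟩
    rw [← Real.log_le_log_iff (Real.exp_pos _) hP, Real.log_exp] at hge
    rw [← Real.log_le_log_iff hP (Real.exp_pos _), Real.log_exp] at hle
    have hlog := one_div_le_log_sub_log hm
    have hDle : B + D ≤ k + removalConst k β * Real.log (m + 1 : ℕ) := by
      have := mul_le_mul_of_nonneg_left hlog hC0
      rw [mul_one_div] at this
      rw [hB, hD]; linarith
    rw [abs_le]
    constructor <;> linarith

end Induction

/-! ### Nearly stochastic scalings and the entropy minimum -/

section NearScaling
variable {V ι : Type*} [DecidableEq V] [DecidableEq ι] [Fintype ι]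
variable {c : V → ι} {κ : ι → ℕ} {U : Finset V} {m : ℕ}

/-- A nearly stochastic scaling determines the partition function up to a polynomial factor. -/
lemma abs_log_matchingSum_add_le (h : HasOrder c κ U m) (hm : 2 ≤ m) (hk : 1 ≤ ∑ i, κ i)
    {α δ : ℝ} (hα1 : 1 ≤ α) (hδ : 0 ≤ δ) (hδα : δ * (4 * (1 + α) + 1) ≤ 1)
    (hδβ : 8 * (∑ i, κ i : ℕ) * δ * (α * (2 * α) ^ (∑ i, κ i)) ≤ 1) (hδm : δ * m ≤ 1)
    {w : Finset V → ℝ} {l : V → ℝ} (hl : ∀ v, 0 < l v)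
    (hw : ∀ S ∈ profileEdges c κ U, 0 < w S)
    (hα : ∀ S ∈ profileEdges c κ U, ∀ T ∈ profileEdges c κ U, w S ≤ α * w T)
    (hrow : ∀ v ∈ U,
      |rowSum (profileEdges c κ U) (fun S => w S * ∏ u ∈ S, l u) v - 1| ≤ δ) :
    0 < matchingSum c κ U w ∧
    |Real.log (matchingSum c κ U w) + ∑ v ∈ U, Real.log (l v) + m * ((∑ i, κ i : ℕ) - 1)| ≤
      9 * (∑ i, κ i : ℕ) + 2 +
        removalConst (∑ i, κ i : ℕ) (α * (2 * α) ^ (∑ i, κ i)) * Real.log m := by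
  have hm1 : 1 ≤ m := by lia
  have hkR : (1 : ℝ) ≤ (∑ i, κ i : ℕ) := by exact_mod_cast hk
  set x : Finset V → ℝ := fun S => w S * ∏ u ∈ S, l u with hxdef
  have hx : ∀ S ∈ profileEdges c κ U, 0 < x S := fun S hS =>
    mul_pos (hw S hS) (prod_pos fun a _ => hl a)
  have hβ : 1 ≤ α * (2 * α) ^ (∑ i, κ i) :=
    one_le_mul_of_one_le_of_one_le hα1 (one_le_pow₀ (by linarith))
  have hbal : ∀ S ∈ profileEdges c κ U, ∀ T ∈ profileEdges c κ U,
      x S ≤ α * (2 * α) ^ (∑ i, κ i) * x T :=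
    fun S hS T hT => scaled_balanced h hm hα1 hδ hδα hl hw hα (fun S _ => rfl) hrow hS hT
  -- The factors that correct the nearly stochastic scaling have product `exp (O(1))`.
  obtain ⟨l', hl', hlx⟩ := exists_scaling h hm1 hx
  have hfun : (fun T => x T * ∏ u ∈ T, l' u) = fun T => w T * ∏ u ∈ T, (l u * l' u) := by
    ext T; rw [hxdef, prod_mul_distrib, mul_assoc]
  have hmain := abs_log_matchingSum_le hk hα1 hm1 h (l := fun v => l v * l' v)
    (fun v => mul_pos (hl v) (hl' v)) hw hα (by rw [← hfun]; exact hlx)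
  have hll : 0 < ∏ v ∈ U, (l v * l' v) := prod_pos fun v _ => mul_pos (hl v) (hl' v)
  rw [matchingSum_mul_prod] at hmain
  have hP : 0 < matchingSum c κ U w := pos_of_mul_pos_left hmain.1 hll.le
  refine ⟨hP, ?_⟩
  have h1 := hmain.2
  rw [Real.log_mul hP.ne' hll.ne', prod_mul_distrib,
    Real.log_mul (prod_pos fun v _ => hl v).ne' (prod_pos fun v _ => hl' v).ne',
    Real.log_prod fun v _ => (hl v).ne', Real.log_prod fun v _ => (hl' v).ne'] at h1
  -- the total weight is nearly `m`
  have hM := sum_rowSum (subset_refl (profileEdges c κ U)) x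
  have hMle : ∑ v ∈ U, rowSum (profileEdges c κ U) x v ≤ #U • (1 + δ) :=
    sum_le_card_nsmul _ _ _ fun v hv => by linarith [(abs_le.1 (hrow v hv)).2]
  have hMge : #U • (1 - δ) ≤ ∑ v ∈ U, rowSum (profileEdges c κ U) x v :=
    card_nsmul_le_sum _ _ _ fun v hv => by linarith [(abs_le.1 (hrow v hv)).1]
  rw [hM, h.card, nsmul_eq_mul, Nat.cast_mul, mul_assoc] at hMle hMge
  replace hMle := le_of_mul_le_mul_left hMle (by linarith)
  replace hMge := le_of_mul_le_mul_left hMge (by linarith)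
  have hm2 : (2 : ℝ) ≤ m := by exact_mod_cast hm
  have hδ2 : δ ≤ 1 / 2 := by nlinarith
  have hMpos : 0 < ∑ S ∈ profileEdges c κ U, x S := by nlinarith
  have hlow := le_sum_log_scaling h hm1 hk hl' hx hlx
  have hupp := sum_log_scaling_le_of_near h hm hk hl' hlx (by linarith) (e := 4 * δ)
    (by positivity) hx hbal rfl (fun v hv => by
      obtain ⟨hr1, hr2⟩ := abs_le.1 (hrow v hv)
      generalize rowSum (profileEdges c κ U) x v = r at hr1 hr2
      generalize ∑ S ∈ profileEdges c κ U, x S = M at *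
      have h2 : 1 - m / M * r = (M - m * r) / M := by field_simp
      rw [h2, abs_div, abs_of_pos hMpos, div_le_iff₀ hMpos]
      have h3 : δ * m * δ ≤ δ * m * (1 / 2) := mul_le_mul_of_nonneg_left hδ2 (by positivity)
      have h4 : 2 * (δ * m) ≤ 4 * δ * M := by nlinarith
      rw [abs_le]
      constructor <;> nlinarith) (by linarith)
  generalize ∑ S ∈ profileEdges c κ U, x S = M at *
  have hm0 : (0 : ℝ) < m := by linarith
  have hq : 0 < (m : ℝ) / M := div_pos hm0 hMpos
  have hlog1 : -1 ≤ m * Real.log (m / M) := by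
    have h2 := mul_le_mul_of_nonneg_left (Real.one_sub_inv_le_log_of_pos hq) hm0.le
    have h3 : (m : ℝ) * (1 - ((m : ℝ) / M)⁻¹) = m - M := by field_simp
    linarith
  have hlog2 : m * Real.log (m / M) ≤ 2 := by
    have h2 := mul_le_mul_of_nonneg_left (Real.log_le_sub_one_of_pos hq) hm0.le
    refine h2.trans ?_
    have h3 : (m : ℝ) * (m / M - 1) = m * (m - M) / M := by field_simp
    rw [h3, div_le_iff₀ hMpos]
    have h4 : (m : ℝ) * (m - M) ≤ m * 1 := mul_le_mul_of_nonneg_left (by linarith) hm0.le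
    nlinarith
  have herr : 4 * ((∑ i, κ i : ℕ) : ℝ) ^ 2 * (4 * δ) ^ 2 * m * (α * (2 * α) ^ (∑ i, κ i)) ≤
      8 * (∑ i, κ i : ℕ) := by
    calc 4 * ((∑ i, κ i : ℕ) : ℝ) ^ 2 * (4 * δ) ^ 2 * m * (α * (2 * α) ^ (∑ i, κ i))
        = 8 * (∑ i, κ i : ℕ) * (δ * m) *
          (8 * (∑ i, κ i : ℕ) * δ * (α * (2 * α) ^ (∑ i, κ i))) := by ring
      _ ≤ 8 * (∑ i, κ i : ℕ) * 1 * 1 := by gcongr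
      _ = _ := by ring
  rw [abs_le] at h1 ⊢
  constructor <;> linarith [h1.1, h1.2]

end NearScaling

section Profiles
variable {V : Type*} [DecidableEq V] [Fintype V]

/-- Complete uniform and complete partite hypergraphs are both given by a coloring and a profile. -/
lemma exists_profile {k m : ℕ} {H : Finset (Finset V)} (hcard : Fintype.card V = k * m)
    (hH : IsCompleteUniform k H ∨ IsCompletePartite k m H) :
    ∃ (n : ℕ) (c : V → Fin n) (κ : Fin n → ℕ), ∑ i, κ i = k ∧ HasOrder c κ univ m ∧
      H = profileEdges c κ univ := by
  rcases hH with hH | ⟨part, hdisj, hcov, hsize, hH⟩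
  · refine ⟨1, fun _ => 0, fun _ => k, by simp, fun i => ?_, ?_⟩
    · simp [Subsingleton.elim i 0, hcard]
    · ext S
      rw [hH S, mem_profileEdges]
      simp
  · choose c hc using hcov
    have hpart : ∀ i v, v ∈ part i ↔ c v = i := by
      intro i v
      constructor
      · intro hv
        by_contra hne
        exact disjoint_left.1 (hdisj _ _ hne) (hc v) hv
      · rintro rfl; exact hc v
    refine ⟨k, c, fun _ => 1, by simp, fun i => ?_, ?_⟩
    · rw [one_mul, ← hsize i]
      congr 1; ext v; simp [hpart]
    · ext S
      rw [hH S, mem_profileEdges]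
      simp only [subset_univ, true_and]
      refine forall_congr' fun i => ?_
      have : S ∩ part i = ({v ∈ S | c v = i} : Finset V) := by
        ext v; simp [hpart]
      rw [← this]
      exact Eq.congr_left (congrArg card (by ext; simp))

end Profiles

section EntropyMinimum
variable {V : Type*} [DecidableEq V]

/-- The weight on all sets that is `0` outside the hypergraph. -/
def extendWeight {H : Finset (Finset V)} (W : {S // S ∈ H} → ℝ) (S : Finset V) : ℝ :=
  if h : S ∈ H then W ⟨S, h⟩ else 0

lemma extendWeight_coe {H : Finset (Finset V)} (W : {S // S ∈ H} → ℝ) (S : {S // S ∈ H}) :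
    extendWeight W S.1 = W S := by simp [extendWeight]

lemma sum_subtype_eq {H : Finset (Finset V)} (F : Finset V → ℝ) :
    ∑ S : {S // S ∈ H}, F S.1 = ∑ S ∈ H, F S := by
  rw [univ_eq_attach, sum_attach H F]

lemma mem_stochasticWeights_iff {H : Finset (Finset V)} {X : {S // S ∈ H} → ℝ} :
    X ∈ stochasticWeights H ↔
      (∀ S, 0 ≤ X S) ∧ ∀ v, rowSum H (extendWeight X) v = 1 := by
  have : ∀ v, ∑ S : {S // S ∈ H} with v ∈ S.1, X S = rowSum H (extendWeight X) v := by
    intro v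
    rw [rowSum, sum_filter, sum_filter, ← sum_subtype_eq]
    exact sum_congr rfl fun S _ => by rw [extendWeight_coe]
  rw [stochasticWeights, Set.mem_ofPred_eq]
  refine and_congr Iff.rfl (forall_congr' fun v => ?_)
  rw [← this]
  exact Eq.congr_left (sum_congr (by ext; simp) fun _ _ => rfl)

lemma entropyFun_eq {H : Finset (Finset V)} (W X : {S // S ∈ H} → ℝ) :
    entropyFun W X =
      ∑ S ∈ H, extendWeight X S * Real.log (extendWeight X S / extendWeight W S) := by
  rw [← sum_subtype_eq, entropyFun]
  exact sum_congr rfl fun S _ => by rw [extendWeight_coe, extendWeight_coe]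

lemma partitionFunction_eq [Fintype V] {ι : Type*} [DecidableEq ι] [Fintype ι] {c : V → ι}
    {κ : ι → ℕ} (W : {S // S ∈ profileEdges c κ univ} → ℝ) :
    partitionFunction W = matchingSum c κ univ (extendWeight W) := by
  rw [partitionFunction, matchingSum]
  refine sum_bij' (fun M _ => M.map (Function.Embedding.subtype _))
    (fun M _ => M.subtype (· ∈ profileEdges c κ univ)) ?_ ?_ ?_ ?_ ?_
  · intro M hM
    simp only [mem_filter, mem_univ, true_and] at hM
    refine mem_matchingsOn.2 ⟨?_, ?_, ?_⟩
    · intro S hS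
      obtain ⟨T, -, rfl⟩ := mem_map.1 hS
      exact T.2
    · intro S hS T hT hST
      obtain ⟨A, hA, rfl⟩ := mem_map.1 hS
      obtain ⟨B, hB, rfl⟩ := mem_map.1 hT
      exact hM.1 A hA B hB fun e => hST (congrArg _ e)
    · intro v _
      obtain ⟨S, hS, hv⟩ := hM.2 v
      exact ⟨S.1, mem_map_of_mem _ hS, hv⟩
  · intro M hM
    obtain ⟨h1, h2, h3⟩ := mem_matchingsOn.1 hM
    simp only [mem_filter, mem_univ, true_and]
    refine ⟨fun S hS T hT hST => h2 _ (mem_subtype.1 hS) _ (mem_subtype.1 hT)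
      fun e => hST (Subtype.ext e), fun v => ?_⟩
    obtain ⟨S, hS, hv⟩ := h3 v (mem_univ _)
    exact ⟨⟨S, h1 hS⟩, mem_subtype.2 hS, hv⟩
  · intro M _
    ext S; simp
  · intro M hM
    have h1 := (mem_matchingsOn.1 hM).1
    ext S
    simp only [mem_map, mem_subtype, Function.Embedding.subtype_apply, Subtype.exists,
      exists_and_left, exists_prop, exists_eq_right_right]
    exact ⟨fun h => h.1, fun h => ⟨h, h1 h⟩⟩
  · intro M _
    rw [prod_map]
    exact prod_congr rfl fun S _ => (extendWeight_coe W S).symm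

lemma convex_stochasticWeights {V : Type*} (H : Finset (Finset V)) :
    Convex ℝ (stochasticWeights H) := by
  intro X hX Y hY a b ha hb hab
  refine ⟨fun S => ?_, fun v => ?_⟩
  · have := hX.1 S; have := hY.1 S
    simp only [Pi.add_apply, Pi.smul_apply, smul_eq_mul]; positivity
  · simp only [Pi.add_apply, Pi.smul_apply, smul_eq_mul]
    rw [sum_add_distrib, ← mul_sum, ← mul_sum, hX.2 v, hY.2 v]
    linarith

lemma mul_log_div_eq {w t : ℝ} (hw : 0 < w) :
    t * Real.log (t / w) = t * Real.log t - t * Real.log w := by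
  by_cases ht : t = 0
  · simp [ht]
  · rw [Real.log_div ht hw.ne']; ring

lemma strictConvexOn_mul_log_div {w : ℝ} (hw : 0 < w) :
    StrictConvexOn ℝ (Set.Ici 0) fun t : ℝ => t * Real.log (t / w) := by
  refine ⟨convex_Ici 0, fun x hx y hy hxy a b ha hb hab => ?_⟩
  have := Real.strictConvexOn_mul_log.2 hx hy hxy ha hb hab
  simp only [smul_eq_mul, mul_log_div_eq hw] at this ⊢
  linarith

lemma strictConvexOn_entropyFun {V : Type*} {H : Finset (Finset V)} {W : {S // S ∈ H} → ℝ}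
    (hW : ∀ S, 0 < W S) : StrictConvexOn ℝ (stochasticWeights H) (entropyFun W) := by
  refine ⟨convex_stochasticWeights H, fun X hX Y hY hXY a b ha hb hab => ?_⟩
  obtain ⟨T, hT⟩ := Function.ne_iff.1 hXY
  simp only [entropyFun, smul_eq_mul, mul_sum, ← sum_add_distrib]
  refine sum_lt_sum (fun S _ => ?_) ⟨T, mem_univ _, ?_⟩
  · exact (strictConvexOn_mul_log_div (hW S)).convexOn.2 (hX.1 S) (hY.1 S) ha.le hb.le hab
  · exact (strictConvexOn_mul_log_div (hW T)).2 (hX.1 T) (hY.1 T) hT ha hb hab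

/-- The minimum `ζ` of the entropy is attained by the stochastic scaling of `W`; it is the sum of the
logarithms of the scaling factors and determines the partition function up to a polynomial factor. -/
lemma exists_isLeast_entropyFun [Fintype V] {ι : Type*} [DecidableEq ι] [Fintype ι] {c : V → ι}
    {κ : ι → ℕ} {m : ℕ} (h : HasOrder c κ univ m) (hm : 1 ≤ m) (hk : 1 ≤ ∑ i, κ i) {α : ℝ}
    (hα : 1 ≤ α) {W : {S // S ∈ profileEdges c κ univ} → ℝ} (hW : IsBalanced α W) :
    ∃ ζ : ℝ, IsLeast (entropyFun W '' stochasticWeights (profileEdges c κ univ)) ζ ∧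
      0 < partitionFunction W ∧
      |Real.log (partitionFunction W) + ζ + m * ((∑ i, κ i : ℕ) - 1)| ≤ (∑ i, κ i : ℕ) +
        removalConst (∑ i, κ i : ℕ) (α * (2 * α) ^ (∑ i, κ i)) * Real.log m := by
  have hw : ∀ S ∈ profileEdges c κ univ, 0 < extendWeight W S := fun S hS => by
    rw [extendWeight, dif_pos hS]; exact hW.1 _
  have hb : ∀ S ∈ profileEdges c κ univ, ∀ T ∈ profileEdges c κ univ,
      extendWeight W S ≤ α * extendWeight W T := fun S hS T hT => by
    rw [extendWeight, dif_pos hS, extendWeight, dif_pos hT]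
    exact (div_le_iff₀ (hW.1 _)).1 (hW.2 ⟨S, hS⟩ ⟨T, hT⟩)
  obtain ⟨l, hl, hrow⟩ := exists_scaling h hm hw
  have hX : ∀ S ∈ profileEdges c κ univ,
      extendWeight (fun S : {S // S ∈ profileEdges c κ univ} => W S * ∏ u ∈ S.1, l u) S =
        extendWeight W S * ∏ u ∈ S, l u := fun S hS => by simp [extendWeight, dif_pos hS]
  refine ⟨∑ v, Real.log (l v), ⟨⟨fun S => W S * ∏ u ∈ S.1, l u, ?_, ?_⟩, ?_⟩, ?_⟩
  · refine mem_stochasticWeights_iff.2 ⟨fun S =>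
      (mul_pos (hW.1 S) (prod_pos fun v _ => hl v)).le, fun v => ?_⟩
    rw [← hrow v (mem_univ _)]
    exact sum_congr rfl fun S hS => hX S (mem_filter.1 hS).1
  · rw [entropyFun_eq, ← sum_log_scaling_eq hl hw hrow]
    exact sum_congr rfl fun S hS => by rw [hX S hS]
  · rintro _ ⟨X, hXs, rfl⟩
    rw [mem_stochasticWeights_iff] at hXs
    rw [entropyFun_eq]
    refine sum_log_scaling_le h hk hl hw hrow (fun S hS => ?_) fun v _ => hXs.2 v
    rw [extendWeight, dif_pos hS]; exact hXs.1 _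
  · have hmain := abs_log_matchingSum_le hk hα hm h hl hw hb hrow
    have hlpos : 0 < ∏ v, l v := prod_pos fun v _ => hl v
    rw [matchingSum_mul_prod] at hmain
    rw [partitionFunction_eq]
    have hP := pos_of_mul_pos_left hmain.1 hlpos.le
    refine ⟨hP, ?_⟩
    have h1 := hmain.2
    rwa [Real.log_mul hP.ne' hlpos.ne', Real.log_prod fun v _ => (hl v).ne'] at h1

lemma rpow_bounds_of_abs_log_le {P η γ m : ℝ} (hm : 0 < m) (hP : 0 < P) (hη : 0 < η)
    (h : |Real.log P - Real.log η| ≤ γ * Real.log m) :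
    η * m ^ (-γ) ≤ P ∧ P ≤ η * m ^ γ := by
  have h1 := abs_le.1 h
  rw [← Real.exp_log hP, ← Real.exp_log hη, Real.rpow_def_of_pos hm, Real.rpow_def_of_pos hm,
    ← Real.exp_add, ← Real.exp_add, Real.exp_le_exp, Real.exp_le_exp]
  constructor <;> linarith [h1.1, h1.2]

end EntropyMinimum

/-! ### Program logic for the machine -/

section Logic

/-- `p.Within S t s Q`: if all cells of the memory `s` are in `S`, then the program `p`, started
from `s`, is finished after at most `t` steps, all numbers that occur in the cells are in `S`, and
the final memory satisfies `Q`. -/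
def Program.Within (S : ℝ → Prop) (t : ℕ) (p : Program) (s : Memory) (Q : Memory → Prop) : Prop :=
  (∀ a, S (s.cell a)) → ∃ t' ≤ t, ∃ s', Q s' ∧ ∀ ps,
    (∀ j ≤ t', ∀ a, S ((Config.step^[j] ⟨p :: ps, s⟩).mem.cell a)) ∧
    Config.step^[t'] ⟨p :: ps, s⟩ = ⟨ps, s'⟩

variable {S : ℝ → Prop} {t t₁ t₂ : ℕ} {p q : Program} {s : Memory} {Q Q' : Memory → Prop}

namespace Program

lemma Within.mono (h : p.Within S t₁ s Q') (ht : t₁ ≤ t) (hQ : ∀ s', Q' s' → Q s') :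
    p.Within S t s Q := fun hs =>
  let ⟨t', h1, s', h2, h3⟩ := h hs
  ⟨t', h1.trans ht, s', hQ s' h2, h3⟩

lemma Within.of_step {s' : Memory} (hstep : ∀ ps, Config.step ⟨p :: ps, s⟩ = ⟨ps, s'⟩)
    (hS : (∀ a, S (s.cell a)) → ∀ a, S (s'.cell a)) (hQ : Q s') : p.Within S 1 s Q := by
  intro hs
  refine ⟨1, le_rfl, s', hQ, fun ps => ⟨fun j hj a => ?_, hstep ps⟩⟩
  interval_cases j
  · exact hs a
  · rw [Function.iterate_one, hstep]; exact hS hs a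

/-- A first step that only unfolds the program, followed by the programs `p'`. -/
lemma Within.trans_step {p' : List Program}
    (hstep : ∀ ps, Config.step ⟨p :: ps, s⟩ = ⟨p' ++ ps, s⟩)
    (h : (∀ a, S (s.cell a)) → ∃ t' ≤ t, ∃ s', Q s' ∧ ∀ ps,
      (∀ j ≤ t', ∀ a, S ((Config.step^[j] ⟨p' ++ ps, s⟩).mem.cell a)) ∧
      Config.step^[t'] ⟨p' ++ ps, s⟩ = ⟨ps, s'⟩) : p.Within S (t + 1) s Q := by
  intro hs
  obtain ⟨t', ht', s', hQ, h'⟩ := h hs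
  refine ⟨t' + 1, by lia, s', hQ, fun ps => ⟨fun j hj a => ?_, ?_⟩⟩
  · rcases j with _ | j
    · exact hs a
    · rw [Function.iterate_succ_apply, hstep]
      exact (h' ps).1 j (by lia) a
  · rw [Function.iterate_succ_apply, hstep]
    exact (h' ps).2

/-- Sequential composition of `p` with a list of programs. -/
lemma Within.append {p' : List Program} {R : Memory → Prop} (h : p.Within S t₁ s R)
    (hs : ∀ a, S (s.cell a))
    (h' : ∀ s₁, R s₁ → (∀ a, S (s₁.cell a)) → ∃ t' ≤ t₂, ∃ s', Q s' ∧ ∀ ps,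
      (∀ j ≤ t', ∀ a, S ((Config.step^[j] ⟨p' ++ ps, s₁⟩).mem.cell a)) ∧
      Config.step^[t'] ⟨p' ++ ps, s₁⟩ = ⟨ps, s'⟩) :
    ∃ t' ≤ t₁ + t₂, ∃ s', Q s' ∧ ∀ ps,
      (∀ j ≤ t', ∀ a, S ((Config.step^[j] ⟨p :: p' ++ ps, s⟩).mem.cell a)) ∧
      Config.step^[t'] ⟨p :: p' ++ ps, s⟩ = ⟨ps, s'⟩ := by
  obtain ⟨a₁, ha₁, s₁, hR, h1⟩ := h hs
  have hs₁ : ∀ a, S (s₁.cell a) := fun a => by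
    have h2 := (h1 []).1 a₁ le_rfl a
    rwa [(h1 []).2] at h2
  obtain ⟨a₂, ha₂, s', hQ, h2⟩ := h' s₁ hR hs₁
  refine ⟨a₁ + a₂, by lia, s', hQ, fun ps => ⟨fun j hj a => ?_, ?_⟩⟩
  · rcases le_total j a₁ with hj1 | hj1
    · exact (h1 (p' ++ ps)).1 j hj1 a
    · obtain ⟨i, rfl⟩ := Nat.exists_eq_add_of_le hj1
      rw [add_comm, Function.iterate_add_apply, List.cons_append, (h1 (p' ++ ps)).2]
      exact (h2 ps).1 i (by lia) a
  · rw [add_comm, Function.iterate_add_apply, List.cons_append, (h1 (p' ++ ps)).2]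
    exact (h2 ps).2

lemma Within.seq (h : p.Within S t₁ s fun s₁ => q.Within S t₂ s₁ Q) :
    (Program.seq p q).Within S (t₁ + t₂ + 1) s Q := by
  refine Within.trans_step (p' := [p, q]) (fun ps => rfl) fun hs => ?_
  exact h.append (p' := [q]) hs fun s₁ h1 hs₁ => h1 hs₁

lemma within_skip (hQ : Q s) : Program.skip.Within S 1 s Q :=
  Within.of_step (fun _ => rfl) (fun h => h) hQ

lemma within_ifCounterLt {i j : ℕ} (h1 : s.counter i < s.counter j → p.Within S t s Q)
    (h2 : ¬ s.counter i < s.counter j → q.Within S t s Q) :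
    (Program.ifCounterLt i j p q).Within S (t + 1) s Q := by
  by_cases h : s.counter i < s.counter j
  · exact Within.trans_step (p' := [p]) (fun ps => by simp [Config.step, h]) (h1 h)
  · exact Within.trans_step (p' := [q]) (fun ps => by simp [Config.step, h]) (h2 h)

lemma within_ifLt {i j : ℕ}
    (h1 : s.cell (s.counter i) < s.cell (s.counter j) → p.Within S t s Q)
    (h2 : ¬ s.cell (s.counter i) < s.cell (s.counter j) → q.Within S t s Q) :
    (Program.ifLt i j p q).Within S (t + 1) s Q := by
  by_cases h : s.cell (s.counter i) < s.cell (s.counter j)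
  · exact Within.trans_step (p' := [p]) (fun ps => by simp [Config.step, h]) (h1 h)
  · exact Within.trans_step (p' := [q]) (fun ps => by simp [Config.step, h]) (h2 h)

lemma within_while_aux {i l n : ℕ} {I : ℕ → Memory → Prop}
    (hbody : ∀ j < n, ∀ s, I j s →
      s.counter i < s.counter l ∧ p.Within S t s (I (j + 1)))
    (hend : ∀ s, I n s → ¬ s.counter i < s.counter l) :
    ∀ d j, j + d = n → ∀ s, I j s →
      (Program.whileCounterLt i l p).Within S (d * (t + 1) + 1) s (I n) := by
  intro d
  induction d with
  | zero =>
    intro j hj s hI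
    obtain rfl : j = n := by lia
    have h := hend s hI
    refine (Within.of_step (s' := s) (fun ps => by simp [Config.step, h]) (fun h => h) hI).mono
      (by lia) fun _ h => h
  | succ d ih =>
    intro j hj s hI
    obtain ⟨h1, h2⟩ := hbody j (by lia) s hI
    have h3 := Within.trans_step (S := S) (Q := I n) (t := t + (d * (t + 1) + 1))
      (p := Program.whileCounterLt i l p)
      (p' := [p, Program.whileCounterLt i l p]) (s := s)
      (fun ps => by simp [Config.step, h1]) fun hs =>
        h2.append (p' := [Program.whileCounterLt i l p]) hs fun s₁ hI₁ hs₁ =>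
          ih (j + 1) (by lia) s₁ hI₁ hs₁
    exact h3.mono (by rw [Nat.succ_mul]; lia) fun _ h => h

/-- The rule for loops with `n` rounds and the invariant `I`. -/
lemma within_while {i l n : ℕ} (I : ℕ → Memory → Prop)
    (h0 : I 0 s)
    (hbody : ∀ j < n, ∀ s, I j s →
      s.counter i < s.counter l ∧ p.Within S t s (I (j + 1)))
    (hend : ∀ s, I n s → ¬ s.counter i < s.counter l) :
    (Program.whileCounterLt i l p).Within S (n * (t + 1) + 1) s (I n) :=
  within_while_aux hbody hend n 0 (by lia) s h0

/-- The effect of a single instruction on the memory. -/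
noncomputable def effect : Program → Memory → Memory
  | setCounter i n, s => ⟨Function.update s.counter i n, s.cell⟩
  | addCounter i j l, s => ⟨Function.update s.counter i (s.counter j + s.counter l), s.cell⟩
  | subCounter i j l, s => ⟨Function.update s.counter i (s.counter j - s.counter l), s.cell⟩
  | fromCounter i j, s =>
      ⟨s.counter, Function.update s.cell (s.counter i) (s.counter j : ℝ)⟩
  | arith op i j l, s => ⟨s.counter, Function.update s.cell (s.counter i)
        (op.eval (s.cell (s.counter j)) (s.cell (s.counter l)))⟩
  | _, s => s

/-- The program is a single instruction, it does not divide by zero, and the number that it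
computes is in `S`. -/
def Admissible (S : ℝ → Prop) : Program → Memory → Prop
  | setCounter _ _, _ => True
  | addCounter _ _ _, _ => True
  | subCounter _ _ _, _ => True
  | fromCounter _ j, s => S (s.counter j)
  | arith op _ j l, s => (op = .div → s.cell (s.counter l) ≠ 0) ∧
      S (op.eval (s.cell (s.counter j)) (s.cell (s.counter l)))
  | _, _ => False

lemma within_of_admissible (h : p.Admissible S s) (hQ : Q (p.effect s)) : p.Within S 1 s Q := by
  have hupd : ∀ (a : ℕ) (x : ℝ), S x → (∀ b, S (s.cell b)) →
      ∀ b, S (Function.update s.cell a x b) := by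
    intro a x hx hs b
    rw [Function.update_apply]; split_ifs
    · exact hx
    · exact hs b
  cases p with
  | setCounter i n => exact Within.of_step (fun _ => rfl) (fun h => h) hQ
  | addCounter i j l => exact Within.of_step (fun _ => rfl) (fun h => h) hQ
  | subCounter i j l => exact Within.of_step (fun _ => rfl) (fun h => h) hQ
  | fromCounter i j => exact Within.of_step (fun _ => rfl) (hupd _ _ h) hQ
  | arith op i j l =>
    refine Within.of_step (fun ps => ?_) (hupd _ _ h.2) hQ
    have : ¬ (op = .div ∧ s.cell (s.counter l) = 0) := fun h' => h.1 h'.1 h'.2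
    simp [Config.step, this, effect]
  | _ => exact h.elim

/-- A sequence of programs. -/
def block : List Program → Program
  | [] => skip
  | p :: ps => seq p (block ps)

/-- The effect of a sequence of single instructions on the memory. -/
noncomputable def blockEffect : List Program → Memory → Memory
  | [], s => s
  | p :: ps, s => blockEffect ps (p.effect s)

/-- All instructions are admissible when they are executed in this order. -/
def BlockAdmissible (S : ℝ → Prop) : List Program → Memory → Prop
  | [], _ => True
  | p :: ps, s => p.Admissible S s ∧ BlockAdmissible S ps (p.effect s)

lemma within_block {ps : List Program} (h : BlockAdmissible S ps s) (hQ : Q (blockEffect ps s))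
    (ht : 2 * ps.length + 1 ≤ t := by simp) : (block ps).Within S t s Q := by
  induction ps generalizing s t with
  | nil => exact (within_skip hQ).mono ht fun _ h => h
  | cons p ps ih =>
    simp only [List.length_cons] at ht
    exact (Within.seq (t₁ := 1) (t₂ := 2 * ps.length + 1)
      (within_of_admissible h.1 (ih h.2 hQ le_rfl))).mono (by lia) fun _ h => h

end Program

/-- The largest constant that the program can write into a counter. -/
def Program.maxConst : Program → ℕ
  | .setCounter _ n => n
  | .seq p q => max p.maxConst q.maxConst
  | .ifCounterLt _ _ p q => max p.maxConst q.maxConst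
  | .ifLt _ _ p q => max p.maxConst q.maxConst
  | .whileCounterLt _ _ p => p.maxConst
  | _ => 0

lemma Config.step_counter_le {B X : ℕ} (hB : B ≤ X) {c : Config}
    (hc : ∀ p ∈ c.todo, p.maxConst ≤ B) (hX : ∀ i, c.mem.counter i ≤ X) :
    (∀ p ∈ c.step.todo, p.maxConst ≤ B) ∧ ∀ i, c.step.mem.counter i ≤ 2 * X := by
  have hX2 : ∀ i, c.mem.counter i ≤ 2 * X := fun i => (hX i).trans (by lia)
  have hupd : ∀ (i v : ℕ), v ≤ 2 * X → ∀ j, Function.update c.mem.counter i v j ≤ 2 * X := by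
    intro i v hv j
    rw [Function.update_apply]; split_ifs
    · exact hv
    · exact hX2 j
  obtain ⟨todo, s⟩ := c
  rcases todo with _ | ⟨p, ps⟩
  · exact ⟨hc, hX2⟩
  · have hp := hc p (by simp)
    have hps : ∀ q ∈ ps, q.maxConst ≤ B := fun q hq => hc q (by simp [hq])
    cases p with
    | setCounter i n => exact ⟨hps, hupd _ _ (by simp only [Program.maxConst] at hp; lia)⟩
    | addCounter i j l =>
      exact ⟨hps, hupd _ _ (by have := hX j; have := hX l; dsimp only at *; lia)⟩
    | subCounter i j l =>
      exact ⟨hps, hupd _ _ (by have := hX j; have := hX l; dsimp only at *; lia)⟩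
    | fromCounter i j => exact ⟨hps, hX2⟩
    | arith op i j l =>
      simp only [Config.step]
      split_ifs
      · exact ⟨hc, hX2⟩
      · exact ⟨hps, hX2⟩
    | skip => exact ⟨hps, hX2⟩
    | seq p q =>
      simp only [Program.maxConst, max_le_iff] at hp
      refine ⟨?_, hX2⟩
      simp only [Config.step, List.forall_mem_cons]
      exact ⟨hp.1, hp.2, hps⟩
    | ifCounterLt i j p q =>
      simp only [Program.maxConst, max_le_iff] at hp
      refine ⟨?_, hX2⟩
      simp only [Config.step, List.forall_mem_cons]
      refine ⟨?_, hps⟩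
      split_ifs
      exacts [hp.1, hp.2]
    | ifLt i j p q =>
      simp only [Program.maxConst, max_le_iff] at hp
      refine ⟨?_, hX2⟩
      simp only [Config.step, List.forall_mem_cons]
      refine ⟨?_, hps⟩
      split_ifs
      exacts [hp.1, hp.2]
    | whileCounterLt i j p =>
      simp only [Config.step]
      split_ifs
      · exact ⟨by simp only [List.forall_mem_cons]; exact ⟨hp, hp, hps⟩, hX2⟩
      · exact ⟨hps, hX2⟩

/-- The largest counter at most doubles in every step, as long as it is at least as large as the
constants in the program. -/
lemma Program.run_counter_le (p : Program) (s : Memory) {X : ℕ} (hp : p.maxConst ≤ X)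
    (hX : ∀ i, s.counter i ≤ X) (t i : ℕ) : (p.run s t).mem.counter i ≤ 2 ^ t * X := by
  suffices H : ∀ t, (∀ q ∈ (p.run s t).todo, q.maxConst ≤ p.maxConst) ∧
      ∀ i, (p.run s t).mem.counter i ≤ 2 ^ t * X from (H t).2 i
  intro t
  induction t with
  | zero => exact ⟨by simp [Program.run], by simpa [Program.run] using hX⟩
  | succ t ih =>
    have h := Config.step_counter_le (B := p.maxConst) (X := 2 ^ t * X)
      (hp.trans (Nat.le_mul_of_pos_left _ (by positivity))) ih.1 ih.2
    rw [Program.run, Function.iterate_succ_apply', pow_succ']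
    simp only [mul_assoc]
    exact h

lemma Config.iterate_step_of_halted (s : Memory) (j : ℕ) :
    Config.step^[j] ⟨[], s⟩ = ⟨[], s⟩ := by
  induction j with
  | zero => rfl
  | succ j ih => rw [Function.iterate_succ_apply, show Config.step ⟨[], s⟩ = ⟨[], s⟩ from rfl, ih]

/-- A program that halts satisfies its bounds at all times. -/
lemma Program.Within.run {S : ℝ → Prop} {t : ℕ} {p : Program} {s : Memory} {Q : Memory → Prop}
    (h : p.Within S t s Q) (hs : ∀ a, S (s.cell a)) :
    ∃ t' ≤ t, (p.run s t').todo = [] ∧ Q (p.run s t').mem ∧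
      (∀ j a, S ((p.run s j).mem.cell a)) ∧
      ∀ j, ∃ j' ≤ t', p.run s j = p.run s j' := by
  obtain ⟨t', ht', s', hQ, h1⟩ := h hs
  obtain ⟨h2, h3⟩ := h1 []
  have hlate : ∀ j, ∃ j' ≤ t', p.run s j = p.run s j' := by
    intro j
    rcases le_total j t' with hj | hj
    · exact ⟨j, hj, rfl⟩
    · refine ⟨t', le_rfl, ?_⟩
      obtain ⟨i, rfl⟩ := Nat.exists_eq_add_of_le hj
      rw [Program.run, Program.run, add_comm, Function.iterate_add_apply, h3,
        Config.iterate_step_of_halted]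
  refine ⟨t', ht', by rw [Program.run, h3], by rw [Program.run, h3]; exact hQ, fun j a => ?_,
    hlate⟩
  obtain ⟨j', hj', e⟩ := hlate j
  rw [e]; exact h2 j' hj' a

end Logic

/-! ### Approximate scaling by coordinate ascent -/

section Ascent
variable (N : ℕ) (D : ℕ → Finset ℕ) (A : ℕ → ℝ) (lo hi τ : ℝ)

/-- The entry with index `a` of the array `A`, multiplied by the scaling factors `l u` of all `u` in the
set `D a` of digits of `a`. -/
def scaledEntry (l : ℕ → ℝ) (a : ℕ) : ℝ := A a * ∏ u ∈ D a, l u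

/-- The sum of the scaled entries whose index has the digit `u`. -/
def scaledRow (l : ℕ → ℝ) (u : ℕ) : ℝ := ∑ a ∈ range N with u ∈ D a, scaledEntry D A l a

open Classical in
/-- The factor by which the scaling factor of `u` is multiplied: one step up or down if the row sum
is outside of the interval `[lo, hi]`, and `1` otherwise. Factors are only taken from this set, as
exact normalization could make the bit sizes grow exponentially. -/
noncomputable def scaleFactor (l : ℕ → ℝ) (u : ℕ) : ℝ :=
  if scaledRow N D A l u < lo then 1 + τ else if hi < scaledRow N D A l u then 1 - τ else 1

/-- One update, of the scaling factor of `u`. -/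
noncomputable def scaleStep (l : ℕ → ℝ) (u : ℕ) : ℕ → ℝ :=
  Function.update l u (l u * scaleFactor N D A lo hi τ l u)

/-- The scaling factors after the updates of `0, …, j - 1`. -/
noncomputable def scaleSweep (l : ℕ → ℝ) : ℕ → ℕ → ℝ
  | 0 => l
  | j + 1 => scaleStep N D A lo hi τ (scaleSweep l j) j

/-- The scaling factors after `t` sweeps over all `n` coordinates, starting from `1`. -/
noncomputable def scaleRounds (n : ℕ) : ℕ → ℕ → ℝ
  | 0 => fun _ => 1
  | t + 1 => scaleSweep N D A lo hi τ (scaleRounds n t) n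

/-- The dual objective function of the entropy minimization. -/
noncomputable def dualValue (n : ℕ) (r : ℝ) (l : ℕ → ℝ) : ℝ :=
  ∑ u ∈ range n, Real.log (l u) - r * ∑ a ∈ range N, scaledEntry D A l a

variable {N D A lo hi τ} {n : ℕ}

lemma prod_update_mul (l : ℕ → ℝ) (u : ℕ) (f : ℝ) (B : Finset ℕ) :
    ∏ v ∈ B, Function.update l u (l u * f) v = (∏ v ∈ B, l v) * if u ∈ B then f else 1 := by
  by_cases h : u ∈ B
  · rw [prod_update_of_mem h, if_pos h, ← mul_prod_erase B l h, sdiff_singleton_eq_erase]; ring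
  · rw [prod_update_of_notMem h, if_neg h, mul_one]

lemma scaledEntry_update (l : ℕ → ℝ) (u : ℕ) (f : ℝ) (a : ℕ) :
    scaledEntry D A (Function.update l u (l u * f)) a =
      if u ∈ D a then scaledEntry D A l a * f else scaledEntry D A l a := by
  rw [scaledEntry, prod_update_mul, scaledEntry]
  split_ifs <;> ring

lemma scaleFactor_mem (l : ℕ → ℝ) (u : ℕ) :
    scaleFactor N D A lo hi τ l u = 1 + τ ∨ scaleFactor N D A lo hi τ l u = 1 - τ ∨
      scaleFactor N D A lo hi τ l u = 1 := by
  unfold scaleFactor; split_ifs <;> simp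

lemma scaleFactor_pos (h0 : 0 < τ) (h1 : τ < 1) (l : ℕ → ℝ) (u : ℕ) :
    0 < scaleFactor N D A lo hi τ l u := by
  rcases scaleFactor_mem (N := N) (D := D) (A := A) (lo := lo) (hi := hi) (τ := τ) l u with
    h | h | h <;> rw [h] <;> linarith

lemma scaleStep_pos (h0 : 0 < τ) (h1 : τ < 1) {l : ℕ → ℝ} (hl : ∀ v, 0 < l v) (u v : ℕ) :
    0 < scaleStep N D A lo hi τ l u v := by
  rw [scaleStep, Function.update_apply]
  split_ifs
  · exact mul_pos (hl u) (scaleFactor_pos h0 h1 l u)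
  · exact hl v

lemma scaleSweep_pos (h0 : 0 < τ) (h1 : τ < 1) {l : ℕ → ℝ} (hl : ∀ v, 0 < l v) (j v : ℕ) :
    0 < scaleSweep N D A lo hi τ l j v := by
  induction j generalizing v with
  | zero => exact hl v
  | succ j ih => exact scaleStep_pos h0 h1 ih j v

lemma scaleRounds_pos (h0 : 0 < τ) (h1 : τ < 1) (t v : ℕ) :
    0 < scaleRounds N D A lo hi τ n t v := by
  induction t generalizing v with
  | zero => exact one_pos
  | succ t ih => exact scaleSweep_pos h0 h1 ih n v

lemma dualValue_update {l : ℕ → ℝ} (hl : ∀ v, 0 < l v) {u : ℕ} (hu : u < n) {f : ℝ} (hf : 0 < f)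
    (r : ℝ) :
    dualValue N D A n r (Function.update l u (l u * f)) =
      dualValue N D A n r l + (Real.log f - (f - 1) * (r * scaledRow N D A l u)) := by
  have h1 : ∑ v ∈ range n, Real.log (Function.update l u (l u * f) v) =
      ∑ v ∈ range n, Real.log (l v) + Real.log f := by
    rw [← add_sum_erase _ _ (mem_range.2 hu), ← add_sum_erase (range n) _ (mem_range.2 hu)]
    rw [sum_congr rfl (g := fun v => Real.log (l v)) fun v hv => by
      rw [Function.update_of_ne (ne_of_mem_erase hv)]]
    rw [Function.update_self, Real.log_mul (hl u).ne' hf.ne']; ring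
  have h2 : ∑ a ∈ range N, scaledEntry D A (Function.update l u (l u * f)) a =
      ∑ a ∈ range N, scaledEntry D A l a + (f - 1) * scaledRow N D A l u := by
    rw [scaledRow, sum_filter, mul_sum, ← sum_add_distrib]
    refine sum_congr rfl fun a _ => ?_
    rw [scaledEntry_update]
    split_ifs <;> ring
  rw [dualValue, dualValue, h1, h2]; ring

/-- An update of a scaling factor raises the dual objective function. -/
lemma dualValue_scaleStep {δ r : ℝ} (hδ : 0 < δ) (hδ2 : δ ≤ 1 / 2) (hr : 0 < r)
    (hlo : lo = (1 - δ) / r) (hhi : hi = (1 + δ) / r) (hτ : τ = δ / 2) {l : ℕ → ℝ}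
    (hl : ∀ v, 0 < l v) {u : ℕ} (hu : u < n) :
    (scaleStep N D A lo hi τ l u = l ∧ scaleFactor N D A lo hi τ l u = 1) ∨
      dualValue N D A n r l + δ ^ 2 / 8 ≤
        dualValue N D A n r (scaleStep N D A lo hi τ l u) := by
  have hf := scaleFactor_pos (N := N) (D := D) (A := A) (lo := lo) (hi := hi)
    (by linarith : 0 < τ) (by linarith) l u
  have hstep := dualValue_update (N := N) (D := D) (A := A) hl hu hf r
  by_cases h1 : scaledRow N D A l u < lo
  · right
    have hF : scaleFactor N D A lo hi τ l u = 1 + τ := if_pos h1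
    rw [scaleStep, hstep, hF]
    rw [hlo, lt_div_iff₀ hr] at h1
    have h2 := Real.one_sub_inv_le_log_of_pos (by linarith : 0 < 1 + τ)
    have h3 : τ - τ ^ 2 ≤ 1 - (1 + τ)⁻¹ := by
      have h4 : 1 - (1 + τ)⁻¹ = τ / (1 + τ) := by
        have : 1 + τ ≠ 0 := by linarith
        field_simp; ring
      rw [h4, le_div_iff₀ (by linarith)]
      have : 0 ≤ τ ^ 3 := by rw [hτ]; positivity
      nlinarith
    have h5 : (1 + τ - 1) * (r * scaledRow N D A l u) ≤ τ * (1 - δ) := by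
      rw [add_sub_cancel_left]
      exact mul_le_mul_of_nonneg_left (by linarith) (by linarith)
    subst hτ
    nlinarith
  · by_cases h2 : hi < scaledRow N D A l u
    · right
      have hF : scaleFactor N D A lo hi τ l u = 1 - τ := by
        rw [scaleFactor, if_neg h1, if_pos h2]
      rw [scaleStep, hstep, hF]
      rw [hhi, div_lt_iff₀ hr] at h2
      have h3 := Real.one_sub_inv_le_log_of_pos (by linarith : 0 < 1 - τ)
      have h4 : -τ - 3 / 2 * τ ^ 2 ≤ 1 - (1 - τ)⁻¹ := by
        have h4 : 1 - (1 - τ)⁻¹ = -τ / (1 - τ) := by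
          have : 1 - τ ≠ 0 := by linarith
          field_simp; ring
        rw [h4, le_div_iff₀ (by linarith)]
        have : 0 ≤ τ ^ 2 * (1 - 3 * τ) := mul_nonneg (sq_nonneg _) (by linarith)
        nlinarith
      have h5 : τ * (1 + δ) ≤ -((1 - τ - 1) * (r * scaledRow N D A l u)) := by
        have h6 : -((1 - τ - 1) * (r * scaledRow N D A l u)) =
          τ * (r * scaledRow N D A l u) := by ring
        rw [h6]
        exact mul_le_mul_of_nonneg_left (by linarith) (by linarith)
      subst hτ
      nlinarith
    · left
      have hF : scaleFactor N D A lo hi τ l u = 1 := by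
        rw [scaleFactor, if_neg h1, if_neg h2]
      exact ⟨by rw [scaleStep, hF, mul_one, Function.update_eq_self], hF⟩

/-- A sweep changes nothing or raises the dual objective function by a fixed amount. -/
lemma dualValue_scaleSweep {δ r : ℝ} (hδ : 0 < δ) (hδ2 : δ ≤ 1 / 2) (hr : 0 < r)
    (hlo : lo = (1 - δ) / r) (hhi : hi = (1 + δ) / r) (hτ : τ = δ / 2) {l : ℕ → ℝ}
    (hl : ∀ v, 0 < l v) {j : ℕ} (hj : j ≤ n) :
    (scaleSweep N D A lo hi τ l j = l ∧ ∀ u < j, scaleFactor N D A lo hi τ l u = 1) ∨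
      dualValue N D A n r l + δ ^ 2 / 8 ≤
        dualValue N D A n r (scaleSweep N D A lo hi τ l j) := by
  induction j with
  | zero => left; exact ⟨rfl, by simp⟩
  | succ j ih =>
    have h1 := dualValue_scaleStep (N := N) (D := D) (A := A) (n := n) hδ hδ2 hr hlo hhi hτ
      (scaleSweep_pos (N := N) (D := D) (A := A) (lo := lo) (hi := hi)
        (by linarith : 0 < τ) (by linarith) hl j) (u := j) (by lia)
    rw [scaleSweep]
    have hpos : 0 < δ ^ 2 / 8 := by positivity
    rcases ih (by lia) with ⟨h2, h3⟩ | h2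
    · rw [h2] at h1 ⊢
      rcases h1 with ⟨h4, h5⟩ | h4
      · left
        refine ⟨h4, fun u hu => ?_⟩
        rcases Nat.lt_succ_iff_lt_or_eq.1 hu with hu | rfl
        · exact h3 u hu
        · exact h5
      · right; exact h4
    · right
      rcases h1 with ⟨h4, -⟩ | h4
      · rw [h4]; exact h2
      · linarith

/-- If the dual objective function is bounded above, then, after sufficiently many rounds, all rows
are nearly balanced. -/
lemma scaledRow_scaleRounds {δ r g : ℝ} (hδ : 0 < δ) (hδ2 : δ ≤ 1 / 2) (hr : 0 < r)
    (hlo : lo = (1 - δ) / r) (hhi : hi = (1 + δ) / r) (hτ : τ = δ / 2)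
    (hg : ∀ l : ℕ → ℝ, (∀ v, 0 < l v) →
      dualValue N D A n r l ≤ dualValue N D A n r (fun _ => 1) + g)
    {T : ℕ} (hT : g < T * (δ ^ 2 / 8)) {u : ℕ} (hu : u < n) :
    |r * scaledRow N D A (scaleRounds N D A lo hi τ n T) u - 1| ≤ δ := by
  have hτ0 : 0 < τ := by linarith
  have hτ1 : τ < 1 := by linarith
  -- Either some sweep has changed nothing, or every sweep has raised the dual objective function.
  have h1 : ∀ t : ℕ, (∀ u < n,
      scaleFactor N D A lo hi τ (scaleRounds N D A lo hi τ n t) u = 1) ∨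
      dualValue N D A n r (fun _ => 1) + t * (δ ^ 2 / 8) ≤
        dualValue N D A n r (scaleRounds N D A lo hi τ n t) := by
    intro t
    induction t with
    | zero => right; simp [scaleRounds]
    | succ t ih =>
      have h2 := dualValue_scaleSweep (N := N) (D := D) (A := A) (n := n) hδ hδ2 hr hlo hhi hτ
        (scaleRounds_pos (N := N) (D := D) (A := A) (lo := lo) (hi := hi) (n := n) hτ0 hτ1 t)
        le_rfl
      rw [scaleRounds]
      rcases h2 with ⟨h3, h4⟩ | h3
      · left; rw [h3]; exact h4
      · rcases ih with h4 | h4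
        · left
          have h5 : ∀ j ≤ n, scaleSweep N D A lo hi τ (scaleRounds N D A lo hi τ n t) j =
              scaleRounds N D A lo hi τ n t := by
            intro j
            induction j with
            | zero => intro _; rfl
            | succ j ihj =>
              intro hj
              rw [scaleSweep, ihj (by lia), scaleStep, h4 j (by lia), mul_one,
                Function.update_eq_self]
          rw [h5 n le_rfl]; exact h4
        · right; push_cast; linarith
  rcases h1 T with h2 | h2
  · have h3 := h2 u hu
    unfold scaleFactor at h3
    split_ifs at h3 with h4 h5
    · linarith
    · linarith
    · generalize scaledRow N D A (scaleRounds N D A lo hi τ n T) u = R at h4 h5 ⊢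
      rw [hlo, not_lt, div_le_iff₀ hr] at h4
      rw [hhi, not_lt, le_div_iff₀ hr] at h5
      rw [abs_le]; constructor <;> linarith
  · have h3 := hg _ (scaleRounds_pos (N := N) (D := D) (A := A) (lo := lo) (hi := hi) (n := n)
      hτ0 hτ1 T)
    linarith

end Ascent

/-! ### Digits of array addresses -/

section Programs
open Program

/-- The digits of `a` in base `n`, as a set, for numbers with `k` digits. -/
def digitSet (k n a : ℕ) : Finset ℕ := (range k).image fun i => a / n ^ i % n

/-- The two memories have the same counters, except possibly for those in the list. -/
def Memory.Agree (l : List ℕ) (s s' : Memory) : Prop := ∀ i, i ∉ l → s'.counter i = s.counter i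

lemma Memory.Agree.trans {l : List ℕ} {s₁ s₂ s₃ : Memory} (h : s₁.Agree l s₂)
    (h' : s₂.Agree l s₃) : s₁.Agree l s₃ := fun i hi => (h' i hi).trans (h i hi)

lemma Memory.Agree.mono {l l' : List ℕ} {s s' : Memory} (h : s.Agree l s') (hl : l ⊆ l') :
    s.Agree l' s' := fun i hi => h i fun h' => hi (hl h')

lemma Memory.Agree.refl (l : List ℕ) (s : Memory) : s.Agree l s := fun _ _ => rfl

namespace Program

/-- `c_d := c_a * c_b`, with the help of counter `12`. -/
def mulCounter (d a b : ℕ) : Program :=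
  seq (block [setCounter d 0, setCounter 12 0])
    (whileCounterLt 12 b (block [addCounter d d a, addCounter 12 12 1]))

lemma within_mulCounter {S : ℝ → Prop} {d a b : ℕ} (hd1 : d ≠ 1) (hd12 : d ≠ 12) (hda : d ≠ a)
    (hdb : d ≠ b) (ha : a ≠ 12) (hb : b ≠ 12) {s : Memory} (h1 : s.counter 1 = 1) :
    (mulCounter d a b).Within S (6 * s.counter b + 7) s fun s' =>
      s'.cell = s.cell ∧ s'.counter d = s.counter a * s.counter b ∧ s.Agree [d, 12] s' := by
  refine Within.mono (Within.seq (t₁ := 5) (t₂ := s.counter b * (5 + 1) + 1)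
    (within_block ?_ ?_)) (by lia) fun _ h => h
  · simp [BlockAdmissible, Admissible]
  refine (within_while (fun j s' => s'.cell = s.cell ∧ s'.counter d = s.counter a * j ∧
    s'.counter 12 = j ∧ s.Agree [d, 12] s') ?_ ?_ ?_).mono le_rfl fun s' h => ⟨h.1, h.2.1, h.2.2.2⟩
  · refine ⟨rfl, ?_, ?_, fun i hi => ?_⟩
    · simp [blockEffect, effect, hd12]
    · simp [blockEffect, effect]
    · simp only [List.mem_cons, List.not_mem_nil, or_false, not_or] at hi
      simp [blockEffect, effect, hi.1, hi.2]
  · rintro j hj s' ⟨hc, hd, h12, hag⟩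
    have e1 : s'.counter 1 = 1 := (hag 1 (by simp [hd1.symm])).trans h1
    have ea : s'.counter a = s.counter a := hag a (by simp [hda.symm, ha])
    have eb : s'.counter b = s.counter b := hag b (by simp [hdb.symm, hb])
    refine ⟨by rw [h12, eb]; exact hj, within_block (by simp [BlockAdmissible, Admissible]) ?_⟩
    refine ⟨hc, ?_, ?_, fun i hi => ?_⟩
    · simp [blockEffect, effect, hd12, hd, ea, Nat.mul_succ]
    · simp [blockEffect, effect, hd12.symm, hd1.symm, h12, e1]
    · have := hag i hi
      simp only [List.mem_cons, List.not_mem_nil, or_false, not_or] at hi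
      simp [blockEffect, effect, hi.1, hi.2, this]
  · rintro s' ⟨hc, hd, h12, hag⟩
    rw [h12, hag b (by simp [hdb.symm, hb])]; exact lt_irrefl _

/-- Splits off the last digit of counter `8` and compares it with counter `5`. -/
def digitStep : Program :=
  seq (block [setCounter 9 0])
    (seq (whileCounterLt 14 8 (block [subCounter 8 8 2, addCounter 9 9 1]))
      (seq (ifCounterLt 8 5 skip (ifCounterLt 5 8 skip (setCounter 10 1)))
        (block [addCounter 8 9 11])))

/-- The counters that the digit loops use are set up. -/
structure DigitReady (n : ℕ) (s : Memory) : Prop where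
  pos : 0 < n
  c1 : s.counter 1 = 1
  c2 : s.counter 2 = n
  c11 : s.counter 11 = 0
  c14 : s.counter 14 = n - 1

lemma DigitReady.agree {n : ℕ} {s s' : Memory} (h : DigitReady n s) {l : List ℕ}
    (hs : s.Agree l s') (h1 : 1 ∉ l) (h2 : 2 ∉ l) (h11 : 11 ∉ l) (h14 : 14 ∉ l) :
    DigitReady n s' :=
  ⟨h.pos, (hs 1 h1).trans h.c1, (hs 2 h2).trans h.c2, (hs 11 h11).trans h.c11,
    (hs 14 h14).trans h.c14⟩

lemma within_digitStep {S : ℝ → Prop} {n : ℕ} {s : Memory} (h : DigitReady n s) :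
    digitStep.Within S (6 * s.counter 8 + 13) s fun s' =>
      s'.cell = s.cell ∧ s'.counter 8 = s.counter 8 / n ∧
      s'.counter 10 = (if s.counter 8 % n = s.counter 5 then 1 else s.counter 10) ∧
      s.Agree [8, 9, 10] s' := by
  set y := s.counter 8 with hy
  have hyn : y / n ≤ y := Nat.div_le_self _ _
  have hn := h.pos
  refine Within.mono (Within.seq (t₁ := 3) (t₂ := (y / n * (5 + 1) + 1) + (3 + 3 + 1) + 1)
    (within_block ?_ (Within.seq ?_))) (by lia) fun _ h => h
  · simp [BlockAdmissible, Admissible]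
  refine (within_while (t := 5) (n := y / n) (fun j s' => s'.cell = s.cell ∧
    s'.counter 8 = y - j * n ∧
    s'.counter 9 = j ∧ s.Agree [8, 9] s') ?_ ?_ ?_).mono le_rfl ?_
  · refine ⟨rfl, ?_, ?_, fun i hi => ?_⟩
    · simp [blockEffect, effect, hy]
    · simp [blockEffect, effect]
    · simp only [List.mem_cons, List.not_mem_nil, or_false, not_or] at hi
      simp [blockEffect, effect, hi.2]
  · rintro j hj s' ⟨hc, h8, h9, hag⟩
    have h' := h.agree hag (by simp) (by simp) (by simp) (by simp)
    have hjn : (j + 1) * n ≤ y := (Nat.le_div_iff_mul_le hn).1 hj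
    have e : (j + 1) * n = j * n + n := by ring
    refine ⟨by rw [h'.c14, h8]; lia, within_block (by simp [BlockAdmissible, Admissible]) ?_⟩
    refine ⟨hc, ?_, ?_, fun i hi => ?_⟩
    · simp [blockEffect, effect, h8, h'.c2]; lia
    · simp [blockEffect, effect, h9, h'.c1]
    · have := hag i hi
      simp only [List.mem_cons, List.not_mem_nil, or_false, not_or] at hi
      simp [blockEffect, effect, hi.1, hi.2, this]
  · rintro s' ⟨hc, h8, h9, hag⟩
    have h' := h.agree hag (by simp) (by simp) (by simp) (by simp)
    have := Nat.mod_lt y hn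
    have e := Nat.div_add_mod' y n
    rw [h'.c14, h8]; lia
  · rintro s' ⟨hc, h8, h9, hag⟩
    have h' := h.agree hag (by simp) (by simp) (by simp) (by simp)
    have e := Nat.div_add_mod' y n
    have h8' : s'.counter 8 = y % n := by lia
    have h5 := hag 5 (by simp)
    have h10 := hag 10 (by simp)
    refine Within.seq (t₁ := 3) (t₂ := 3) ?_
    have hfin : ∀ s'' : Memory, s''.cell = s'.cell →
        s''.counter 10 = (if y % n = s.counter 5 then 1 else s.counter 10) →
        s'.Agree [10] s'' → (block [addCounter 8 9 11]).Within S 3 s'' fun s' =>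
          s'.cell = s.cell ∧ s'.counter 8 = y / n ∧
          s'.counter 10 = (if y % n = s.counter 5 then 1 else s.counter 10) ∧
          s.Agree [8, 9, 10] s' := by
      intro s'' hc'' h10'' hag''
      refine within_block (by simp [BlockAdmissible, Admissible]) ⟨hc''.trans hc, ?_, ?_, ?_⟩
      · simp [blockEffect, effect, hag'' 9 (by simp), hag'' 11 (by simp), h9, h'.c11]
      · simpa [blockEffect, effect] using h10''
      · intro i hi
        simp only [List.mem_cons, List.not_mem_nil, or_false, not_or] at hi
        simp [blockEffect, effect, hi.1, hag'' i (by simp [hi.2.2]),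
          hag i (by simp [hi.1, hi.2.1])]
    refine within_ifCounterLt (t := 2) (fun hlt => ?_) fun hnlt => within_ifCounterLt (t := 1)
      (fun hlt => ?_) fun hnlt' => ?_
    · rw [h8', h5] at hlt
      refine (within_skip (hfin s' rfl ?_ (Memory.Agree.refl _ _))).mono (by lia) fun _ h => h
      rw [if_neg (by lia), h10]
    · rw [h8', h5] at hlt
      refine within_skip (hfin s' rfl ?_ (Memory.Agree.refl _ _))
      rw [if_neg (by lia), h10]
    · rw [h8', h5] at hnlt hnlt'
      refine within_of_admissible trivial (hfin _ rfl ?_ fun i hi => ?_)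
      · rw [if_pos (by lia)]; simp [effect]
      · simp only [List.mem_cons, List.not_mem_nil, or_false] at hi
        simp [effect, hi]

/-- Splits off the last `k` digits of counter `8` and records in counter `10` whether counter `5` is
among them. -/
def digits : ℕ → Program
  | 0 => skip
  | k + 1 => seq (digits k) digitStep

lemma digitSet_succ (k n a : ℕ) : digitSet (k + 1) n a = insert (a / n ^ k % n) (digitSet k n a) := by
  rw [digitSet, range_add_one, image_insert, digitSet]

lemma within_digits {S : ℝ → Prop} {n : ℕ} {s : Memory} (h : DigitReady n s)
    (h10 : s.counter 10 = 0) (k : ℕ) :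
    (digits k).Within S (k * (6 * s.counter 8 + 14) + 1) s fun s' =>
      s'.cell = s.cell ∧ s'.counter 8 = s.counter 8 / n ^ k ∧
      s'.counter 10 = (if s.counter 5 ∈ digitSet k n (s.counter 8) then 1 else 0) ∧
      s.Agree [8, 9, 10] s' := by
  induction k with
  | zero =>
    exact (within_skip ⟨rfl, by simp, by simp [digitSet, h10], Memory.Agree.refl _ _⟩).mono
      (by lia) fun _ h => h
  | succ k ih =>
    refine (Within.seq (t₂ := 6 * s.counter 8 + 13)
      (ih.mono le_rfl ?_)).mono (by rw [Nat.succ_mul]; lia) fun _ h => h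
    rintro s' ⟨hc, h8, h10', hag⟩
    have h' := h.agree hag (by simp) (by simp) (by simp) (by simp)
    have hle : s'.counter 8 ≤ s.counter 8 := by rw [h8]; exact Nat.div_le_self _ _
    refine (within_digitStep h').mono (by lia) ?_
    rintro s'' ⟨hc', h8', h10'', hag'⟩
    refine ⟨hc'.trans hc, ?_, ?_, hag.trans hag'⟩
    · rw [h8', h8, Nat.div_div_eq_div_mul, pow_succ]
    · rw [h10'', h8, h10', hag 5 (by simp), digitSet_succ]
      by_cases e : s.counter 8 / n ^ k % n = s.counter 5
      · simp [e]
      · simp [e, Ne.symm e]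

/-- Sets counter `10` to `1` if counter `5` is one of the `k` digits of counter `4`, and to `0`
otherwise. -/
def testDigit (k : ℕ) : Program :=
  seq (block [addCounter 8 4 11, setCounter 10 0]) (digits k)

lemma within_testDigit {S : ℝ → Prop} {n : ℕ} {s : Memory} (h : DigitReady n s) (k : ℕ) :
    (testDigit k).Within S (k * (6 * s.counter 4 + 14) + 7) s fun s' =>
      s'.cell = s.cell ∧
      s'.counter 10 = (if s.counter 5 ∈ digitSet k n (s.counter 4) then 1 else 0) ∧
      s.Agree [8, 9, 10] s' := by
  refine Within.mono (Within.seq (t₁ := 5) (t₂ := k * (6 * s.counter 4 + 14) + 1)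
    (within_block ?_ ?_)) (by lia) fun _ h => h
  · simp [BlockAdmissible, Admissible]
  set s₁ := blockEffect [addCounter 8 4 11, setCounter 10 0] s with hs₁
  have hag : s.Agree [8, 9, 10] s₁ := by
    intro i hi
    simp only [List.mem_cons, List.not_mem_nil, or_false, not_or] at hi
    simp [hs₁, blockEffect, effect, hi.1, hi.2.2]
  have h8 : s₁.counter 8 = s.counter 4 := by simp [hs₁, blockEffect, effect, h.c11]
  have hc : s₁.cell = s.cell := rfl
  have h5 := hag 5 (by simp)
  refine (within_digits (h.agree hag (by simp) (by simp) (by simp) (by simp))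
    (by simp [hs₁, blockEffect, effect]) k).mono (by rw [h8]) ?_
  rintro s' ⟨hc', -, h10, hag'⟩
  exact ⟨hc'.trans hc, by rw [h10, h8, h5], hag.trans hag'⟩

end Program
end Programs

/-! ### Row sums and scaling on the machine -/

section Rounds
open Program

/-- The memory layout of the program: the array of the weights occupies the cells below `N`, and
counter `20 + j` holds the address `N + j` of the `j`-th scratch cell. Counters `0`, `1`, `2`, `3`,
`7`, `11`, `14`, `18` hold `m`, `1`, `n = k m`, `N = n ^ k`, the number `T` of rounds, `0`, `n - 1` and
`n - m`; counters `4`, `5`, `6` are loop variables for addresses, vertices and rounds.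

The scratch cells hold: `0` the sum of the array, `1` the product of the scaling factors, `2` a row
sum, `3` the factor of an update, `4` and `5` the bounds for the row sums, `6` and `7` the factors
`1 ± τ`, `8` the number `1`, `9` the step size `τ`, `10` the tolerance `2 τ`, `11` the number `m`,
and from `12` on the quantities that enter the output. -/
structure Layout (m n N T : ℕ) (s : Memory) : Prop where
  digit : DigitReady n s
  c0 : s.counter 0 = m
  c3 : s.counter 3 = N
  c7 : s.counter 7 = T
  c18 : s.counter 18 = n - m
  scratch : ∀ j < 17, s.counter (20 + j) = N + j

/-- The counters that the loops use. -/
def loopCounters : List ℕ := [4, 5, 6, 8, 9, 10, 12]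

lemma Layout.agree {m n N T : ℕ} {s s' : Memory} (h : Layout m n N T s)
    (hs : s.Agree loopCounters s') : Layout m n N T s' where
  digit := h.digit.agree hs (by simp [loopCounters]) (by simp [loopCounters])
    (by simp [loopCounters]) (by simp [loopCounters])
  c0 := (hs 0 (by simp [loopCounters])).trans h.c0
  c3 := (hs 3 (by simp [loopCounters])).trans h.c3
  c7 := (hs 7 (by simp [loopCounters])).trans h.c7
  c18 := (hs 18 (by simp [loopCounters])).trans h.c18
  scratch := fun j hj => (hs (20 + j) (by simp [loopCounters]; lia)).trans (h.scratch j hj)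

lemma agree_loop_of_agree {s s' : Memory} (h : s.Agree [4, 8, 9, 10] s') :
    s.Agree loopCounters s' := h.mono (by simp [loopCounters])

namespace Program

/-- Adds up the entries of the array whose tuples contain counter `5`. -/
def rowProgram (k : ℕ) : Program :=
  seq (block [setCounter 4 0, fromCounter 22 11])
    (whileCounterLt 4 3 (seq (testDigit k)
      (seq (ifCounterLt 11 10 (arith .add 22 22 4) skip) (block [addCounter 4 4 1]))))

variable {S : ℝ → Prop} {k m n N T : ℕ} {s : Memory}

lemma within_rowProgram (h : Layout m n N T s)
    (hS : ∀ j ≤ N, S (∑ a ∈ range j with s.counter 5 ∈ digitSet k n a, s.cell a)) :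
    (rowProgram k).Within S (N * (k * (6 * N + 14) + 15) + 7) s fun s' =>
      s'.cell = Function.update s.cell (N + 2)
        (∑ a ∈ range N with s.counter 5 ∈ digitSet k n a, s.cell a) ∧
      s.Agree [4, 8, 9, 10] s' := by
  have hL : ∀ s', s.Agree [4, 8, 9, 10] s' → Layout m n N T s' :=
    fun s' hs' => h.agree (agree_loop_of_agree hs')
  have h22 : s.counter 22 = N + 2 := h.scratch 2 (by lia)
  refine Within.mono (Within.seq (t₁ := 5)
    (t₂ := N * ((k * (6 * N + 14) + 7) + (2 + 3 + 1) + 1 + 1) + 1) (within_block ?_ ?_))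
    (by lia) fun _ h => h
  · have := hS 0 (by lia)
    simpa [BlockAdmissible, Admissible, effect, h.digit.c11] using this
  refine (within_while (n := N) (fun j s' => s'.counter 4 = j ∧ s'.cell = Function.update s.cell
    (N + 2) (∑ a ∈ range j with s.counter 5 ∈ digitSet k n a, s.cell a) ∧
    s.Agree [4, 8, 9, 10] s') ?_ ?_ ?_).mono le_rfl fun s' h => h.2
  · refine ⟨?_, ?_, fun i hi => ?_⟩
    · simp [blockEffect, effect]
    · simp [blockEffect, effect, h.digit.c11, h22]
    · simp only [List.mem_cons, List.not_mem_nil, or_false, not_or] at hi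
      simp [blockEffect, effect, hi.1]
  · rintro j hj s' ⟨h4, hc, hag⟩
    have h' := hL s' hag
    refine ⟨by rw [h4, h'.c3]; exact hj, ?_⟩
    refine Within.seq (t₁ := k * (6 * N + 14) + 7) (t₂ := 2 + 3 + 1)
      ((within_testDigit h'.digit k).mono (by rw [h4]; gcongr) ?_)
    rintro s₁ ⟨hc₁, h10, hag₁⟩
    have hag₁' : s.Agree [4, 8, 9, 10] s₁ := hag.trans (hag₁.mono (by simp))
    have h₁ := hL s₁ hag₁'
    have h4₁ : s₁.counter 4 = j := (hag₁ 4 (by simp)).trans h4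
    have h5 : s'.counter 5 = s.counter 5 := hag 5 (by simp)
    have h22₁ : s₁.counter 22 = N + 2 := h₁.scratch 2 (by lia)
    rw [h4, h5] at h10
    have hfin : ∀ s₂ : Memory, s₁.Agree [] s₂ → s₂.cell = Function.update s.cell (N + 2)
          (∑ a ∈ range (j + 1) with s.counter 5 ∈ digitSet k n a, s.cell a) →
        (block [addCounter 4 4 1]).Within S 3 s₂ fun s' => s'.counter 4 = j + 1 ∧
          s'.cell = Function.update s.cell (N + 2)
            (∑ a ∈ range (j + 1) with s.counter 5 ∈ digitSet k n a, s.cell a) ∧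
          s.Agree [4, 8, 9, 10] s' := by
      intro s₂ hag₂ hc₂
      refine within_block (by simp [BlockAdmissible, Admissible]) ⟨?_, hc₂, fun i hi => ?_⟩
      · simp [blockEffect, effect, hag₂ 4 (by simp), hag₂ 1 (by simp), h4₁, h₁.digit.c1]
      · have := (hag₁'.trans (hag₂.mono (by simp))) i hi
        simp only [List.mem_cons, List.not_mem_nil, or_false, not_or] at hi
        simp [blockEffect, effect, hi.1, this]
    refine Within.seq (t₁ := 2) (t₂ := 3) (within_ifCounterLt (t := 1) (fun hlt => ?_) fun hlt => ?_)
    · have hmem : s.counter 5 ∈ digitSet k n j := by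
        by_contra hmem
        rw [h10, if_neg hmem] at hlt
        exact absurd hlt (by lia)
      have hsum : ∑ a ∈ range (j + 1) with s.counter 5 ∈ digitSet k n a, s.cell a =
          (∑ a ∈ range j with s.counter 5 ∈ digitSet k n a, s.cell a) + s.cell j := by
        rw [sum_filter, sum_filter, sum_range_succ, if_pos hmem]
      have hval : s₁.cell (s₁.counter 22) + s₁.cell (s₁.counter 4) =
          ∑ a ∈ range (j + 1) with s.counter 5 ∈ digitSet k n a, s.cell a := by
        rw [hsum, h22₁, h4₁, hc₁, hc, Function.update_self, Function.update_of_ne (by lia)]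
      refine within_of_admissible ⟨by simp, ?_⟩ (hfin _ (fun i _ => rfl) ?_)
      · rw [ArithOp.eval, hval]; exact hS (j + 1) (by lia)
      · simp only [effect, ArithOp.eval]
        rw [hval, h22₁, hc₁, hc, Function.update_idem]
    · have hmem : s.counter 5 ∉ digitSet k n j := by
        intro hmem
        rw [h10, if_pos hmem, h₁.digit.c11] at hlt
        exact hlt (by lia)
      refine within_skip (hfin _ (fun i _ => rfl) ?_)
      rw [hc₁, hc, sum_filter, sum_filter, sum_range_succ, if_neg hmem, add_zero]
  · rintro s' ⟨h4, hc, hag⟩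
    rw [h4, (hL s' hag).c3]; exact lt_irrefl _

/-- Multiplies the entries of the array whose tuples contain counter `5`, and the product of all
scaling factors, by the number in scratch cell `3`. -/
def scaleProgram (k : ℕ) : Program :=
  seq (block [setCounter 4 0])
    (seq (whileCounterLt 4 3 (seq (testDigit k)
      (seq (ifCounterLt 11 10 (arith .mul 4 4 23) skip) (block [addCounter 4 4 1]))))
      (block [arith .mul 21 21 23]))

lemma within_scaleProgram (h : Layout m n N T s)
    (hS : ∀ a < N, s.counter 5 ∈ digitSet k n a → S (s.cell a * s.cell (N + 3)))
    (hS' : S (s.cell (N + 1) * s.cell (N + 3))) :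
    (scaleProgram k).Within S (N * (k * (6 * N + 14) + 15) + 9) s fun s' =>
      (∀ a, s'.cell a = if (a < N ∧ s.counter 5 ∈ digitSet k n a) ∨ a = N + 1 then
        s.cell a * s.cell (N + 3) else s.cell a) ∧
      s.Agree [4, 8, 9, 10] s' := by
  have hL : ∀ s', s.Agree [4, 8, 9, 10] s' → Layout m n N T s' :=
    fun s' hs' => h.agree (agree_loop_of_agree hs')
  refine Within.mono (Within.seq (t₁ := 3)
    (t₂ := (N * ((k * (6 * N + 14) + 7) + (2 + 3 + 1) + 1 + 1) + 1) + 3 + 1) (within_block ?_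
      (Within.seq ?_)))
    (by lia) fun _ h => h
  · simp [BlockAdmissible, Admissible]
  refine (within_while (n := N) (fun j s' => s'.counter 4 = j ∧
    (∀ a, s'.cell a = if a < j ∧ s.counter 5 ∈ digitSet k n a then
        s.cell a * s.cell (N + 3) else s.cell a) ∧
    s.Agree [4, 8, 9, 10] s') ?_ ?_ ?_).mono le_rfl ?_
  · refine ⟨?_, ?_, fun i hi => ?_⟩
    · simp [blockEffect, effect]
    · simp [blockEffect, effect]
    · simp only [List.mem_cons, List.not_mem_nil, or_false, not_or] at hi
      simp [blockEffect, effect, hi.1]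
  · rintro j hj s' ⟨h4, hc, hag⟩
    have h' := hL s' hag
    refine ⟨by rw [h4, h'.c3]; exact hj, ?_⟩
    refine Within.seq (t₁ := k * (6 * N + 14) + 7) (t₂ := 2 + 3 + 1)
      ((within_testDigit h'.digit k).mono (by rw [h4]; gcongr) ?_)
    rintro s₁ ⟨hc₁, h10, hag₁⟩
    have hag₁' : s.Agree [4, 8, 9, 10] s₁ := hag.trans (hag₁.mono (by simp))
    have h₁ := hL s₁ hag₁'
    have h4₁ : s₁.counter 4 = j := (hag₁ 4 (by simp)).trans h4
    have h5 : s'.counter 5 = s.counter 5 := hag 5 (by simp)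
    have h23₁ : s₁.counter 23 = N + 3 := h₁.scratch 3 (by lia)
    rw [h4, h5] at h10
    have hfin : ∀ s₂ : Memory, s₁.Agree [] s₂ →
        (∀ a, s₂.cell a = if a < j + 1 ∧ s.counter 5 ∈ digitSet k n a then
          s.cell a * s.cell (N + 3) else s.cell a) →
        (block [addCounter 4 4 1]).Within S 3 s₂ fun s' => s'.counter 4 = j + 1 ∧
          (∀ a, s'.cell a = if a < j + 1 ∧ s.counter 5 ∈ digitSet k n a then
            s.cell a * s.cell (N + 3) else s.cell a) ∧
          s.Agree [4, 8, 9, 10] s' := by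
      intro s₂ hag₂ hc₂
      refine within_block (by simp [BlockAdmissible, Admissible]) ⟨?_, hc₂, fun i hi => ?_⟩
      · simp [blockEffect, effect, hag₂ 4 (by simp), hag₂ 1 (by simp), h4₁, h₁.digit.c1]
      · have := (hag₁'.trans (hag₂.mono (by simp))) i hi
        simp only [List.mem_cons, List.not_mem_nil, or_false, not_or] at hi
        simp [blockEffect, effect, hi.1, this]
    refine Within.seq (t₁ := 2) (t₂ := 3) (within_ifCounterLt (t := 1) (fun hlt => ?_) fun hlt => ?_)
    · have hmem : s.counter 5 ∈ digitSet k n j := by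
        by_contra hmem
        rw [h10, if_neg hmem] at hlt
        exact absurd hlt (by lia)
      have hval : s₁.cell (s₁.counter 4) * s₁.cell (s₁.counter 23) =
          s.cell j * s.cell (N + 3) := by
        rw [h23₁, h4₁, hc₁, hc, hc, if_neg (by lia), if_neg (by lia)]
      refine within_of_admissible ⟨by simp, ?_⟩ (hfin _ (fun i _ => rfl) fun a => ?_)
      · rw [ArithOp.eval, hval]; exact hS j hj hmem
      · simp only [effect, ArithOp.eval]
        rw [hval, h4₁, Function.update_apply, hc₁, hc]
        by_cases ha : a = j
        · rw [if_pos ha, ha, if_pos ⟨by lia, hmem⟩]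
        · have : a < j + 1 ↔ a < j := by lia
          rw [if_neg ha]; simp only [this]
    · have hmem : s.counter 5 ∉ digitSet k n j := by
        intro hmem
        rw [h10, if_pos hmem, h₁.digit.c11] at hlt
        exact hlt (by lia)
      refine within_skip (hfin _ (fun i _ => rfl) fun a => ?_)
      rw [hc₁, hc]
      by_cases ha : a = j
      · rw [ha, if_neg (by tauto), if_neg (by tauto)]
      · have : a < j + 1 ↔ a < j := by lia
        simp only [this]
  · rintro s' ⟨h4, hc, hag⟩
    rw [h4, (hL s' hag).c3]; exact lt_irrefl _
  · rintro s' ⟨h4, hc, hag⟩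
    have h' := hL s' hag
    have h21 : s'.counter 21 = N + 1 := h'.scratch 1 (by lia)
    have h23 : s'.counter 23 = N + 3 := h'.scratch 3 (by lia)
    have hval : s'.cell (s'.counter 21) * s'.cell (s'.counter 23) =
        s.cell (N + 1) * s.cell (N + 3) := by
      rw [h21, h23, hc, hc, if_neg (by lia), if_neg (by lia)]
    refine within_block ⟨⟨by simp, ?_⟩, trivial⟩ ⟨fun a => ?_, fun i hi => ?_⟩
    · rw [ArithOp.eval, hval]; exact hS'
    · simp only [blockEffect, effect, ArithOp.eval]
      rw [hval, h21, Function.update_apply, hc]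
      by_cases ha : a = N + 1
      · rw [if_pos ha, ha, if_pos (Or.inr rfl)]
      · simp [ha]
    · simpa [blockEffect, effect] using hag i hi

/-- Chooses the factor by which a row is scaled. -/
def chooseProgram : Program :=
  ifLt 22 24 (block [arith .mul 23 26 28])
    (ifLt 25 22 (block [arith .mul 23 27 28]) (block [arith .mul 23 28 28]))

open Classical in
lemma within_chooseProgram (h : Layout m n N T s) (h1 : s.cell (N + 8) = 1)
    (hS6 : S (s.cell (N + 6))) (hS7 : S (s.cell (N + 7))) (hS1 : S 1) :
    chooseProgram.Within S 5 s fun s' =>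
      s'.cell = Function.update s.cell (N + 3)
        (if s.cell (N + 2) < s.cell (N + 4) then s.cell (N + 6) else
          if s.cell (N + 5) < s.cell (N + 2) then s.cell (N + 7) else 1) ∧
      s.Agree [] s' := by
  have h22 : s.counter 22 = N + 2 := h.scratch 2 (by lia)
  have h23 : s.counter 23 = N + 3 := h.scratch 3 (by lia)
  have h24 : s.counter 24 = N + 4 := h.scratch 4 (by lia)
  have h25 : s.counter 25 = N + 5 := h.scratch 5 (by lia)
  have h26 : s.counter 26 = N + 6 := h.scratch 6 (by lia)
  have h27 : s.counter 27 = N + 7 := h.scratch 7 (by lia)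
  have h28 : s.counter 28 = N + 8 := h.scratch 8 (by lia)
  refine within_ifLt (t := 4) (fun hlt => ?_) fun hlt =>
    within_ifLt (t := 3) (fun hlt' => ?_) fun hlt' => ?_
  · rw [h22, h24] at hlt
    refine within_block (by simpa [BlockAdmissible, Admissible, h26, h28, h1, ArithOp.eval]) ⟨?_, ?_⟩
    · simp [blockEffect, effect, h23, h26, h28, h1, ArithOp.eval, hlt]
    · intro i _; rfl
  · rw [h22, h24] at hlt
    rw [h22, h25] at hlt'
    refine within_block (by simpa [BlockAdmissible, Admissible, h27, h28, h1, ArithOp.eval]) ⟨?_, ?_⟩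
    · simp only [blockEffect, effect, h23, h27, h28, h1, ArithOp.eval]
      rw [if_neg hlt, if_pos hlt', mul_one]
    · intro i _; rfl
  · rw [h22, h24] at hlt
    rw [h22, h25] at hlt'
    refine within_block (by simpa [BlockAdmissible, Admissible, h28, h1, ArithOp.eval]) ⟨?_, ?_⟩
    · simp only [blockEffect, effect, h23, h28, h1, ArithOp.eval]
      rw [if_neg hlt, if_neg hlt', mul_one]
    · intro i _; rfl

end Program
end Rounds

/-! ### The ascent on the machine -/

section RoundLoop
open Program

/-- The memory during the rounds: the array is scaled by `l`, scratch cell `1` holds the product of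
the scaling factors, and the scratch cells from the fourth on hold the constants `R`. -/
structure RoundState (k m n N T : ℕ) (A R l : ℕ → ℝ) (s : Memory) : Prop where
  layout : Layout m n N T s
  entries : ∀ a < N, s.cell a = scaledEntry (digitSet k n) A l a
  prod : s.cell (N + 1) = ∏ u ∈ range n, l u
  rest : ∀ j, 4 ≤ j → s.cell (N + j) = R j

lemma RoundState.of_agree {k m n N T : ℕ} {A R l : ℕ → ℝ} {s s' : Memory}
    (h : RoundState k m n N T A R l s) (hag : s.Agree loopCounters s') (hc : s'.cell = s.cell) :
    RoundState k m n N T A R l s' :=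
  ⟨h.layout.agree hag, by rw [hc]; exact h.entries, by rw [hc]; exact h.prod,
    by rw [hc]; exact h.rest⟩

namespace Program

/-- One update of the scaling factor of the coordinate in counter `5`. -/
def updateProgram (k : ℕ) : Program :=
  seq (rowProgram k) (seq chooseProgram (seq (scaleProgram k) (block [addCounter 5 5 1])))

/-- A bound for the number of steps of `updateProgram`. -/
def updateTime (k N : ℕ) : ℕ := 2 * (N * (k * (6 * N + 14) + 15)) + 27

variable {S : ℝ → Prop} {k m n N T : ℕ} {A R l : ℕ → ℝ} {τ : ℝ} {s : Memory}

lemma within_updateProgram (h : RoundState k m n N T A R l s) (h6 : R 6 = 1 + τ) (h7 : R 7 = 1 - τ)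
    (h8 : R 8 = 1) {u : ℕ} (h5 : s.counter 5 = u) (hu : u < n)
    (hS6 : S (1 + τ)) (hS7 : S (1 - τ)) (hS1 : S 1)
    (hrow : ∀ j ≤ N, S (∑ a ∈ range j with u ∈ digitSet k n a, scaledEntry (digitSet k n) A l a))
    (hent : ∀ a < N, S (scaledEntry (digitSet k n) A
      (scaleStep N (digitSet k n) A (R 4) (R 5) τ l u) a))
    (hprod : S (∏ v ∈ range n, scaleStep N (digitSet k n) A (R 4) (R 5) τ l u v)) :
    (updateProgram k).Within S (updateTime k N) s fun s' =>
      RoundState k m n N T A R (scaleStep N (digitSet k n) A (R 4) (R 5) τ l u) s' ∧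
      s'.counter 5 = u + 1 ∧ s'.counter 6 = s.counter 6 := by
  set F := scaleFactor N (digitSet k n) A (R 4) (R 5) τ l u with hF
  have hsum : ∀ j ≤ N, ∑ a ∈ range j with u ∈ digitSet k n a, s.cell a =
      ∑ a ∈ range j with u ∈ digitSet k n a, scaledEntry (digitSet k n) A l a := fun j hj =>
    sum_congr rfl fun a ha => h.entries a
      (lt_of_lt_of_le (mem_range.1 (mem_filter.1 ha).1) hj)
  refine Within.mono (Within.seq (t₁ := N * (k * (6 * N + 14) + 15) + 7)
    (t₂ := 5 + ((N * (k * (6 * N + 14) + 15) + 9) + 3 + 1) + 1)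
    ((within_rowProgram (k := k) h.layout fun j hj => by rw [h5, hsum j hj]; exact hrow j hj).mono
      le_rfl ?_)) (by unfold updateTime; lia) fun _ h => h
  rintro s₁ ⟨hc₁, hag₁⟩
  rw [h5, hsum N le_rfl] at hc₁
  have hL₁ := h.layout.agree (agree_loop_of_agree hag₁)
  have hrest₁ : ∀ j, 4 ≤ j → s₁.cell (N + j) = R j := fun j hj => by
    rw [hc₁, Function.update_of_ne (by lia), h.rest j hj]
  refine Within.seq ((within_chooseProgram hL₁ ((hrest₁ 8 (by lia)).trans h8)
    (by rw [hrest₁ 6 (by lia), h6]; exact hS6) (by rw [hrest₁ 7 (by lia), h7]; exact hS7) hS1).mono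
    le_rfl ?_)
  rintro s₂ ⟨hc₂, hag₂⟩
  have hrow₁ : s₁.cell (N + 2) = scaledRow N (digitSet k n) A l u := by
    rw [hc₁, Function.update_self, scaledRow]
  rw [hrest₁ 4 (by lia), hrest₁ 5 (by lia), hrest₁ 6 (by lia), hrest₁ 7 (by lia), h6, h7,
    hrow₁] at hc₂
  have hc₂' : s₂.cell = Function.update s₁.cell (N + 3) F := by
    rw [hc₂, hF, scaleFactor]
  have hag₂' : s.Agree [4, 8, 9, 10] s₂ := hag₁.trans (hag₂.mono (by simp))
  have hL₂ := h.layout.agree (agree_loop_of_agree hag₂')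
  have h5₂ : s₂.counter 5 = u := (hag₂' 5 (by simp)).trans h5
  have hF₂ : s₂.cell (N + 3) = F := by rw [hc₂', Function.update_self]
  have hcell₂ : ∀ a, a ≠ N + 2 → a ≠ N + 3 → s₂.cell a = s.cell a := fun a h2 h3 => by
    rw [hc₂', Function.update_of_ne h3, hc₁, Function.update_of_ne h2]
  have hent' : ∀ a < N, scaledEntry (digitSet k n) A
      (scaleStep N (digitSet k n) A (R 4) (R 5) τ l u) a =
      if u ∈ digitSet k n a then s₂.cell a * F else s₂.cell a := fun a ha => by
    rw [scaleStep, scaledEntry_update, hcell₂ a (by lia) (by lia), h.entries a ha]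
  have hprod' : ∏ v ∈ range n, scaleStep N (digitSet k n) A (R 4) (R 5) τ l u v =
      s₂.cell (N + 1) * F := by
    rw [scaleStep, prod_update_mul, if_pos (mem_range.2 hu), hcell₂ _ (by lia) (by lia), h.prod]
  refine Within.seq (t₁ := N * (k * (6 * N + 14) + 15) + 9) (t₂ := 3)
    ((within_scaleProgram (k := k) hL₂ (fun a ha hmem => ?_) ?_).mono le_rfl ?_)
  · rw [h5₂] at hmem
    have := hent a ha
    rwa [hent' a ha, if_pos hmem, ← hF₂] at this
  · rw [hF₂, ← hprod']; exact hprod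
  · rintro s₃ ⟨hc₃, hag₃⟩
    rw [h5₂, hF₂] at hc₃
    have hag₃' : s.Agree [4, 8, 9, 10] s₃ := hag₂'.trans hag₃
    have hL₃ := h.layout.agree (agree_loop_of_agree hag₃')
    refine within_block (by simp [BlockAdmissible, Admissible]) ⟨⟨?_, ?_, ?_, ?_⟩, ?_, ?_⟩
    · refine h.layout.agree fun i hi => ?_
      have := agree_loop_of_agree hag₃' i hi
      simp only [loopCounters, List.mem_cons, List.not_mem_nil, or_false, not_or] at hi
      simp [blockEffect, effect, hi.2.1, this]
    · intro a ha
      simp only [blockEffect, effect]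
      rw [hc₃, hent' a ha]
      by_cases hmem : u ∈ digitSet k n a
      · rw [if_pos hmem, if_pos (Or.inl ⟨ha, hmem⟩)]
      · rw [if_neg hmem, if_neg (by rintro (h | h); exacts [hmem h.2, by lia])]
    · simp only [blockEffect, effect]
      rw [hc₃, if_pos (Or.inr rfl), hprod']
    · intro j hj
      simp only [blockEffect, effect]
      rw [hc₃, if_neg (by lia), hcell₂ _ (by lia) (by lia), h.rest j hj]
    · simp [blockEffect, effect, hag₃' 5 (by simp), h5, hL₃.digit.c1]
    · simp [blockEffect, effect, hag₃' 6 (by simp)]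

/-- As many sweeps over all coordinates as counter `7` says. -/
def roundsProgram (k : ℕ) : Program :=
  seq (block [setCounter 6 0])
    (whileCounterLt 6 7 (seq (block [setCounter 5 0])
      (seq (whileCounterLt 5 2 (updateProgram k)) (block [addCounter 6 6 1]))))

/-- A bound for the number of steps of `roundsProgram`. -/
def roundsTime (k n N T : ℕ) : ℕ := T * (n * (updateTime k N + 1) + 10) + 5

/-- The program computes the scaling factors `scaleRounds`, provided that the row sums, the entries and
the products of the scaling factors that occur are in `S`. -/
lemma within_roundsProgram (h : RoundState k m n N T A R (fun _ => 1) s) (h6 : R 6 = 1 + τ)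
    (h7 : R 7 = 1 - τ) (h8 : R 8 = 1) (hS6 : S (1 + τ)) (hS7 : S (1 - τ)) (hS1 : S 1)
    (hrow : ∀ t < T, ∀ u < n, ∀ j ≤ N, S (∑ a ∈ range j with u ∈ digitSet k n a,
      scaledEntry (digitSet k n) A (scaleSweep N (digitSet k n) A (R 4) (R 5) τ
        (scaleRounds N (digitSet k n) A (R 4) (R 5) τ n t) u) a))
    (hent : ∀ t < T, ∀ u < n, ∀ a < N, S (scaledEntry (digitSet k n) A
      (scaleSweep N (digitSet k n) A (R 4) (R 5) τ
        (scaleRounds N (digitSet k n) A (R 4) (R 5) τ n t) (u + 1)) a))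
    (hprod : ∀ t < T, ∀ u < n, S (∏ v ∈ range n, scaleSweep N (digitSet k n) A (R 4) (R 5) τ
        (scaleRounds N (digitSet k n) A (R 4) (R 5) τ n t) (u + 1) v)) :
    (roundsProgram k).Within S (roundsTime k n N T) s
      (RoundState k m n N T A R (scaleRounds N (digitSet k n) A (R 4) (R 5) τ n T)) := by
  refine Within.mono (Within.seq (t₁ := 3)
    (t₂ := T * ((3 + ((n * (updateTime k N + 1) + 1) + 3 + 1) + 1) + 1) + 1)
    (within_block ?_ ?_)) (by unfold roundsTime; lia) fun _ h => h
  · simp [BlockAdmissible, Admissible]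
  refine (within_while (n := T) (fun t s' => s'.counter 6 = t ∧ RoundState k m n N T A R
    (scaleRounds N (digitSet k n) A (R 4) (R 5) τ n t) s') ?_ ?_ ?_).mono le_rfl fun s' h => h.2
  · refine ⟨?_, h.of_agree (fun i hi => ?_) rfl⟩
    · simp [blockEffect, effect]
    · simp only [loopCounters, List.mem_cons, List.not_mem_nil, or_false, not_or] at hi
      simp [blockEffect, effect, hi]
  · rintro t ht s₁ ⟨h6₁, h₁⟩
    refine ⟨by rw [h6₁, h₁.layout.c7]; exact ht, ?_⟩
    refine Within.seq (t₁ := 3) (t₂ := (n * (updateTime k N + 1) + 1) + 3 + 1)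
      (within_block ?_ (Within.seq (t₁ := n * (updateTime k N + 1) + 1) (t₂ := 3) ?_))
    · simp [BlockAdmissible, Admissible]
    refine (within_while (n := n) (fun u s' => s'.counter 5 = u ∧ s'.counter 6 = t ∧
      RoundState k m n N T A R (scaleSweep N (digitSet k n) A (R 4) (R 5) τ
        (scaleRounds N (digitSet k n) A (R 4) (R 5) τ n t) u) s') ?_ ?_ ?_).mono le_rfl ?_
    · refine ⟨?_, ?_, h₁.of_agree (fun i hi => ?_) rfl⟩
      · simp [blockEffect, effect]
      · simp [blockEffect, effect, h6₁]
      · simp only [loopCounters, List.mem_cons, List.not_mem_nil, or_false, not_or] at hi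
        simp [blockEffect, effect, hi]
    · rintro u hu s₂ ⟨h5₂, h6₂, h₂⟩
      refine ⟨by rw [h5₂, h₂.layout.digit.c2]; exact hu, ?_⟩
      refine (within_updateProgram h₂ h6 h7 h8 h5₂ hu hS6 hS7 hS1 (hrow t ht u hu)
        (hent t ht u hu) (hprod t ht u hu)).mono le_rfl ?_
      rintro s₃ ⟨h₃, h5₃, h6₃⟩
      exact ⟨h5₃, h6₃.trans h6₂, h₃⟩
    · rintro s₂ ⟨h5₂, h6₂, h₂⟩
      rw [h5₂, h₂.layout.digit.c2]; exact lt_irrefl _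
    · rintro s₂ ⟨h5₂, h6₂, h₂⟩
      refine within_block ?_ ⟨?_, h₂.of_agree (fun i hi => ?_) rfl⟩
      · simp [BlockAdmissible, Admissible]
      · simp [blockEffect, effect, h6₂, h₂.layout.digit.c1]
      · simp only [loopCounters, List.mem_cons, List.not_mem_nil, or_false, not_or] at hi
        simp [blockEffect, effect, hi]
  · rintro s' ⟨h6', h'⟩
    rw [h6', h'.layout.c7]; exact lt_irrefl _

end Program
end RoundLoop

/-! ### Counters and powers -/

section Setup
open Program

namespace Program
variable {S : ℝ → Prop} {k m n N T : ℕ} {s : Memory}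

/-- `c_3 := c_3 * c_2 ^ j` -/
def powerCounter : ℕ → Program
  | 0 => skip
  | j + 1 => seq (powerCounter j) (seq (mulCounter 15 3 2) (block [addCounter 3 15 11]))

lemma within_powerCounter (h1 : s.counter 1 = 1) (h3 : s.counter 3 = 1) (h11 : s.counter 11 = 0)
    (j : ℕ) : (powerCounter j).Within S (j * (6 * s.counter 2 + 12) + 1) s fun s' =>
      s'.cell = s.cell ∧ s'.counter 3 = s.counter 2 ^ j ∧ s.Agree [3, 12, 15] s' := by
  induction j with
  | zero => exact (within_skip ⟨rfl, by simp [h3], Memory.Agree.refl _ _⟩).mono (by lia) fun _ h => h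
  | succ j ih =>
    refine Within.mono (Within.seq (t₂ := (6 * s.counter 2 + 7) + 3 + 1) (ih.mono le_rfl ?_))
      (by rw [Nat.succ_mul]; lia) fun _ h => h
    rintro s₁ ⟨hc₁, h3₁, hag₁⟩
    have h2₁ : s₁.counter 2 = s.counter 2 := hag₁ 2 (by simp)
    refine Within.seq (t₁ := 6 * s.counter 2 + 7) (t₂ := 3)
      ((within_mulCounter (d := 15) (a := 3) (b := 2) (by lia) (by lia) (by lia) (by lia) (by lia)
      (by lia) ((hag₁ 1 (by simp)).trans h1)).mono (by rw [h2₁]) ?_)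
    rintro s₂ ⟨hc₂, h15₂, hag₂⟩
    have hag₂' := hag₁.trans (hag₂.mono (by simp))
    refine within_block (by simp [BlockAdmissible, Admissible])
      ⟨hc₂.trans hc₁, ?_, fun i hi => ?_⟩
    · simp [blockEffect, effect, h15₂, h3₁, h2₁, hag₂' 11 (by simp), h11, pow_succ]
    · have := hag₂' i hi
      simp only [List.mem_cons, List.not_mem_nil, or_false, not_or] at hi
      simp [blockEffect, effect, hi, this]

/-- Sets counters `21, …, 20 + j` to the addresses that follow the one in counter `20`. -/
def addressCounters : ℕ → Program
  | 0 => skip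
  | j + 1 => seq (addressCounters j) (block [addCounter (21 + j) (20 + j) 1])

lemma within_addressCounters (h1 : s.counter 1 = 1) (j : ℕ) :
    (addressCounters j).Within S (4 * j + 1) s fun s' => s'.cell = s.cell ∧
      (∀ i ≤ j, s'.counter (20 + i) = s.counter 20 + i) ∧
      ∀ i ≤ 20, s'.counter i = s.counter i := by
  induction j with
  | zero => exact within_skip ⟨rfl, fun i hi => by rw [Nat.le_zero.1 hi]; rfl, fun _ _ => rfl⟩
  | succ j ih =>
    refine Within.mono (Within.seq (t₂ := 3) (ih.mono le_rfl ?_)) (by lia) fun _ h => h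
    rintro s₁ ⟨hc₁, h20, hag⟩
    refine within_block (by simp [BlockAdmissible, Admissible]) ⟨hc₁, fun i hi => ?_, fun i hi => ?_⟩
    · rcases Nat.le_succ_iff_eq_or_le.1 hi with rfl | hi
      · have e : 20 + (j + 1) = 21 + j := by lia
        simp only [blockEffect, effect]
        rw [e, Function.update_self, h20 j le_rfl, hag 1 (by lia), h1]; lia
      · simp only [blockEffect, effect]
        rw [Function.update_of_ne (by lia), h20 i hi]
    · simp only [blockEffect, effect]
      rw [Function.update_of_ne (by lia), hag i hi]

lemma within_seq_block {ps : List Program} {q : Program} {Q : Memory → Prop} (t₂ : ℕ) {t : ℕ}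
    (h : BlockAdmissible S ps s) (hq : q.Within S t₂ (blockEffect ps s) Q)
    (ht : 2 * ps.length + 2 + t₂ ≤ t) : (seq (block ps) q).Within S t s Q :=
  Within.mono (Within.seq (t₁ := 2 * ps.length + 1) (within_block h hq le_rfl)) (by lia)
    fun _ h => h

lemma within_seq_mulCounter {d a b x y : ℕ} {q : Program} {Q : Memory → Prop} (t₂ : ℕ) {t : ℕ}
    (hd : (d ≠ 1 ∧ d ≠ 12 ∧ d ≠ a ∧ d ≠ b) ∧ a ≠ 12 ∧ b ≠ 12) (h1 : s.counter 1 = 1)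
    (ha : s.counter a = x) (hb : s.counter b = y)
    (hq : ∀ s₁ : Memory, s₁.cell = s.cell → s₁.counter d = x * y → s.Agree [d, 12] s₁ →
      q.Within S t₂ s₁ Q)
    (ht : 6 * y + 8 + t₂ ≤ t) : (seq (mulCounter d a b) q).Within S t s Q :=
  Within.mono (Within.seq (t₁ := 6 * y + 7) ((within_mulCounter hd.1.1 hd.1.2.1 hd.1.2.2.1
    hd.1.2.2.2 hd.2.1 hd.2.2 h1).mono (by rw [hb]) fun s₁ h₁ =>
      hq s₁ h₁.1 (by rw [h₁.2.1, ha, hb]) h₁.2.2)) (by lia) fun _ h => h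

/-- Computes the number of vertices and the size of the array. -/
def sizeCounters (k : ℕ) : Program :=
  seq (block [setCounter 1 1, setCounter 13 k]) (seq (mulCounter 2 13 0)
    (seq (block [setCounter 3 1]) (powerCounter k)))

lemma within_sizeCounters (h0 : s.counter 0 = m) (h11 : s.counter 11 = 0) :
    (sizeCounters k).Within S (k * (6 * (k * m) + 12) + 6 * m + 30) s fun s' =>
      s'.cell = s.cell ∧ s'.counter 0 = m ∧ s'.counter 1 = 1 ∧ s'.counter 2 = k * m ∧
      s'.counter 3 = (k * m) ^ k ∧ s'.counter 11 = 0 := by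
  refine within_seq_block (k * (6 * (k * m) + 12) + 6 * m + 20)
    (by simp [BlockAdmissible, Admissible]) ?_ (by simp; lia)
  refine within_seq_mulCounter (x := k) (y := m) (k * (6 * (k * m) + 12) + 10) (by simp)
    (by simp [blockEffect, effect]) (by simp [blockEffect, effect])
    (by simpa [blockEffect, effect] using h0) (fun s₁ hc₁ h2 hag => ?_) (by lia)
  have e0 := hag 0 (by simp)
  have e1 := hag 1 (by simp)
  have e11 := hag 11 (by simp)
  simp [blockEffect, effect] at e0 e1 e11
  rw [h0] at e0
  rw [h11] at e11
  refine within_seq_block (k * (6 * (k * m) + 12) + 1)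
    (by simp [BlockAdmissible, Admissible]) ?_ (by simp; lia)
  refine (within_powerCounter (by simp [blockEffect, effect, e1]) (by simp [blockEffect, effect])
    (by simp [blockEffect, effect, e11]) k).mono (by simp [blockEffect, effect, h2]) ?_
  rintro s₂ ⟨hc₂, h3, hag₂⟩
  have g0 := hag₂ 0 (by simp)
  have g1 := hag₂ 1 (by simp)
  have g2 := hag₂ 2 (by simp)
  have g11 := hag₂ 11 (by simp)
  simp [blockEffect, effect] at g0 g1 g2 g11 h3
  exact ⟨hc₂.trans hc₁, g0.trans e0, g1.trans e1, g2.trans h2, by rw [h3, h2], g11.trans e11⟩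

/-- Initializes the counters: the number of rounds `b m³`, the number `a m` that determines the step
size, the constant `d`, and the addresses of the scratch cells. -/
def setupCounters (k a b d : ℕ) : Program :=
  seq (sizeCounters k)
  (seq (block [subCounter 14 2 1, subCounter 18 2 0, setCounter 13 b, setCounter 19 a])
  (seq (mulCounter 15 13 0) (seq (mulCounter 13 15 0) (seq (mulCounter 7 13 0)
  (seq (mulCounter 16 19 0)
  (seq (block [setCounter 17 d, addCounter 20 3 11]) (addressCounters 16)))))))

/-- A bound for the number of steps of `setupCounters`. -/
def setupCountersTime (k m : ℕ) : ℕ := k * (6 * (k * m) + 12) + 30 * m + 200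

lemma within_setupCounters (hk : 0 < k) (hm : 0 < m) (a b d : ℕ) (h0 : s.counter 0 = m)
    (h11 : s.counter 11 = 0) :
    (setupCounters k a b d).Within S (setupCountersTime k m) s fun s' => s'.cell = s.cell ∧
      Layout m (k * m) ((k * m) ^ k) (b * m * m * m) s' ∧ s'.counter 16 = a * m ∧
      s'.counter 17 = d := by
  refine Within.mono (Within.seq (t₂ := 24 * m + 150) ((within_sizeCounters h0 h11).mono le_rfl ?_))
    (by unfold setupCountersTime; lia) fun _ h => h
  rintro s₁ ⟨hc₁, h0₁, h1₁, h2₁, h3₁, h11₁⟩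
  refine within_seq_block (24 * m + 140) (by simp [BlockAdmissible, Admissible]) ?_ (by simp; lia)
  refine within_seq_mulCounter (x := b) (y := m) (18 * m + 130) (by simp)
    (by simp [blockEffect, effect, h1₁]) (by simp [blockEffect, effect])
    (by simp [blockEffect, effect, h0₁]) (fun s₂ hc₂ h15₂ hag₂ => ?_) (by lia)
  have f := fun i hi => hag₂ i hi
  refine within_seq_mulCounter (x := b * m) (y := m) (12 * m + 120) (by simp)
    (by rw [hag₂ 1 (by simp)]; simp [blockEffect, effect, h1₁]) h15₂
    (by rw [hag₂ 0 (by simp)]; simp [blockEffect, effect, h0₁]) (fun s₃ hc₃ h13₃ hag₃ => ?_) (by lia)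
  refine within_seq_mulCounter (x := b * m * m) (y := m) (6 * m + 110) (by simp)
    (by rw [hag₃ 1 (by simp), hag₂ 1 (by simp)]; simp [blockEffect, effect, h1₁]) h13₃
    (by rw [hag₃ 0 (by simp), hag₂ 0 (by simp)]; simp [blockEffect, effect, h0₁])
    (fun s₄ hc₄ h7₄ hag₄ => ?_) (by lia)
  have hag : (blockEffect [subCounter 14 2 1, subCounter 18 2 0, setCounter 13 b,
      setCounter 19 a] s₁).Agree [15, 12, 13, 7] s₄ :=
    (hag₂.mono (by simp)).trans ((hag₃.mono (by simp)).trans (hag₄.mono (by simp)))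
  have g0 := hag 0 (by simp)
  have g1 := hag 1 (by simp)
  have g2 := hag 2 (by simp)
  have g3 := hag 3 (by simp)
  have g11 := hag 11 (by simp)
  have g14 := hag 14 (by simp)
  have g18 := hag 18 (by simp)
  have g19 := hag 19 (by simp)
  simp [blockEffect, effect] at g0 g1 g2 g3 g11 g14 g18 g19
  refine within_seq_mulCounter (x := a) (y := m) 100 (by simp)
    (g1.trans h1₁) g19 (g0.trans h0₁) (fun s₅ hc₅ h16₅ hag₅ => ?_) (by lia)
  refine within_seq_block 70 (by simp [BlockAdmissible, Admissible]) ?_ (by simp)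
  refine (within_addressCounters (by simp [blockEffect, effect, hag₅ 1 (by simp), g1, h1₁])
    16).mono (by lia) ?_
  rintro s₆ ⟨hc₆, h20, hag₆⟩
  have f20 : s₅.counter 3 + s₅.counter 11 = (k * m) ^ k := by
    rw [hag₅ 3 (by simp), hag₅ 11 (by simp), g3, g11, h3₁, h11₁, add_zero]
  have f := fun i (hi : i ≤ 20) (h17 : i ≠ 17) (h20 : i ≠ 20) (h16 : i ∉ [16, 12]) =>
    (hag₆ i hi).trans (by simp [blockEffect, effect, h17, h20] : _ = s₅.counter i) |>.trans
      (hag₅ i h16)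
  have hN : (blockEffect [setCounter 17 d, addCounter 20 3 11] s₅).counter 20 = (k * m) ^ k := by
    simpa [blockEffect, effect] using f20
  refine ⟨?_, ⟨⟨by positivity, ?_, ?_, ?_, ?_⟩, ?_, ?_, ?_, ?_, fun j hj => ?_⟩, ?_, ?_⟩
  · rw [hc₆]; exact hc₅.trans (hc₄.trans (hc₃.trans (hc₂.trans hc₁)))
  · rw [f 1 (by lia) (by lia) (by lia) (by simp), g1, h1₁]
  · rw [f 2 (by lia) (by lia) (by lia) (by simp), g2, h2₁]
  · rw [f 11 (by lia) (by lia) (by lia) (by simp), g11, h11₁]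
  · rw [f 14 (by lia) (by lia) (by lia) (by simp), g14, h1₁, h2₁]
  · rw [f 0 (by lia) (by lia) (by lia) (by simp), g0, h0₁]
  · rw [f 3 (by lia) (by lia) (by lia) (by simp), g3, h3₁]
  · rw [f 7 (by lia) (by lia) (by lia) (by simp), h7₄]
  · rw [f 18 (by lia) (by lia) (by lia) (by simp), g18, h0₁, h2₁]
  · rw [h20 j (by lia), hN]
  · rw [hag₆ 16 (by lia)]
    simpa [blockEffect, effect] using h16₅
  · rw [hag₆ 17 (by lia)]
    simp [blockEffect, effect]

/-- `r[c_d] := r[c_d] * r[c_b] ^ c_e`, with the help of counter `12`. -/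
def powerLoop (d b e : ℕ) : Program :=
  seq (block [setCounter 12 0])
    (whileCounterLt 12 e (block [arith .mul d d b, addCounter 12 12 1]))

lemma within_powerLoop {d b e x y z : ℕ} (hd : s.counter d = x) (hb : s.counter b = y)
    (he : s.counter e = z) (h1 : s.counter 1 = 1) (hdbe : d ≠ 12 ∧ b ≠ 12 ∧ e ≠ 12) (hxy : x ≠ y)
    (hS : ∀ j ≤ z, S (s.cell x * s.cell y ^ j)) :
    (powerLoop d b e).Within S (6 * z + 5) s fun s' =>
      s'.cell = Function.update s.cell x (s.cell x * s.cell y ^ z) ∧ s.Agree [12] s' := by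
  refine within_seq_block (6 * z + 1) (by simp [BlockAdmissible, Admissible]) ?_ (by simp; lia)
  refine (within_while (t := 5) (n := z) (fun j s' => s'.counter 12 = j ∧
    s'.cell = Function.update s.cell x (s.cell x * s.cell y ^ j) ∧ s.Agree [12] s')
    ?_ ?_ ?_).mono (by lia) fun s' h => h.2
  · refine ⟨by simp [blockEffect, effect], by simp [blockEffect, effect], fun i hi => ?_⟩
    simp only [List.mem_cons, List.not_mem_nil, or_false] at hi
    simp [blockEffect, effect, hi]
  · rintro j hj s₁ ⟨h12, hc, hag⟩
    have hd₁ : s₁.counter d = x := (hag d (by simp [hdbe])).trans hd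
    have hb₁ : s₁.counter b = y := (hag b (by simp [hdbe])).trans hb
    have he₁ : s₁.counter e = z := (hag e (by simp [hdbe])).trans he
    have h1₁ : s₁.counter 1 = 1 := (hag 1 (by simp)).trans h1
    have hval : s₁.cell (s₁.counter d) * s₁.cell (s₁.counter b) =
        s.cell x * s.cell y ^ (j + 1) := by
      rw [hd₁, hb₁, hc, Function.update_self, Function.update_of_ne hxy.symm, pow_succ, mul_assoc]
    refine ⟨by rw [h12, he₁]; exact hj, within_block ⟨⟨by simp, ?_⟩, trivial, trivial⟩
      ⟨?_, ?_, fun i hi => ?_⟩⟩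
    · rw [ArithOp.eval, hval]; exact hS _ hj
    · simp [blockEffect, effect, h12, h1₁]
    · simp only [blockEffect, effect, ArithOp.eval]
      rw [hval, hd₁, hc, Function.update_idem]
    · have := hag i hi
      simp only [List.mem_cons, List.not_mem_nil, or_false] at hi
      simp [blockEffect, effect, hi, this]
  · rintro s₁ ⟨h12, hc, hag⟩
    rw [h12, (hag e (by simp [hdbe])).trans he]; exact lt_irrefl _

end Program
end Setup

/-! ### The whole program -/

section Scratch
open Program

/-- The memory that holds the array `A` in the first `N` cells and the numbers `R` behind it. -/
noncomputable def joinedCells (N : ℕ) (A R : ℕ → ℝ) (a : ℕ) : ℝ := if a < N then A a else R (a - N)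

lemma joinedCells_add (N : ℕ) (A R : ℕ → ℝ) (j : ℕ) : joinedCells N A R (N + j) = R j := by
  rw [joinedCells, if_neg (by lia), Nat.add_sub_cancel_left]

lemma joinedCells_of_lt {N : ℕ} {A R : ℕ → ℝ} {a : ℕ} (ha : a < N) : joinedCells N A R a = A a :=
  if_pos ha

lemma joinedCells_update (N : ℕ) (A R : ℕ → ℝ) (j : ℕ) (x : ℝ) :
    Function.update (joinedCells N A R) (N + j) x = joinedCells N A (Function.update R j x) := by
  ext a
  by_cases h : a < N
  · rw [Function.update_of_ne (by lia), joinedCells_of_lt h, joinedCells_of_lt h]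
  · obtain ⟨i, rfl⟩ := Nat.exists_eq_add_of_le (not_lt.1 h)
    rw [joinedCells_add, Function.update_apply, Function.update_apply, joinedCells_add]
    simp

lemma eq_joinedCells (N : ℕ) (c : ℕ → ℝ) : c = joinedCells N c fun j => c (N + j) := by
  ext a
  rw [joinedCells]
  split_ifs with h
  · rfl
  · rw [Nat.add_sub_cancel' (not_lt.1 h)]

/-- The memory outside the loops: the array is followed by the numbers `R`. -/
structure ScratchState (m n N T : ℕ) (A R : ℕ → ℝ) (s : Memory) : Prop where
  layout : Layout m n N T s
  cell : s.cell = joinedCells N A R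

namespace Program
variable {S : ℝ → Prop} {k m n N T : ℕ} {A R : ℕ → ℝ} {s : Memory} {q : Program} {t : ℕ}
  {Q : Memory → Prop}

lemma within_seq_fromCounter {i j x : ℕ} (h : ScratchState m n N T A R s) (hj : s.counter j = x)
    (hS : S x) (hi : i < 17 := by norm_num)
    (hq : ∀ s', s'.counter = s.counter → ScratchState m n N T A (Function.update R i x) s' →
      q.Within S t s' Q) : (seq (fromCounter (20 + i) j) q).Within S (t + 2) s Q := by
  refine (Within.seq (t₁ := 1) (t₂ := t) (within_of_admissible ?_ (hq _ ?_ ⟨?_, ?_⟩))).mono (by lia)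
    fun _ h => h
  · rw [Admissible, hj]; exact hS
  · rfl
  · exact h.layout.agree fun _ _ => rfl
  · simp only [effect]
    rw [hj, h.layout.scratch i hi, h.cell, joinedCells_update]

lemma within_seq_arith {op : ArithOp} {i j l : ℕ} (h : ScratchState m n N T A R s)
    {x y : ℝ} (hx : R j = x) (hy : R l = y) (hy0 : op = .div → y ≠ 0) (hS : S (op.eval x y))
    (hq : ∀ s', s'.counter = s.counter →
      ScratchState m n N T A (Function.update R i (op.eval x y)) s' → q.Within S t s' Q)
    (hi : i < 17 := by norm_num) (hj : j < 17 := by norm_num) (hl : l < 17 := by norm_num) :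
    (seq (arith op (20 + i) (20 + j) (20 + l)) q).Within S (t + 2) s Q := by
  have hj' : s.cell (s.counter (20 + j)) = x := by
    rw [h.layout.scratch j hj, h.cell, joinedCells_add, hx]
  have hl' : s.cell (s.counter (20 + l)) = y := by
    rw [h.layout.scratch l hl, h.cell, joinedCells_add, hy]
  refine (Within.seq (t₁ := 1) (t₂ := t) (within_of_admissible ?_ (hq _ ?_ ⟨?_, ?_⟩))).mono
    (by lia) fun _ h => h
  · rw [Admissible, hj', hl']; exact ⟨hy0, hS⟩
  · rfl
  · exact h.layout.agree fun _ _ => rfl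
  · simp only [effect]
    rw [hj', hl', h.layout.scratch i hi, h.cell, joinedCells_update]

lemma within_seq_powerLoop {i j e z : ℕ} (h : ScratchState m n N T A R s)
    {x y : ℝ} (hx : R i = x) (hy : R j = y) (he : s.counter e = z) (hij : i ≠ j) (he12 : e ≠ 12)
    (hS : ∀ c ≤ z, S (x * y ^ c))
    (hq : ∀ s', s.Agree [12] s' →
      ScratchState m n N T A (Function.update R i (x * y ^ z)) s' → q.Within S t s' Q)
    (hi : i < 17 := by norm_num) (hj : j < 17 := by norm_num) :
    (seq (powerLoop (20 + i) (20 + j) e) q).Within S (t + 6 * z + 6) s Q := by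
  have hx' : s.cell (N + i) = x := by rw [h.cell, joinedCells_add, hx]
  have hy' : s.cell (N + j) = y := by rw [h.cell, joinedCells_add, hy]
  refine (Within.seq (t₁ := 6 * z + 5) (t₂ := t) ((within_powerLoop (h.layout.scratch i hi)
    (h.layout.scratch j hj) he h.layout.digit.c1 (by lia) (by lia)
    (by rw [hx', hy']; exact hS)).mono le_rfl ?_)).mono (by lia) fun _ h => h
  rintro s' ⟨hc, hag⟩
  refine hq s' hag ⟨h.layout.agree (hag.mono (by simp [loopCounters])), ?_⟩
  rw [hc, hx', hy', h.cell, joinedCells_update]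

/-- Writes the constants that the later parts use, then continues with `q`. -/
def constantsProgram (q : Program) : Program :=
  seq (fromCounter (20 + 8) 1) (seq (fromCounter (20 + 9) 16) (seq (fromCounter (20 + 11) 0)
  (seq (fromCounter (20 + 14) 1) (seq (fromCounter (20 + 16) 17) (seq (fromCounter (20 + 0) 11)
  (seq (arith .div (20 + 9) (20 + 8) (20 + 9)) (seq (arith .add (20 + 6) (20 + 8) (20 + 9))
  (seq (arith .sub (20 + 7) (20 + 8) (20 + 9)) (seq (arith .add (20 + 10) (20 + 9) (20 + 9))
  (seq (arith .mul (20 + 1) (20 + 8) (20 + 8)) (seq (arith .div (20 + 13) (20 + 8) (20 + 11))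
  (seq (arith .sub (20 + 13) (20 + 8) (20 + 13)) q))))))))))))

lemma within_constantsProgram {c d : ℕ} (h : ScratchState m n N T A R s)
    (h16 : s.counter 16 = c) (h17 : s.counter 17 = d) (hm : m ≠ 0) (hc : c ≠ 0)
    (hS : ∀ x ∈ [0, 1, (c : ℝ), m, d, 1 / c, 1 + 1 / c, 1 - 1 / c, 1 / c + 1 / c, 1 / m,
      1 - 1 / m], S x)
    (hq : ∀ s' R', ScratchState m n N T A R' s' → R' 0 = 0 → R' 1 = 1 → R' 6 = 1 + 1 / c →
      R' 7 = 1 - 1 / c → R' 8 = 1 → R' 10 = 1 / c + 1 / c → R' 11 = m → R' 13 = 1 - 1 / m →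
      R' 14 = 1 → R' 16 = d → q.Within S t s' Q) :
    (constantsProgram q).Within S (t + 26) s Q := by
  simp only [List.forall_mem_cons] at hS
  obtain ⟨S0, S1, Sc, Sm, Sd, Sτ, Sa, Sb, Sδ, Si, Sh, -⟩ := hS
  refine within_seq_fromCounter h h.layout.digit.c1 (by simpa using S1) (hq := fun s₁ e₁ h₁ => ?_)
  refine within_seq_fromCounter h₁ (by rw [e₁, h16]) Sc (hq := fun s₂ e₂ h₂ => ?_)
  refine within_seq_fromCounter h₂ h₂.layout.c0 Sm (hq := fun s₃ e₃ h₃ => ?_)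
  refine within_seq_fromCounter h₃ h₃.layout.digit.c1 (by simpa using S1) (hq := fun s₄ e₄ h₄ => ?_)
  refine within_seq_fromCounter h₄ (by rw [e₄, e₃, e₂, e₁, h17]) Sd (hq := fun s₅ e₅ h₅ => ?_)
  refine within_seq_fromCounter h₅ h₅.layout.digit.c11 (by simpa using S0)
    (hq := fun s₆ e₆ h₆ => ?_)
  refine within_seq_arith h₆ (x := 1) (y := c) (by simp)
    (by simp) (fun _ => by exact_mod_cast hc) Sτ fun s₇ _ h₇ => ?_
  refine within_seq_arith h₇ (x := 1) (y := 1 / c) (by simp)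
    (by simp [ArithOp.eval]) (by simp) Sa fun s₈ _ h₈ => ?_
  refine within_seq_arith h₈ (x := 1) (y := 1 / c) (by simp)
    (by simp [ArithOp.eval]) (by simp) Sb fun s₉ _ h₉ => ?_
  refine within_seq_arith h₉ (x := 1 / c) (y := 1 / c)
    (by simp [ArithOp.eval])
    (by simp [ArithOp.eval]) (by simp) Sδ fun s₁₀ _ h₁₀ => ?_
  refine within_seq_arith h₁₀ (x := 1) (y := 1) (by simp)
    (by simp) (by simp) (by simpa [ArithOp.eval] using S1)
    fun s₁₁ _ h₁₁ => ?_
  refine within_seq_arith h₁₁ (x := 1) (y := m) (by simp)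
    (by simp) (fun _ => by exact_mod_cast hm) Si fun s₁₂ _ h₁₂ => ?_
  refine within_seq_arith h₁₂ (x := 1) (y := 1 / m) (by simp)
    (by simp [ArithOp.eval]) (by simp) Sh fun s₁₃ _ h₁₃ => ?_
  refine hq s₁₃ _ h₁₃ ?_ ?_ ?_ ?_ ?_ ?_ ?_ ?_ ?_ ?_ <;>
    simp [ArithOp.eval]

/-- Adds up the array. -/
def totalProgram : Program :=
  seq (block [setCounter 4 0])
    (whileCounterLt 4 3 (block [arith .add 20 20 4, addCounter 4 4 1]))

lemma within_totalProgram (h : ScratchState m n N T A R s) (h0 : R 0 = 0)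
    (hS : ∀ j ≤ N, S (∑ a ∈ range j, A a)) :
    totalProgram.Within S (6 * N + 5) s
      (ScratchState m n N T A (Function.update R 0 (∑ a ∈ range N, A a))) := by
  refine within_seq_block (6 * N + 1) (by simp [BlockAdmissible, Admissible]) ?_ (by simp; lia)
  refine (within_while (t := 5) (n := N) (fun j s' => s'.counter 4 = j ∧
    ScratchState m n N T A (Function.update R 0 (∑ a ∈ range j, A a)) s') ?_ ?_ ?_).mono (by lia)
    fun s' h => h.2
  · refine ⟨by simp [blockEffect, effect], h.layout.agree fun i hi => ?_, ?_⟩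
    · simp only [loopCounters, List.mem_cons, List.not_mem_nil, or_false, not_or] at hi
      simp [blockEffect, effect, hi]
    · rw [range_zero, sum_empty, ← h0, Function.update_eq_self]
      exact h.cell
  · rintro j hj s₁ ⟨h4, h₁⟩
    have hval : s₁.cell (s₁.counter 20) + s₁.cell (s₁.counter 4) = ∑ a ∈ range (j + 1), A a := by
      rw [h₁.layout.scratch 0 (by lia), h₁.cell, joinedCells_add, Function.update_self, h4,
        joinedCells_of_lt hj, sum_range_succ]
    refine ⟨by rw [h4, h₁.layout.c3]; exact hj, within_block ⟨⟨by simp, ?_⟩, trivial, trivial⟩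
      ⟨?_, h₁.layout.agree fun i hi => ?_, ?_⟩⟩
    · rw [ArithOp.eval, hval]; exact hS _ hj
    · simp [blockEffect, effect, h4, h₁.layout.digit.c1]
    · simp only [loopCounters, List.mem_cons, List.not_mem_nil, or_false, not_or] at hi
      simp [blockEffect, effect, hi]
    · simp only [blockEffect, effect, ArithOp.eval]
      rw [hval, h₁.layout.scratch 0 (by lia), h₁.cell, joinedCells_update, Function.update_idem]
  · rintro s₁ ⟨h4, h₁⟩
    rw [h4, h₁.layout.c3]; exact lt_irrefl _

/-- Computes the bounds for the row sums, then continues with `q`. -/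
def boundsProgram (q : Program) : Program :=
  seq (arith .div (20 + 12) (20 + 0) (20 + 11)) (seq (arith .sub (20 + 4) (20 + 8) (20 + 10))
  (seq (arith .mul (20 + 4) (20 + 12) (20 + 4)) (seq (arith .add (20 + 5) (20 + 8) (20 + 10))
  (seq (arith .mul (20 + 5) (20 + 12) (20 + 5)) (seq (arith .div (20 + 16) (20 + 12) (20 + 16))
    q)))))

lemma within_boundsProgram {x δ d : ℝ} (h : ScratchState m n N T A R s) (hm : m ≠ 0) (hd : d ≠ 0)
    (h0 : R 0 = x) (h8 : R 8 = 1) (h10 : R 10 = δ) (h11 : R 11 = m) (h16 : R 16 = d)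
    (hS : ∀ y ∈ [x / m, 1 - δ, x / m * (1 - δ), 1 + δ, x / m * (1 + δ), x / m / d], S y)
    (hq : ∀ s' R', ScratchState m n N T A R' s' → R' 4 = x / m * (1 - δ) →
      R' 5 = x / m * (1 + δ) → R' 16 = x / m / d →
      (∀ i, i ∉ [4, 5, 12, 16] → R' i = R i) → q.Within S t s' Q) :
    (boundsProgram q).Within S (t + 12) s Q := by
  simp only [List.forall_mem_cons] at hS
  obtain ⟨Sa, Sb, Sc, Sd, Se, Sf, -⟩ := hS
  refine within_seq_arith h h0 h11 (fun _ => by exact_mod_cast hm) Sa fun s₁ _ h₁ => ?_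
  refine within_seq_arith h₁ (x := 1) (y := δ) (by simp [h8])
    (by simp [h10]) (by simp) Sb fun s₂ _ h₂ => ?_
  refine within_seq_arith h₂ (x := x / m) (y := 1 - δ)
    (by simp [ArithOp.eval])
    (by simp [ArithOp.eval]) (by simp) Sc fun s₃ _ h₃ => ?_
  refine within_seq_arith h₃ (x := 1) (y := δ) (by simp [h8])
    (by simp [h10]) (by simp) Sd fun s₄ _ h₄ => ?_
  refine within_seq_arith h₄ (x := x / m) (y := 1 + δ)
    (by simp [ArithOp.eval])
    (by simp [ArithOp.eval]) (by simp) Se fun s₅ _ h₅ => ?_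
  refine within_seq_arith h₅ (x := x / m) (y := d)
    (by simp [ArithOp.eval])
    (by simp [h16]) (fun _ => hd) Sf fun s₆ _ h₆ => ?_
  refine hq s₆ _ h₆ ?_ ?_ ?_ fun i hi => ?_
  · simp [ArithOp.eval]
  · simp [ArithOp.eval]
  · simp [ArithOp.eval]
  · simp only [List.mem_cons, List.not_mem_nil, or_false, not_or] at hi
    simp [hi]

/-- Computes the output from the product of the scaling factors. -/
def outputProgram : Program :=
  seq (arith .div (20 + 15) (20 + 8) (20 + 1)) (seq (powerLoop (20 + 14) (20 + 13) 0)
  (seq (powerLoop (20 + 15) (20 + 16) 0) (seq (powerLoop (20 + 15) (20 + 14) 18)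
    (block [arith .mul 11 35 28]))))

lemma within_outputProgram {x h g : ℝ} (hs : ScratchState m n N T A R s) (hx : x ≠ 0)
    (h1 : R 1 = x) (h8 : R 8 = 1) (h13 : R 13 = h) (h14 : R 14 = 1) (h16 : R 16 = g)
    (hS1 : S (1 / x)) (hS2 : ∀ j ≤ m, S (1 * h ^ j)) (hS3 : ∀ j ≤ m, S (1 / x * g ^ j))
    (hS4 : ∀ j ≤ n - m, S (1 / x * g ^ m * (1 * h ^ m) ^ j)) :
    outputProgram.Within S (12 * m + 6 * (n - m) + 30) s fun s' =>
      s'.cell 0 = 1 / x * g ^ m * (h ^ m) ^ (n - m) := by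
  refine Within.mono (t₁ := (3 + 6 * (n - m) + 6 + 6 * m + 6) + 6 * m + 6 + 2) ?_ (by lia)
    fun _ h => h
  refine within_seq_arith hs h8 h1 (fun _ => hx) hS1 fun s₁ _ h₁ => ?_
  refine within_seq_powerLoop h₁ (x := 1) (y := h) (by simp [h14])
    (by simp [h13]) h₁.layout.c0 (by lia) (by lia) hS2 fun s₂ _ h₂ => ?_
  refine within_seq_powerLoop h₂ (x := 1 / x) (y := g)
    (by simp [ArithOp.eval])
    (by simp [h16]) h₂.layout.c0 (by lia) (by lia) hS3 fun s₃ _ h₃ => ?_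
  refine within_seq_powerLoop h₃ (x := 1 / x * g ^ m) (y := 1 * h ^ m)
    (by simp)
    (by simp) h₃.layout.c18 (by lia) (by lia) hS4 fun s₄ _ h₄ => ?_
  have hval : s₄.cell (s₄.counter 35) * s₄.cell (s₄.counter 28) =
      1 / x * g ^ m * (1 * h ^ m) ^ (n - m) := by
    rw [show (35 : ℕ) = 20 + 15 from rfl, show (28 : ℕ) = 20 + 8 from rfl,
      h₄.layout.scratch 15 (by lia), h₄.layout.scratch 8 (by lia), h₄.cell, joinedCells_add,
      joinedCells_add]
    simp [h8]
  refine within_block ⟨⟨by simp, ?_⟩, trivial⟩ ?_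
  · rw [ArithOp.eval, hval]; exact hS4 _ le_rfl
  · simp only [blockEffect, effect, ArithOp.eval]
    rw [hval, h₄.layout.digit.c11, Function.update_self, one_mul]

/-- The whole algorithm. Here `k` is the uniformity, the step size is `1 / (a m)`, the number of rounds
is `b m³`, and `d` stands for `k!`, the number of array entries that belong to an edge. -/
def matchingProgram (k a b d : ℕ) : Program :=
  seq (setupCounters k a b d) (constantsProgram (seq totalProgram (boundsProgram
    (seq (roundsProgram k) outputProgram))))

/-- A bound for the number of steps of `matchingProgram`. -/
def matchingTime (k b m : ℕ) : ℕ :=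
  setupCountersTime k m + 6 * (k * m) ^ k + roundsTime k (k * m) ((k * m) ^ k) (b * m * m * m) +
    12 * m + 6 * (k * m - m) + 100

/-- The output of the algorithm in terms of the product `y` of all scaling factors and the sum `x` of the
array. The power of `1 - 1 / m` replaces `exp (-m (k - 1))`, which the machine cannot compute. -/
lemma within_matchingProgram {a b d : ℕ} (hk : 0 < k) (hm : 0 < m) (ha : 0 < a) (hd : 0 < d)
    (h0 : s.counter 0 = m) (h11 : s.counter 11 = 0) {n N T : ℕ} (hn : n = k * m) (hN : N = n ^ k)
    (hT : T = b * m * m * m) {τ x lo hi : ℝ} (hτ : τ = 1 / (a * m : ℕ))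
    (hx : x = ∑ i ∈ range N, s.cell i) (hlo : lo = x / m * (1 - (τ + τ)))
    (hhi : hi = x / m * (1 + (τ + τ))) {l : ℕ → ℕ → ℕ → ℝ}
    (hl : ∀ t u, l t u = scaleSweep N (digitSet k n) s.cell lo hi τ
      (scaleRounds N (digitSet k n) s.cell lo hi τ n t) u)
    {y : ℝ} (hy : y = ∏ u ∈ range n, scaleRounds N (digitSet k n) s.cell lo hi τ n T u)
    (hy0 : y ≠ 0)
    (hS1 : ∀ z ∈ [0, 1, ((a * m : ℕ) : ℝ), m, d, τ, 1 + τ, 1 - τ, τ + τ, 1 / m, 1 - 1 / m], S z)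
    (hS2 : ∀ j ≤ N, S (∑ i ∈ range j, s.cell i))
    (hS3 : ∀ z ∈ [x / m, 1 - (τ + τ), lo, 1 + (τ + τ), hi, x / m / d], S z)
    (hrow : ∀ t < T, ∀ u < n, ∀ j ≤ N, S (∑ a ∈ range j with u ∈ digitSet k n a,
      scaledEntry (digitSet k n) s.cell (l t u) a))
    (hent : ∀ t < T, ∀ u < n, ∀ a < N, S (scaledEntry (digitSet k n) s.cell (l t (u + 1)) a))
    (hprod : ∀ t < T, ∀ u < n, S (∏ v ∈ range n, l t (u + 1) v))
    (hS4 : S (1 / y)) (hS5 : ∀ j ≤ m, S (1 * (1 - 1 / m) ^ j))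
    (hS6 : ∀ j ≤ m, S (1 / y * (x / m / d) ^ j))
    (hS7 : ∀ j ≤ n - m, S (1 / y * (x / m / d) ^ m * (1 * (1 - 1 / m) ^ m) ^ j)) :
    (matchingProgram k a b d).Within S (matchingTime k b m) s fun s' =>
      s'.cell 0 = 1 / y * (x / m / d) ^ m * ((1 - 1 / m) ^ m) ^ (n - m) := by
  have ham : a * m ≠ 0 := by positivity
  refine Within.mono (Within.seq (t₁ := setupCountersTime k m)
    (t₂ := ((6 * N + 5) + (roundsTime k n N T + (12 * m + 6 * (n - m) + 30) + 1 + 12) + 1) + 26)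
    ((within_setupCounters hk hm a b d h0 h11).mono le_rfl ?_))
    (by unfold matchingTime; subst hn hN hT; lia) fun _ h => h
  rintro s₁ ⟨hc₁, hL₁, h16₁, h17₁⟩
  rw [← hn, ← hN, ← hT] at hL₁
  have h₁ : ScratchState m n N T s.cell (fun j => s.cell (N + j)) s₁ :=
    ⟨hL₁, hc₁.trans (eq_joinedCells N s.cell)⟩
  subst hτ
  refine within_constantsProgram h₁ h16₁ h17₁ hm.ne' ham (by simpa using hS1) ?_
  intro s₂ R h₂ e0 e1 e6 e7 e8 e10 e11 e13 e14 e16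
  refine Within.seq ((within_totalProgram h₂ e0 hS2).mono le_rfl fun s₃ h₃ => ?_)
  rw [← hx] at h₃
  have hd' : (d : ℝ) ≠ 0 := by exact_mod_cast hd.ne'
  rw [hlo, hhi] at hS3
  refine within_boundsProgram h₃ hm.ne' hd' (Function.update_self ..)
    (by simpa using e8) (by simpa using e10) (by simpa using e11) (by simpa using e16) hS3 ?_
  intro s₄ R' h₄ f4 f5 f16 f
  rw [← hlo] at f4
  rw [← hhi] at f5
  have f' : ∀ i, i ∉ [0, 4, 5, 12, 16] → R' i = R i := fun i hi => by
    rw [List.mem_cons, not_or] at hi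
    rw [f i hi.2, Function.update_of_ne hi.1]
  simp only [List.forall_mem_cons] at hS1
  obtain ⟨-, S1, -, -, -, -, Sa, Sb, -⟩ := hS1
  have h₄' : RoundState k m n N T s.cell R' (fun _ => 1) s₄ := by
    refine ⟨h₄.layout, fun i hi => ?_, ?_, fun j hj => ?_⟩
    · rw [h₄.cell, joinedCells_of_lt hi, scaledEntry, prod_const_one, mul_one]
    · rw [h₄.cell, joinedCells_add, prod_const_one, f' 1 (by simp), e1]
    · rw [h₄.cell, joinedCells_add]
  refine Within.seq ((within_roundsProgram h₄' ((f' 6 (by simp)).trans e6)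
    ((f' 7 (by simp)).trans e7) ((f' 8 (by simp)).trans e8) Sa Sb S1 ?_ ?_ ?_).mono le_rfl ?_)
  · simpa only [f4, f5, ← hl] using hrow
  · simpa only [f4, f5, ← hl] using hent
  · simpa only [f4, f5, ← hl] using hprod
  · intro s₅ h₅
    rw [f4, f5] at h₅
    have hR : ∀ i, 4 ≤ i → i ∉ [0, 4, 5, 12, 16] → s₅.cell (N + i) = R i := fun i hi hi' =>
      (h₅.rest i hi).trans (f' i hi')
    exact within_outputProgram ⟨h₅.layout, eq_joinedCells N s₅.cell⟩ hy0 (h₅.prod.trans hy.symm)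
      ((hR 8 (by lia) (by simp)).trans e8) ((hR 13 (by lia) (by simp)).trans e13)
      ((hR 14 (by lia) (by simp)).trans e14) ((h₅.rest 16 (by lia)).trans f16) hS4 hS5 hS6 hS7

end Program
end Scratch

/-! ### The array of weights -/

section Tuples
variable {V : Type*} [DecidableEq V]

/-- Every `k`-set is the image of `k!` tuples of length `k`. -/
lemma card_tuples_image_eq {k : ℕ} [Fintype V] {S : Finset V} (hS : #S = k) :
    #{f : Fin k → V | univ.image f = S} = k.factorial := by
  have e : Fin k ≃ {x // x ∈ S} := Fintype.equivOfCardEq (by simp [hS])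
  have h := Fintype.card_equiv e
  rw [Fintype.card_fin] at h
  rw [← h, ← card_univ]
  refine (card_bij (fun σ _ j => (σ j : V)) ?_ ?_ ?_).symm
  · intro σ _
    simp only [mem_filter, mem_univ, true_and]
    ext x
    simp only [mem_image, mem_univ, true_and]
    exact ⟨fun ⟨j, hj⟩ => hj ▸ (σ j).2, fun hx => ⟨σ.symm ⟨x, hx⟩, by simp⟩⟩
  · intro σ _ σ' _ hσ
    ext j
    exact congrFun hσ j
  · intro f hf
    simp only [mem_filter, mem_univ, true_and] at hf
    have hmem : ∀ j, f j ∈ S := fun j => hf ▸ mem_image_of_mem f (mem_univ j)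
    have hinj : Function.Injective f := by
      rw [← Set.injOn_univ, ← coe_univ, ← card_image_iff, hf, hS, card_univ, Fintype.card_fin]
    refine ⟨Equiv.ofBijective (fun j => ⟨f j, hmem j⟩) ⟨fun i j hij => hinj ?_, ?_⟩,
      mem_univ _, ?_⟩
    · simpa using hij
    · rintro ⟨x, hx⟩
      obtain ⟨j, -, hj⟩ := mem_image.1 (hf.symm ▸ hx)
      exact ⟨j, Subtype.ext hj⟩
    · rfl

/-- The positions of the vertices of `S` in the labelling. -/
def labelSet {n : ℕ} (label : Fin n ≃ V) (S : Finset V) : Finset ℕ :=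
  S.image fun v => (label.symm v : ℕ)

lemma labelSet_injOn {n : ℕ} (label : Fin n ≃ V) :
    Function.Injective fun v => (label.symm v : ℕ) :=
  fun _ _ h => label.symm.injective (Fin.val_injective h)

lemma prod_labelSet {n : ℕ} (label : Fin n ≃ V) (S : Finset V) (l : ℕ → ℝ) :
    ∏ u ∈ labelSet label S, l u = ∏ v ∈ S, l (label.symm v) :=
  prod_image fun _ _ _ _ h => labelSet_injOn label h

lemma mem_labelSet {n : ℕ} {label : Fin n ≃ V} {S : Finset V} {v : V} :
    (label.symm v : ℕ) ∈ labelSet label S ↔ v ∈ S := by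
  rw [labelSet, mem_image]
  exact ⟨fun ⟨x, hx, e⟩ => labelSet_injOn label e ▸ hx, fun h => ⟨v, h, rfl⟩⟩

/-- The digits of the address of a tuple are its entries. -/
lemma digitSet_finFunctionFinEquiv {k n : ℕ} (label : Fin n ≃ V) (v : Fin k → Fin n) :
    digitSet k n (finFunctionFinEquiv v) = labelSet label (univ.image fun i => label (v i)) := by
  have h : ∀ i : Fin k, (finFunctionFinEquiv v : ℕ) / n ^ (i : ℕ) % n = v i := fun i => by
    conv_rhs => rw [← finFunctionFinEquiv.symm_apply_apply v]
    rfl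
  rw [labelSet, image_image, digitSet]
  ext u
  simp only [mem_image, mem_range, mem_univ, true_and, Function.comp, Equiv.symm_apply_apply]
  exact ⟨fun ⟨i, hi, e⟩ => ⟨⟨i, hi⟩, (h ⟨i, hi⟩).symm.trans e⟩,
    fun ⟨i, e⟩ => ⟨i, i.2, (h i).trans e⟩⟩

/-- A sum over the array of weights counts every edge `k!` times. -/
lemma sum_inputMemory_cell [Fintype V] {k m : ℕ} {H : Finset (Finset V)} (hH : ∀ S ∈ H, #S = k)
    (W : {S // S ∈ H} → ℝ) (label : Fin (k * m) ≃ V) (G : Finset ℕ → ℝ) :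
    ∑ a ∈ range ((k * m) ^ k), (inputMemory k m W label).cell a * G (digitSet k (k * m) a) =
      k.factorial * ∑ S ∈ H, extendWeight W S * G (labelSet label S) := by
  have h1 : ∀ v : Fin k → Fin (k * m),
      (inputMemory k m W label).cell (finFunctionFinEquiv v) *
        G (digitSet k (k * m) (finFunctionFinEquiv v)) =
      (fun S => extendWeight W S * G (labelSet label S)) (univ.image fun i => label (v i)) := by
    intro v
    rw [digitSet_finFunctionFinEquiv label]
    congr 1
    simp only [inputMemory, Fin.is_lt, dite_true, Fin.eta, Equiv.symm_apply_apply, weightArray,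
      extendWeight]
    congr!
  rw [← Fin.sum_univ_eq_sum_range (fun a => (inputMemory k m W label).cell a *
    G (digitSet k (k * m) a)), ← finFunctionFinEquiv.sum_comp, sum_congr rfl fun v _ => h1 v]
  -- pass from tuples of labels to tuples of vertices
  have h2 := (Equiv.arrowCongr (Equiv.refl (Fin k)) label).sum_comp
    fun f : Fin k → V => (fun S => extendWeight W S * G (labelSet label S)) (univ.image f)
  refine Eq.trans ?_ (h2.trans ?_)
  · rfl
  have h3 : ∀ S ∉ H, extendWeight W S * G (labelSet label S) = 0 := fun S hS => by
    rw [extendWeight, dif_neg hS, zero_mul]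
  rw [← sum_fiberwise (g := fun f : Fin k → V => univ.image f), mul_sum,
    ← sum_subset (subset_univ H)]
  · refine sum_congr rfl fun S hS => ?_
    rw [sum_congr rfl (g := fun _ => extendWeight W S * G (labelSet label S)) fun f hf => by
      rw [(mem_filter.1 hf).2], sum_const, card_tuples_image_eq (hH S hS), nsmul_eq_mul]
  · intro S _ hS
    refine sum_eq_zero fun f hf => ?_
    dsimp only
    rw [(mem_filter.1 hf).2, h3 S hS]

end Tuples

/-! ### Accuracy of the output -/

section Accuracy
variable {V ι : Type*} [DecidableEq V] [DecidableEq ι] [Fintype ι]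
variable {c : V → ι} {κ : ι → ℕ} {U : Finset V} {m : ℕ}

/-- The dual objective function exceeds its value for trivial scaling factors, which is `-m`, by at
most `m log α`: compare with the uniform stochastic weight. -/
lemma sum_log_sub_le (h : HasOrder c κ U m) (hm : 1 ≤ m) (hk : 0 < ∑ i, κ i) {α : ℝ} (hα : 0 < α)
    {w : Finset V → ℝ} (hw : ∀ S ∈ profileEdges c κ U, 0 < w S)
    (hb : ∀ S ∈ profileEdges c κ U, ∀ T ∈ profileEdges c κ U, w S ≤ α * w T)
    {r : ℝ} (hr : 0 < r) (hrw : r * ∑ S ∈ profileEdges c κ U, w S = m)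
    {l : V → ℝ} (hl : ∀ v, 0 < l v) :
    ∑ v ∈ U, Real.log (l v) - r * ∑ S ∈ profileEdges c κ U, w S * ∏ v ∈ S, l v ≤
      m * Real.log α - m := by
  have hm0 : (0 : ℝ) < m := by exact_mod_cast hm
  have hE := card_profileEdges_pos h hm
  have hx : ∀ S ∈ profileEdges c κ U, 0 < r * w S := fun S hS => mul_pos hr (hw S hS)
  have hrow : ∀ v ∈ U, rowSum (profileEdges c κ U) (fun _ => m / #(profileEdges c κ U)) v = 1 :=
    fun v hv => rowSum_uniform h hm hv
  have h1 := sum_uniform_log_le (M := m) h hm hα hx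
    (fun S hS T hT => by
      have := mul_le_mul_of_nonneg_left (hb S hS T hT) hr.le
      linarith) (by rw [← mul_sum, hrw])
  rw [sum_mul_log_scaled (y := fun _ => (m : ℝ) / #(profileEdges c κ U)) hl hx
    (fun _ _ => by positivity) hrow, div_self hm0.ne', Real.log_one, mul_zero, zero_add] at h1
  have h2 : ∑ S ∈ profileEdges c κ U,
      ((m : ℝ) / #(profileEdges c κ U) - r * w S * ∏ u ∈ S, l u) ≤
      ∑ S ∈ profileEdges c κ U, (m / #(profileEdges c κ U) : ℝ) *
        Real.log (m / #(profileEdges c κ U) / (r * w S * ∏ v ∈ S, l v)) :=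
    sum_le_sum fun S hS =>
      sub_le_mul_log_div (mul_pos (hx S hS) (prod_pos fun v _ => hl v)) (by positivity)
  rw [sum_sub_distrib, sum_of_stochastic h hk hrow] at h2
  have h3 : ∑ S ∈ profileEdges c κ U, r * w S * ∏ u ∈ S, l u =
      r * ∑ S ∈ profileEdges c κ U, w S * ∏ v ∈ S, l v := by
    rw [mul_sum]; exact sum_congr rfl fun S _ => by ring
  linarith

/-- The power `(1 - 1 / m) ^ (m ^ 2)` is `exp (-m)` up to a constant factor. -/
lemma abs_sq_mul_log_add_le (hm : 2 ≤ m) :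
    |(m : ℝ) * (m * Real.log (1 - 1 / m)) + m| ≤ 2 := by
  have hm2 : (2 : ℝ) ≤ m := by exact_mod_cast hm
  have hm0 : (0 : ℝ) < m := by linarith
  have hx : (0 : ℝ) < 1 - 1 / m := by
    have : (1 : ℝ) / m < 1 := by rw [div_lt_one hm0]; linarith
    linarith
  have h1 := Real.log_le_sub_one_of_pos hx
  have h2 := Real.one_sub_inv_le_log_of_pos hx
  have h3 : (m : ℝ) * Real.log (1 - 1 / m) ≤ -1 := by
    have := mul_le_mul_of_nonneg_left h1 hm0.le
    have e : (m : ℝ) * (1 - 1 / m - 1) = -1 := by field_simp; ring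
    linarith
  have hm1 : (0 : ℝ) < m - 1 := by linarith
  have h4 : -(1 + 2 / m) ≤ (m : ℝ) * Real.log (1 - 1 / m) := by
    have := mul_le_mul_of_nonneg_left h2 hm0.le
    have e : (m : ℝ) * (1 - (1 - 1 / (m : ℝ))⁻¹) = -(m / (m - 1)) := by
      have : (1 : ℝ) - 1 / m = (m - 1) / m := by field_simp
      rw [this]; field_simp; ring
    have e2 : (m : ℝ) / (m - 1) ≤ 1 + 2 / m := by
      rw [div_le_iff₀ hm1]
      have : (2 : ℝ) / m * (m - 1) = 2 - 2 / m := by field_simp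
      have h5 : (2 : ℝ) / m ≤ 1 := by rw [div_le_one hm0]; exact hm2
      nlinarith
    linarith
  have h5 := mul_le_mul_of_nonneg_left h3 hm0.le
  have h6 := mul_le_mul_of_nonneg_left h4 hm0.le
  have e : (m : ℝ) * -(1 + 2 / m) = -m - 2 := by field_simp; ring
  rw [abs_le]; constructor <;> linarith

/-- After sufficiently many rounds, the output of the algorithm agrees with the partition function up to
a polynomial factor. -/
lemma abs_log_partitionFunction_sub_le [Fintype V] {k : ℕ} {H : Finset (Finset V)}
    (hH : H = profileEdges c κ univ) (hκ : ∑ i, κ i = k) (h : HasOrder c κ univ m) (hm : 2 ≤ m) (hk : 1 ≤ k) {α δ : ℝ} (hα : 1 ≤ α) (hδ0 : 0 < δ)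
    (hδ2 : δ ≤ 1 / 2) (hδα : δ * (4 * (1 + α) + 1) ≤ 1)
    (hδβ : 8 * (k : ℝ) * δ * (α * (2 * α) ^ k) ≤ 1) (hδm : δ * m ≤ 1)
    {W : {S // S ∈ H} → ℝ} (hW : IsBalanced α W)
    (label : Fin (k * m) ≃ V) {n N T : ℕ} (hn : n = k * m) (hN : N = n ^ k)
    (hT : m * Real.log α < T * (δ ^ 2 / 8)) {A : ℕ → ℝ} (hA : A = (inputMemory k m W label).cell)
    {x lo hi τ : ℝ} (hx : x = ∑ i ∈ range N, A i) (hlo : lo = x / m * (1 - δ))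
    (hhi : hi = x / m * (1 + δ)) (hτ : τ = δ / 2) {y : ℝ}
    (hy : y = ∏ u ∈ range n, scaleRounds N (digitSet k n) A lo hi τ n T u) :
    0 < partitionFunction W ∧ 0 < 1 / y * (x / m / k.factorial) ^ m *
        ((1 - 1 / m) ^ m) ^ (n - m) ∧
      |Real.log (partitionFunction W) - Real.log (1 / y * (x / m / k.factorial) ^ m *
        ((1 - 1 / m) ^ m) ^ (n - m))| ≤
      11 * k + removalConst k (α * (2 * α) ^ k) * Real.log m := by
  set w := extendWeight W with hwdef
  have hPw : partitionFunction W = matchingSum c κ univ w := by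
    subst hH; exact partitionFunction_eq W
  have hm1 : 1 ≤ m := by lia
  have hm0 : (0 : ℝ) < m := by exact_mod_cast hm1
  have hκpos : 0 < ∑ i, κ i := by lia
  have hα0 : 0 < α := by linarith
  have hw : ∀ S ∈ H, 0 < w S := fun S hS => by
    rw [hwdef, extendWeight, dif_pos hS]; exact hW.1 _
  have hb : ∀ S ∈ H, ∀ T ∈ H, w S ≤ α * w T := fun S hS T hT => by
    rw [hwdef, extendWeight, dif_pos hS, extendWeight, dif_pos hT]
    exact (div_le_iff₀ (hW.1 _)).1 (hW.2 ⟨S, hS⟩ ⟨T, hT⟩)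
  have hHk : ∀ S ∈ H, #S = k := fun S hS => (card_of_mem_profileEdges (hH ▸ hS)).trans hκ
  have hM : 0 < ∑ S ∈ H, w S := sum_pos hw (hH ▸ h.profileEdges_nonempty hm1)
  set M := ∑ S ∈ H, w S with hMdef
  have hf : (0 : ℝ) < k.factorial := by exact_mod_cast k.factorial_pos
  have hsum : ∀ G : Finset ℕ → ℝ, ∑ a ∈ range N, A a * G (digitSet k n a) =
      k.factorial * ∑ S ∈ H, w S * G (labelSet label S) := fun G => by
    subst hn hN hA; exact sum_inputMemory_cell hHk W label G
  have hxM : x = k.factorial * M := by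
    have := hsum fun _ => 1
    simp only [mul_one] at this
    rw [hx, this]
  have hx0 : 0 < x := hxM ▸ mul_pos hf hM
  have hr : 0 < m / x := div_pos hm0 hx0
  have hr' : 0 < m / M := div_pos hm0 hM
  have hrx : m / x * k.factorial = m / M := by rw [hxM]; field_simp
  have hentries : ∀ l : ℕ → ℝ, ∑ a ∈ range N, scaledEntry (digitSet k n) A l a =
      k.factorial * ∑ S ∈ H, w S * ∏ v ∈ S, l (label.symm v) := fun l => by
    have := hsum fun D => ∏ u ∈ D, l u
    simp only [prod_labelSet] at this
    exact this
  have hrows : ∀ (l : ℕ → ℝ) (v : V), scaledRow N (digitSet k n) A l (label.symm v) =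
      k.factorial * rowSum H (fun S => w S * ∏ u ∈ S, l (label.symm u)) v := fun l v => by
    have := hsum fun D => if (label.symm v : ℕ) ∈ D then ∏ u ∈ D, l u else 0
    simp only [prod_labelSet, mem_labelSet, mul_ite, mul_zero] at this
    rw [scaledRow, sum_filter, rowSum, sum_filter]
    exact this
  have hlabel : ∀ F : ℕ → ℝ, ∑ u ∈ range n, F u = ∑ v, F (label.symm v) := fun F => by
    rw [hn, ← Fin.sum_univ_eq_sum_range, ← label.symm.sum_comp]
  have hdual : ∀ l : ℕ → ℝ, (∀ v, 0 < l v) → dualValue N (digitSet k n) A n (m / x) l ≤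
      dualValue N (digitSet k n) A n (m / x) (fun _ => 1) + m * Real.log α := by
    intro l hl
    have h1 := sum_log_sub_le h hm1 hκpos hα0 (hH ▸ hw) (hH ▸ hb) hr'
      (by rw [← hH, ← hMdef]; field_simp)
      (l := fun v => l (label.symm v)) fun v => hl _
    rw [← hH] at h1
    rw [dualValue, dualValue, hentries, hentries, hlabel, ← mul_assoc, ← mul_assoc, hrx]
    simp only [Real.log_one, sum_const_zero, prod_const_one, mul_one]
    rw [← hMdef, div_mul_cancel₀ _ hM.ne']
    linarith
  have hτ0 : 0 < τ := by linarith
  have hτ1 : τ < 1 := by linarith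
  set L := scaleRounds N (digitSet k n) A lo hi τ n T with hL
  have hLpos : ∀ u, 0 < L u := scaleRounds_pos hτ0 hτ1 T
  have hbal : ∀ u < n, |m / x * scaledRow N (digitSet k n) A L u - 1| ≤ δ := fun u hu =>
    scaledRow_scaleRounds hδ0 hδ2 hr (by rw [hlo]; field_simp) (by rw [hhi]; field_simp)
      hτ hdual hT hu
  have hk0 : (0 : ℝ) < k := by exact_mod_cast hk
  -- The common factor turns the total weight into `m`.
  set ρ := Real.exp (Real.log (m / M) / k) with hρ
  have hρpos : 0 < ρ := Real.exp_pos _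
  have hρk : ρ ^ k = m / M := by
    rw [hρ, ← Real.exp_nat_mul, mul_div_cancel₀ _ hk0.ne', Real.exp_log hr']
  have hrow : ∀ v ∈ univ, |rowSum H
      (fun S => w S * ∏ u ∈ S, (ρ * L (label.symm u))) v - 1| ≤ δ := by
    intro v _
    have h1 := hbal (label.symm v) (by rw [hn]; exact (label.symm v).2)
    rw [hrows, ← mul_assoc, hrx] at h1
    convert h1 using 3
    rw [rowSum, rowSum, mul_sum]
    refine sum_congr rfl fun S hS => ?_
    rw [prod_mul_distrib, prod_const, hHk S (mem_filter.1 hS).1, hρk]; ring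
  have hmain := abs_log_matchingSum_add_le h hm (by lia) hα hδ0.le hδα (by rw [hκ]; exact hδβ) hδm
    (fun v => mul_pos hρpos (hLpos (label.symm v))) (hH ▸ hw) (hH ▸ hb) (hH ▸ hrow)
  rw [hκ] at hmain
  rw [hPw]
  have hy0 : 0 < y := hy ▸ prod_pos fun u _ => hLpos u
  have hlogy : ∑ v, Real.log (L (label.symm v)) = Real.log y := by
    rw [hy, Real.log_prod fun u _ => (hLpos u).ne', hlabel fun u => Real.log (L u)]
  have hcard : Fintype.card V = k * m := by rw [← Fintype.card_congr label, Fintype.card_fin]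
  have hsumlog : ∑ v, Real.log (ρ * L (label.symm v)) = m * Real.log (m / M) + Real.log y := by
    rw [← hlogy, sum_congr rfl fun v _ => Real.log_mul hρpos.ne' (hLpos _).ne', sum_add_distrib,
      sum_const, card_univ, hcard, hρ, Real.log_exp, nsmul_eq_mul, Nat.cast_mul]
    congr 1; field_simp
  have hh : (0 : ℝ) < 1 - 1 / m := by
    have hm2 : (2 : ℝ) ≤ m := by exact_mod_cast hm
    have : (1 : ℝ) / m < 1 := by rw [div_lt_one hm0]; linarith
    linarith
  have hg : x / m / k.factorial = M / m := by rw [hxM]; field_simp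
  have hg0 : 0 < M / m := div_pos hM hm0
  have hnm : ((n - m : ℕ) : ℝ) = (k - 1) * m := by
    rw [hn, Nat.cast_sub (Nat.le_mul_of_pos_left _ hk)]; push_cast; ring
  refine ⟨hmain.1, by rw [hg]; positivity, ?_⟩
  rw [hg, Real.log_mul (by positivity) (by positivity), Real.log_mul (by positivity)
    (by positivity), Real.log_pow, Real.log_pow, Real.log_pow, hnm, one_div, Real.log_inv]
  have h1 := hmain.2
  rw [hsumlog] at h1
  have h2 : Real.log (M / m) = -Real.log (m / M) := by rw [← Real.log_inv, inv_div]
  have h3 := abs_sq_mul_log_add_le hm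
  have hk1 : (0 : ℝ) ≤ k - 1 := sub_nonneg.2 (by exact_mod_cast hk)
  have h4 : |((k : ℝ) - 1) * ((m : ℝ) * (m * Real.log (1 - 1 / m)) + m)| ≤ (k - 1) * 2 := by
    rw [abs_mul, abs_of_nonneg hk1]
    exact mul_le_mul_of_nonneg_left h3 hk1
  rw [h2]
  generalize Real.log (1 - 1 / (m : ℝ)) = a at h4 ⊢
  have e : Real.log (matchingSum c κ univ w) - (-Real.log y + m * -Real.log (m / M) +
      (k - 1) * m * (m * a)) = (Real.log (matchingSum c κ univ w) +
        (m * Real.log (m / M) + Real.log y) + m * (k - 1)) -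
        (k - 1) * (m * (m * a) + m) := by ring
  rw [e]
  rw [abs_le] at h1 h4 ⊢
  constructor <;> linarith [h1.1, h1.2, h4.1, h4.2]

end Accuracy

/-! ### Bit sizes -/

section BitSizes

lemma HasBitSize.mono {a b : ℕ} {x : ℝ} (h : HasBitSize a x) (hab : a ≤ b) : HasBitSize b x := by
  obtain ⟨p, q, h1, h2, h3, h4⟩ := h
  exact ⟨p, q, h1, h2, h3.trans (pow_le_pow_right₀ (by norm_num) hab),
    h4.trans (Nat.pow_le_pow_right (by norm_num) hab)⟩

lemma HasBitSize.mul {a b : ℕ} {x y : ℝ} (hx : HasBitSize a x) (hy : HasBitSize b y) :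
    HasBitSize (a + b) (x * y) := by
  obtain ⟨p, q, h1, rfl, h3, h4⟩ := hx
  obtain ⟨p', q', h1', rfl, h3', h4'⟩ := hy
  refine ⟨p * p', q * q', by positivity, by push_cast; rw [div_mul_div_comm], ?_, ?_⟩
  · rw [abs_mul, pow_add]; gcongr
  · rw [pow_add]; gcongr

lemma HasBitSize.inv {a : ℕ} {x : ℝ} (hx : HasBitSize a x) : HasBitSize a x⁻¹ := by
  obtain ⟨p, q, h1, rfl, h3, h4⟩ := hx
  rcases eq_or_ne p 0 with rfl | hp
  · exact ⟨0, 1, one_pos, by simp, by simp, Nat.one_le_two_pow⟩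
  · refine ⟨p.sign * q, p.natAbs, Int.natAbs_pos.2 hp, ?_, ?_, ?_⟩
    · have hq : (q : ℝ) ≠ 0 := by positivity
      have hp' : (p : ℝ) ≠ 0 := by exact_mod_cast hp
      have h5 : ((p.natAbs : ℕ) : ℝ) = p.sign * p := by
        have : ((p.natAbs : ℕ) : ℤ) = p.sign * p := by
          rw [Int.natCast_natAbs, Int.sign_mul_self_eq_abs]
        rw [← Int.cast_natCast (R := ℝ), this, Int.cast_mul]
      have h6 : (p.sign : ℝ) ≠ 0 := by
        exact_mod_cast fun h => hp (Int.sign_eq_zero_iff_zero.1 h)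
      rw [h5]; push_cast; field_simp
    · rw [abs_mul, Int.abs_sign_of_ne_zero hp, one_mul, Nat.abs_cast]; exact_mod_cast h4
    · rw [← Int.natCast_natAbs] at h3; exact_mod_cast h3

lemma HasBitSize.add {a b : ℕ} {x y : ℝ} (hx : HasBitSize a x) (hy : HasBitSize b y) :
    HasBitSize (a + b + 1) (x + y) := by
  obtain ⟨p, q, h1, rfl, h3, h4⟩ := hx
  obtain ⟨p', q', h1', rfl, h3', h4'⟩ := hy
  have hq : (q : ℝ) ≠ 0 := by positivity
  have hq' : (q' : ℝ) ≠ 0 := by positivity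
  have h5 : (q : ℤ) ≤ 2 ^ a := by exact_mod_cast h4
  have h5' : (q' : ℤ) ≤ 2 ^ b := by exact_mod_cast h4'
  refine ⟨p * q' + q * p', q * q', by positivity, ?_, ?_, ?_⟩
  · push_cast; rw [div_add_div _ _ hq hq']
  · refine (abs_add_le _ _).trans ?_
    rw [abs_mul, abs_mul, Nat.abs_cast, Nat.abs_cast]
    calc |p| * q' + q * |p'| ≤ 2 ^ a * 2 ^ b + 2 ^ a * 2 ^ b := by gcongr
      _ = _ := by ring
  · calc q * q' ≤ 2 ^ a * 2 ^ b := by gcongr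
      _ ≤ _ := by rw [← pow_add]; exact Nat.pow_le_pow_right (by norm_num) (by lia)

lemma HasBitSize.neg {a : ℕ} {x : ℝ} (hx : HasBitSize a x) : HasBitSize a (-x) := by
  obtain ⟨p, q, h1, rfl, h3, h4⟩ := hx
  exact ⟨-p, q, h1, by push_cast; ring, by rwa [abs_neg], h4⟩

/-- The number `x` has bit size at most `b (L + 1)` whenever `h L` holds. Here `h L` says that the
input has bit size at most `L`; the bound `b` is the cost of `x`. -/
def BitCost (h : ℕ → Prop) (b : ℕ) (x : ℝ) : Prop := ∀ L, h L → HasBitSize (b * (L + 1)) x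

variable {h : ℕ → Prop} {a b : ℕ} {x y : ℝ}

namespace BitCost

lemma mono (hx : BitCost h a x) (hab : a ≤ b) : BitCost h b x :=
  fun L hL => (hx L hL).mono (Nat.mul_le_mul_right _ hab)

lemma add (hx : BitCost h a x) (hy : BitCost h b y) : BitCost h (a + b + 1) (x + y) :=
  fun L hL => ((hx L hL).add (hy L hL)).mono (by rw [add_mul, add_mul]; lia)

lemma sub (hx : BitCost h a x) (hy : BitCost h b y) : BitCost h (a + b + 1) (x - y) :=
  fun L hL => by
    rw [sub_eq_add_neg]
    exact ((hx L hL).add (hy L hL).neg).mono (by rw [add_mul, add_mul]; lia)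

lemma mul (hx : BitCost h a x) (hy : BitCost h b y) : BitCost h (a + b) (x * y) :=
  fun L hL => ((hx L hL).mul (hy L hL)).mono (by rw [add_mul])

lemma div (hx : BitCost h a x) (hy : BitCost h b y) : BitCost h (a + b) (x / y) :=
  fun L hL => by
    rw [div_eq_mul_inv]
    exact ((hx L hL).mul (hy L hL).inv).mono (by rw [add_mul])

lemma natCast (h : ℕ → Prop) (c : ℕ) : BitCost h c (c : ℝ) := fun L _ =>
  ⟨c, 1, one_pos, by simp,
    by rw [Nat.abs_cast]
       exact_mod_cast (Nat.lt_two_pow_self (n := c)).le.trans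
        (Nat.pow_le_pow_right (by norm_num) (Nat.le_mul_of_pos_right _ L.succ_pos)),
    Nat.one_le_two_pow⟩

lemma zero (h : ℕ → Prop) : BitCost h 0 0 := by simpa using natCast h 0

lemma one (h : ℕ → Prop) : BitCost h 0 1 := fun L _ =>
  ⟨1, 1, one_pos, by simp, by simp, Nat.one_le_two_pow⟩

lemma pow (hx : BitCost h a x) (j : ℕ) : BitCost h (j * a) (x ^ j) := by
  induction j with
  | zero => simpa using one h
  | succ j ih => rw [pow_succ, Nat.succ_mul]; exact ih.mul hx

lemma sum {ι : Type*} {s : Finset ι} {F : ι → ℝ} (hF : ∀ i ∈ s, BitCost h a (F i)) :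
    BitCost h (#s * (a + 1)) (∑ i ∈ s, F i) := by
  classical
  induction s using Finset.induction_on with
  | empty => simpa using zero h
  | insert i s hi ih =>
    rw [sum_insert hi, card_insert_of_notMem hi]
    exact ((hF i (mem_insert_self i s)).add
      (ih fun j hj => hF j (mem_insert_of_mem hj))).mono (by rw [Nat.succ_mul]; lia)

end BitCost

section Growth
variable {N : ℕ} {D : ℕ → Finset ℕ} {A : ℕ → ℝ} {lo hi τ c : ℝ} {n f : ℕ} {l : ℕ → ℝ}
  {B : Finset ℕ}

lemma bitCost_scaleFactor (hτ : BitCost h f (1 + τ)) (hτ' : BitCost h f (1 - τ)) (l : ℕ → ℝ)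
    (u : ℕ) : BitCost h f (scaleFactor N D A lo hi τ l u) := by
  rcases scaleFactor_mem (N := N) (D := D) (A := A) (lo := lo) (hi := hi) (τ := τ) l u with
    e | e | e <;> rw [e]
  exacts [hτ, hτ', (BitCost.one h).mono (Nat.zero_le _)]

/-- Every update multiplies a product of scaling factors by at most one new factor, so that bit
sizes grow only linearly. -/
lemma bitCost_scaleSweep (hτ : BitCost h f (1 + τ)) (hτ' : BitCost h f (1 - τ))
    (hl : BitCost h b (c * ∏ v ∈ B, l v)) (j : ℕ) :
    BitCost h (b + j * f) (c * ∏ v ∈ B, scaleSweep N D A lo hi τ l j v) := by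
  induction j with
  | zero => simpa [scaleSweep] using hl
  | succ j ih =>
    rw [scaleSweep, scaleStep, prod_update_mul, ← mul_assoc]
    refine (ih.mul (b := f) ?_).mono (by rw [Nat.succ_mul]; lia)
    split_ifs
    · exact bitCost_scaleFactor hτ hτ' _ _
    · exact (BitCost.one h).mono (Nat.zero_le _)

lemma bitCost_scaleRounds (hτ : BitCost h f (1 + τ)) (hτ' : BitCost h f (1 - τ))
    (hc : BitCost h b c) (t : ℕ) :
    BitCost h (b + t * (n * f)) (c * ∏ v ∈ B, scaleRounds N D A lo hi τ n t v) := by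
  induction t with
  | zero => simpa [scaleRounds] using hc
  | succ t ih =>
    rw [scaleRounds]
    exact (bitCost_scaleSweep hτ hτ' ih n).mono (by rw [Nat.succ_mul]; lia)

lemma bitCost_scaleSweep_scaleRounds (hτ : BitCost h f (1 + τ)) (hτ' : BitCost h f (1 - τ))
    (hc : BitCost h b c) {t T u : ℕ} (ht : t < T) (hu : u ≤ n) :
    BitCost h (b + T * (n * f))
      (c * ∏ v ∈ B, scaleSweep N D A lo hi τ (scaleRounds N D A lo hi τ n t) u v) :=
  (bitCost_scaleSweep hτ hτ' (bitCost_scaleRounds hτ hτ' hc t) u).mono (by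
    have h1 : u * f ≤ n * f := Nat.mul_le_mul_right _ hu
    have h2 : (t + 1) * (n * f) ≤ T * (n * f) := Nat.mul_le_mul_right _ ht
    rw [Nat.succ_mul] at h2
    lia)

end Growth

/-- A bound for the cost of all numbers that occur in the computation. -/
def matchingCost (k a b d m : ℕ) : ℕ :=
  (2 * (a * m) + m + d + 2) + (2 * (k * m) ^ k + m + d + 2 * (a * m) + 2) +
    ((k * m) ^ k + 1) * (b * m * m * m * (k * m * (a * m + 1)) + 2) +
    (m + k * m * m) * (m + 1) + m * (2 * (k * m) ^ k + m + d)

/-- All numbers that occur in the algorithm have polynomial cost. -/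
lemma within_matchingProgram_bitCost {h : ℕ → Prop} {s : Memory} {k m a b d : ℕ} (hk : 0 < k)
    (hm : 0 < m) (ha : 0 < a) (hd : 0 < d) (h0 : s.counter 0 = m) (h11 : s.counter 11 = 0)
    {n N T : ℕ} (hn : n = k * m) (hN : N = n ^ k)
    (hT : T = b * m * m * m) {τ x lo hi : ℝ} (hτ : τ = 1 / (a * m : ℕ)) (hτ1 : τ < 1)
    (hx : x = ∑ i ∈ range N, s.cell i) (hlo : lo = x / m * (1 - (τ + τ)))
    (hhi : hi = x / m * (1 + (τ + τ))) {y : ℝ}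
    (hy : y = ∏ u ∈ range n, scaleRounds N (digitSet k n) s.cell lo hi τ n T u)
    (hs : ∀ i, BitCost h 1 (s.cell i)) :
    (Program.matchingProgram k a b d).Within (BitCost h (matchingCost k a b d m)) (Program.matchingTime k b m) s
      fun s' => s'.cell 0 = 1 / y * (x / m / d) ^ m * ((1 - 1 / m) ^ m) ^ (n - m) := by
  have hτ0 : 0 < τ := by rw [hτ]; have : 0 < a * m := by positivity
                         positivity
  have c1 := BitCost.one h
  have cm := BitCost.natCast h m
  have cd := BitCost.natCast h d
  have cam := BitCost.natCast h (a * m)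
  have cτ : BitCost h (a * m) τ := by rw [hτ]; exact (c1.div cam).mono (by lia)
  have cp : BitCost h (a * m + 1) (1 + τ) := (c1.add cτ).mono (by lia)
  have cp' : BitCost h (a * m + 1) (1 - τ) := (c1.sub cτ).mono (by lia)
  have csum : ∀ j ≤ N, BitCost h (2 * N) (∑ i ∈ range j, s.cell i) := fun j hj =>
    (BitCost.sum fun i _ => hs i).mono (by rw [card_range]; lia)
  have cx : BitCost h (2 * N) x := hx ▸ csum N le_rfl
  have cg := cx.div cm
  have ch : BitCost h (m + 1) (1 - 1 / (m : ℝ)) := (c1.sub (c1.div cm)).mono (by lia)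
  set F := T * (n * (a * m + 1)) with hF
  have cy : BitCost h F y := by
    have := bitCost_scaleRounds (N := N) (D := digitSet k n) (A := s.cell) (lo := lo) (hi := hi)
      (B := range n) (n := n) cp cp' c1 T
    rw [one_mul, ← hy] at this
    exact this.mono (by lia)
  have cent : ∀ t < T, ∀ u ≤ n, ∀ i, BitCost h (F + 1) (scaledEntry (digitSet k n) s.cell
      (scaleSweep N (digitSet k n) s.cell lo hi τ
        (scaleRounds N (digitSet k n) s.cell lo hi τ n t) u) i) := fun t ht u hu i =>
    (bitCost_scaleSweep_scaleRounds cp cp' (hs i) ht hu).mono (by lia)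
  have hy0 : y ≠ 0 := by
    rw [hy]
    exact (prod_pos fun u _ => scaleRounds_pos hτ0 hτ1 T u).ne'
  have hcost : matchingCost k a b d m = (2 * (a * m) + m + d + 2) +
      (2 * N + m + d + 2 * (a * m) + 2) + (N + 1) * (F + 2) +
      (m + n * m) * (m + 1) + m * (2 * N + m + d) := by
    rw [hF, hT, hN, hn]; rfl
  rw [hcost]
  have e1 : (N + 1) * (F + 2) = N * (F + 2) + F + 2 := by ring
  have e2 : (m + n * m) * (m + 1) = m * (m + 1) + n * (m * (m + 1)) := by ring
  rw [e1, e2]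
  have cq : ∀ j ≤ m, BitCost h (F + m * (2 * N + m + d)) (1 / y * (x / m / d) ^ j) := fun j hj =>
    ((c1.div cy).mul ((cg.div cd).pow j)).mono (by
      have : j * (2 * N + m + d) ≤ m * (2 * N + m + d) := Nat.mul_le_mul_right _ hj
      lia)
  refine Program.within_matchingProgram hk hm ha hd h0 h11 hn hN hT hτ hx hlo hhi
    (l := fun t u => scaleSweep N (digitSet k n) s.cell lo hi τ
      (scaleRounds N (digitSet k n) s.cell lo hi τ n t) u) (fun _ _ => rfl) hy hy0 ?_ ?_ ?_ ?_ ?_ ?_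
    ?_ ?_ ?_ ?_
  · simp only [List.forall_mem_cons]
    exact ⟨(BitCost.zero h).mono (by lia), c1.mono (by lia), cam.mono (by lia), cm.mono (by lia),
      cd.mono (by lia), cτ.mono (by lia), cp.mono (by lia), cp'.mono (by lia),
      (cτ.add cτ).mono (by lia), (c1.div cm).mono (by lia), ch.mono (by lia), by simp⟩
  · exact fun j hj => (csum j hj).mono (by lia)
  · simp only [List.forall_mem_cons]
    have cl := c1.sub (cτ.add cτ)
    have cr := c1.add (cτ.add cτ)
    exact ⟨cg.mono (by lia), cl.mono (by lia), hlo ▸ (cg.mul cl).mono (by lia), cr.mono (by lia),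
      hhi ▸ (cg.mul cr).mono (by lia), (cg.div cd).mono (by lia), by simp⟩
  · intro t ht u hu j hj
    refine (BitCost.sum fun i _ => cent t ht u hu.le i).mono ?_
    have : #{i ∈ range j | u ∈ digitSet k n i} * (F + 1 + 1) ≤ N * (F + 2) :=
      Nat.mul_le_mul ((card_filter_le _ _).trans (by rwa [card_range])) le_rfl
    lia
  · exact fun t ht u hu i _ => (cent t ht (u + 1) hu i).mono (by lia)
  · intro t ht u hu
    have := bitCost_scaleSweep_scaleRounds (N := N) (D := digitSet k n) (A := s.cell) (lo := lo)
      (hi := hi) (B := range n) cp cp' c1 ht (u := u + 1) hu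
    rw [one_mul] at this
    exact this.mono (by lia)
  · exact (c1.div cy).mono (by lia)
  · intro j hj
    refine (c1.mul (ch.pow j)).mono ?_
    have : j * (m + 1) ≤ m * (m + 1) := Nat.mul_le_mul_right _ hj
    lia
  · exact fun j hj => (cq j hj).mono (by lia)
  · intro j hj
    refine ((cq m le_rfl).mul ((c1.mul (ch.pow m)).pow j)).mono ?_
    have : j * (m * (m + 1)) ≤ n * (m * (m + 1)) := Nat.mul_le_mul_right _ (by lia)
    lia

end BitSizes

/-! ### Polynomial bounds -/

section Polynomials

/-- The function is bounded by a polynomial on the positive integers. -/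
def PolyBounded (g : ℕ → ℕ) : Prop := ∃ C, ∀ m, 1 ≤ m → g m ≤ C * m ^ C

namespace PolyBounded
variable {f g : ℕ → ℕ}

lemma mono (hg : PolyBounded g) (h : ∀ m, f m ≤ g m) : PolyBounded f :=
  let ⟨C, hC⟩ := hg
  ⟨C, fun m hm => (h m).trans (hC m hm)⟩

lemma const (c : ℕ) : PolyBounded fun _ => c :=
  ⟨c, fun _ hm => Nat.le_mul_of_pos_right _ (Nat.pow_pos hm)⟩

lemma id : PolyBounded fun m => m := ⟨1, fun m _ => by simp⟩

lemma add (hf : PolyBounded f) (hg : PolyBounded g) : PolyBounded fun m => f m + g m := by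
  obtain ⟨C, hC⟩ := hf
  obtain ⟨D, hD⟩ := hg
  refine ⟨C + D, fun m hm => (Nat.add_le_add (hC m hm) (hD m hm)).trans ?_⟩
  rw [add_mul]
  exact Nat.add_le_add (Nat.mul_le_mul_left _ (Nat.pow_le_pow_right hm (by lia)))
    (Nat.mul_le_mul_left _ (Nat.pow_le_pow_right hm (by lia)))

lemma mul (hf : PolyBounded f) (hg : PolyBounded g) : PolyBounded fun m => f m * g m := by
  obtain ⟨C, hC⟩ := hf
  obtain ⟨D, hD⟩ := hg
  refine ⟨C * D + (C + D), fun m hm => (Nat.mul_le_mul (hC m hm) (hD m hm)).trans ?_⟩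
  calc C * m ^ C * (D * m ^ D) = C * D * m ^ (C + D) := by ring
    _ ≤ _ := Nat.mul_le_mul (by lia) (Nat.pow_le_pow_right hm (by lia))

lemma pow (hf : PolyBounded f) (k : ℕ) : PolyBounded fun m => f m ^ k := by
  induction k with
  | zero => simpa using const 1
  | succ k ih => simp only [pow_succ]; exact ih.mul hf

end PolyBounded

open PolyBounded Program in
lemma polyBounded_matchingTime (k b : ℕ) : PolyBounded (Program.matchingTime k b) := by
  have n : PolyBounded fun m => k * m := (const k).mul id
  have N : PolyBounded fun m => (k * m) ^ k := n.pow k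
  have T : PolyBounded fun m => b * m * m * m := (((const b).mul id).mul id).mul id
  have h : PolyBounded fun m => updateTime k ((k * m) ^ k) :=
    (((const 2).mul (N.mul (((const k).mul (((const 6).mul N).add (const 14))).add (const 15)))).add
      (const 27))
  refine (((((((const k).mul (((const 6).mul n).add (const 12))).add ((const 30).mul id)).add
    (const 200)).add ((const 6).mul N)).add ((T.mul ((n.mul (h.add (const 1))).add (const 10))).add
    (const 5))).add (((const 12).mul id).add (((const 6).mul n).add (const 100)))).mono fun m => ?_
  unfold matchingTime setupCountersTime roundsTime
  lia

open PolyBounded Program in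
lemma polyBounded_matchingCost (k a b d : ℕ) : PolyBounded (matchingCost k a b d) := by
  have n : PolyBounded fun m => k * m := (const k).mul id
  have A : PolyBounded fun m => a * m := (const a).mul id
  have N : PolyBounded fun m => (k * m) ^ k := n.pow k
  have T : PolyBounded fun m => b * m * m * m := (((const b).mul id).mul id).mul id
  exact ((((((((const 2).mul A).add id).add (const d)).add (const 2)).add
    ((((((const 2).mul N).add id).add (const d)).add ((const 2).mul A)).add (const 2))).add
    ((N.add (const 1)).mul ((T.mul (n.mul (A.add (const 1)))).add (const 2)))).add
    ((id.add (n.mul id)).mul (id.add (const 1)))).add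
    (id.mul ((((const 2).mul N).add id).add (const d)))

end Polynomials

/-! ### The approximation algorithm -/

section Conclusion

/-- The program approximates the partition function in polynomial time, with numbers of polynomial
bit size. -/
lemma exists_program (k : ℕ) (hk : 1 < k) {α : ℝ} (hα : 1 ≤ α) :
    ∃ (p : Program) (C : ℕ), ∀ {V ι : Type*} [DecidableEq V] [Fintype V] [DecidableEq ι] [Fintype ι]
      {c : V → ι} {κ : ι → ℕ} {m : ℕ} {H : Finset (Finset V)}, 1 < m → H = profileEdges c κ univ →
      ∑ i, κ i = k → HasOrder c κ univ m → ∀ {W : {S // S ∈ H} → ℝ}, IsBalanced α W →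
      ∀ label : Fin (k * m) ≃ V,
        (∃ t ≤ C * m ^ C, (p.run (inputMemory k m W label) t).todo = [] ∧
          0 < (p.run (inputMemory k m W label) t).mem.cell 0 ∧
          |Real.log (partitionFunction W) -
            Real.log ((p.run (inputMemory k m W label) t).mem.cell 0)| ≤
            11 * k + removalConst k (α * (2 * α) ^ k) * Real.log m) ∧
        ∀ L : ℕ, (∀ S, HasBitSize L (W S)) → ∀ t i : ℕ,
          (p.run (inputMemory k m W label) t).mem.counter i ≤ 2 ^ (C * (m + L) ^ C) ∧
          HasBitSize (C * (m + L) ^ C) ((p.run (inputMemory k m W label) t).mem.cell i) := by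
  -- The row sums have to be within `δ = 1 / (K m)` of `1`, and the dual objective function, which
  -- rises by at least `δ² / 8` in every sweep, can rise by at most `m log α`.
  obtain ⟨K, hK⟩ := exists_nat_ge (2 + (4 * (1 + α) + 1) + 8 * (k : ℝ) * (α * (2 * α) ^ k))
  obtain ⟨b, hb⟩ := exists_nat_gt (8 * (K : ℝ) ^ 2 * Real.log α)
  have hβ : 0 ≤ 8 * (k : ℝ) * (α * (2 * α) ^ k) := by positivity
  have hK2 : (2 : ℝ) ≤ K := by linarith
  have hK0 : 0 < K := by exact_mod_cast (by linarith : (0 : ℝ) < K)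
  obtain ⟨C₁, hC₁⟩ := polyBounded_matchingTime k b
  obtain ⟨C₂, hC₂⟩ := polyBounded_matchingCost k (2 * K) b k.factorial
  set p := Program.matchingProgram k (2 * K) b k.factorial with hp
  obtain ⟨C₃, hC₃⟩ := ((polyBounded_matchingTime k b).add PolyBounded.id).add
    (PolyBounded.const p.maxConst)
  refine ⟨p, C₁ + C₂ + C₃ + 1, ?_⟩
  intro V ι _ _ _ _ c κ m H hm hH hκ h W hW label
  set C := C₁ + C₂ + C₃ + 1 with hC
  have hm0 : (0 : ℝ) < m := by exact_mod_cast (by lia : 0 < m)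
  have hm2 : (2 : ℝ) ≤ m := by exact_mod_cast hm
  set s := inputMemory k m W label with hs
  set τ : ℝ := 1 / (2 * K * m : ℕ) with hτ
  have hδ : τ + τ = 1 / (K * m) := by
    rw [hτ]; push_cast; field_simp; norm_num
  have hKm : (0 : ℝ) < K * m := by positivity
  have hδK : τ + τ ≤ 1 / K := by
    rw [hδ]
    exact one_div_le_one_div_of_le (by linarith) (by nlinarith)
  have hτ0 : 0 < τ := by rw [hτ]; positivity
  have hdK : ∀ z : ℝ, z ≤ K → (τ + τ) * z ≤ 1 := fun z hz => by
    calc (τ + τ) * z ≤ (τ + τ) * K := by gcongr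
      _ ≤ 1 / K * K := by gcongr
      _ = 1 := by field_simp
  have hτ2 : τ + τ ≤ 1 / 2 := by have := hdK 2 hK2; linarith
  obtain ⟨hP, hη, hacc⟩ := abs_log_partitionFunction_sub_le hH hκ h hm hk.le hα
    (by linarith : 0 < τ + τ) hτ2
    (hdK _ (by linarith)) (by
      have := hdK (8 * (k : ℝ) * (α * (2 * α) ^ k)) (by linarith)
      linarith) (by rw [hδ]; rw [div_mul_eq_mul_div, one_mul, div_le_one hKm]; nlinarith)
    hW label rfl rfl (T := b * m * m * m) (by
      rw [hδ]; push_cast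
      have e : (b : ℝ) * m * m * m * ((1 / (K * m)) ^ 2 / 8) = m * (b / (8 * K ^ 2)) := by
        field_simp
      rw [e]
      refine mul_lt_mul_of_pos_left ?_ hm0
      rw [lt_div_iff₀ (by positivity)]; linarith) (A := s.cell) rfl rfl rfl rfl
    (τ := τ) (by ring) rfl
  have hcell : ∀ i, BitCost (fun L => ∀ S, HasBitSize L (W S)) 1 (s.cell i) := by
    intro i L hL
    have h0 : HasBitSize (1 * (L + 1)) 0 :=
      ⟨0, 1, one_pos, by simp, by simp, Nat.one_le_two_pow⟩
    simp only [hs, inputMemory, weightArray]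
    split_ifs
    · exact (hL _).mono (by lia)
    · exact h0
    · exact h0
  have hW' := within_matchingProgram_bitCost (s := s) (b := b) (by lia : 0 < k) (by lia : 0 < m)
    (by lia : 0 < 2 * K) k.factorial_pos rfl rfl rfl rfl rfl hτ (by linarith) rfl rfl rfl rfl hcell
  obtain ⟨t, ht, htodo, hout, hS, hlate⟩ := hW'.run fun i => (hcell i).mono (by
    unfold matchingCost; lia)
  rw [← hp] at htodo hout hS hlate
  refine ⟨⟨t, ht.trans ((hC₁ m (by lia)).trans ?_), htodo, ?_, ?_⟩, fun L hL j i => ⟨?_, ?_⟩⟩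
  · exact Nat.mul_le_mul (by lia) (Nat.pow_le_pow_right (by lia) (by lia))
  · rw [hout]; exact hη
  · rw [hout]; exact hacc
  · obtain ⟨j', hj', e⟩ := hlate j
    rw [e]
    have h1 := p.run_counter_le s (X := m + p.maxConst) (by lia) (fun i => by
      simp only [hs, inputMemory]; split_ifs <;> lia) j' i
    refine h1.trans ?_
    calc 2 ^ j' * (m + p.maxConst) ≤ 2 ^ j' * 2 ^ (m + p.maxConst) :=
          Nat.mul_le_mul_left _ Nat.lt_two_pow_self.le
      _ = 2 ^ (j' + (m + p.maxConst)) := (pow_add ..).symm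
      _ ≤ _ := Nat.pow_le_pow_right (by norm_num) ?_
    calc j' + (m + p.maxConst) ≤ C₃ * m ^ C₃ := le_trans (by lia) (hC₃ m (by lia))
      _ ≤ C * (m + L) ^ C := Nat.mul_le_mul (by lia)
        ((Nat.pow_le_pow_left (by lia) _).trans (Nat.pow_le_pow_right (by lia) (by lia)))
  · refine (hS j i L hL).mono ?_
    calc matchingCost k (2 * K) b k.factorial m * (L + 1) ≤ C₂ * m ^ C₂ * (L + 1) :=
          Nat.mul_le_mul_right _ (hC₂ m (by lia))
      _ ≤ C₂ * (m + L) ^ C₂ * (m + L) := Nat.mul_le_mul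
          (Nat.mul_le_mul_left _ (Nat.pow_le_pow_left (by lia) _)) (by lia)
      _ = C₂ * (m + L) ^ (C₂ + 1) := by ring
      _ ≤ _ := Nat.mul_le_mul (by lia) (Nat.pow_le_pow_right (by lia) (by lia))

end Conclusion
theorem theorem1p6 (k : ℕ) (hk : 1 < k) (α : ℝ) (hα : 1 ≤ α) :
    ∃ (γ : ℝ) (p : Program) (C : ℕ), 0 < γ ∧
      ∀ (V : Type*) [Fintype V] (m : ℕ) (H : Finset (Finset V)),
        1 < m → Fintype.card V = k * m →
        (IsCompleteUniform k H ∨ IsCompletePartite k m H) →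
        ∀ W : {S // S ∈ H} → ℝ, IsBalanced α W →
          -- the optimization problem is convex
          Convex ℝ (stochasticWeights H) ∧
          StrictConvexOn ℝ (stochasticWeights H) (entropyFun W) ∧
          -- the minimum exists and determines the partition function up to a factor `m ^ (± γ)`
          (∃ ζ : ℝ, IsLeast (entropyFun W '' stochasticWeights H) ζ ∧
            Real.exp (-ζ - m * (k - 1)) * (m : ℝ) ^ (-γ) ≤ partitionFunction W ∧
            partitionFunction W ≤ Real.exp (-ζ - m * (k - 1)) * (m : ℝ) ^ γ) ∧
          -- the program approximates the partition function in polynomial time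
          ∀ label : Fin (k * m) ≃ V,
            (∃ t ≤ C * m ^ C,
              (p.run (inputMemory k m W label) t).todo = [] ∧
              (p.run (inputMemory k m W label) t).mem.cell 0 * (m : ℝ) ^ (-γ)
                ≤ partitionFunction W ∧
              partitionFunction W
                ≤ (p.run (inputMemory k m W label) t).mem.cell 0 * (m : ℝ) ^ γ) ∧
            -- for rational weights, all numbers that occur have polynomial bit size
            ∀ L : ℕ, (∀ S, HasBitSize L (W S)) → ∀ t i : ℕ,
              (p.run (inputMemory k m W label) t).mem.counter i ≤ 2 ^ (C * (m + L) ^ C) ∧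
              HasBitSize (C * (m + L) ^ C) ((p.run (inputMemory k m W label) t).mem.cell i) := by
  obtain ⟨p, C, hp⟩ := exists_program k hk hα
  set R := removalConst k (α * (2 * α) ^ k) with hR
  have hbound : ∀ m : ℕ, 1 < m → 11 * (k : ℝ) + R * Real.log m ≤ (22 * k + |R|) * Real.log m := by
    intro m hm
    have h1 : Real.log 2 ≤ Real.log m := Real.log_le_log two_pos (by exact_mod_cast hm)
    have h2 := Real.log_two_gt_d9
    have h3 : R * Real.log m ≤ |R| * Real.log m :=
      mul_le_mul_of_nonneg_right (le_abs_self R) (by linarith)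
    have h4 : (k : ℝ) * (1 / 2) ≤ k * Real.log m :=
      mul_le_mul_of_nonneg_left (by linarith) (Nat.cast_nonneg k)
    linarith
  refine ⟨22 * k + |R|, p, C, by positivity, ?_⟩
  intro V _ m H hm hcard hH W hW
  classical
  obtain ⟨n, c, κ, hκ, horder, rfl⟩ := exists_profile hcard hH
  have hm0 : (0 : ℝ) < m := by exact_mod_cast (by lia : 0 < m)
  obtain ⟨ζ, hζ, hP, habs⟩ := exists_isLeast_entropyFun horder (by lia) (by lia) hα hW
  rw [hκ] at habs
  refine ⟨convex_stochasticWeights _, strictConvexOn_entropyFun hW.1, ⟨ζ, hζ, ?_⟩, fun label => ?_⟩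
  · refine rpow_bounds_of_abs_log_le hm0 hP (Real.exp_pos _) ?_
    rw [Real.log_exp]
    refine le_trans (le_of_eq ?_) ((habs.trans ?_).trans (hbound m hm))
    · congr 1; ring
    · have : (0 : ℝ) ≤ k := Nat.cast_nonneg k
      linarith
  · obtain ⟨⟨t, ht, htodo, hpos, hacc⟩, hbits⟩ := hp hm rfl hκ horder hW label
    exact ⟨⟨t, ht, htodo, rpow_bounds_of_abs_log_le hm0 hP hpos (hacc.trans (hbound m hm))⟩, hbits⟩
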